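/- **Setting.** For $N$ Ising spins $\sigma\in\{\pm1\}^N$ let $H_N(\sigma)=-\frac1{\sqrt N}\sum_{i<j}J_{ij}\sigma_i\sigma_j$ with $J_{ij}$ i.i.d. standard Gaussian (Sherrington–Kirkpatrick model, zero field), $Z_N(\beta)=\sum_\sigma e^{-\beta H_N(\sigma)}$, $\alpha_N(\beta)=\frac1N\mathbf E\ln Z_N(\beta)$ and $\alpha(\beta)=\lim_{N\to\infty}\alpha_N(\beta)$. Let $q_{ab}=\frac1N\sum_i\sigma^a_i\sigma^b_i$ be the overlap of replicas $a,b$ (independent samples of the Gibbs measure with the same $J$), and $\langle\cdot\rangle_N=\mathbf E\,\Omega[\cdot]$ the Gibbs average over all replicas followed by the average over $J$. A monomial in the overlaps is *filled* if every replica index occurs in it an even number of times. For numbers $g(\cdot)$ assigned to monomials put $$\begin{aligned}\mathcal E_\beta(g)=\ln2&+\tfrac{\beta^2}{4}\bigl[1+(1-\beta^2)\,g(q_{12}^2)\bigr]+\tfrac{\beta^6}{3}\,g(q_{12}q_{23}q_{31})\\&+\tfrac{\beta^8}{6}\,g(q_{12}^2q_{23}^2)-\tfrac{\beta^8}{8}\,g(q_{12}^2q_{34}^2)-\tfrac{3\beta^8}{4}\,g(q_{12}q_{23}q_{34}q_{41})\\&-\beta^{10}\,g(q_{12}q_{23}q_{31}q_{14}^2)+\tfrac{12\beta^{10}}{5}\,g(q_{12}q_{23}q_{34}q_{45}q_{51})+\tfrac{2\beta^{10}}{3}\,g(q_{12}q_{23}q_{31}q_{45}^2).\end{aligned}$$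 **Proposition (free energy expansion via irreducible overlap fluctuations).** The eight monomials occurring in $\mathcal E_\beta$ are filled, the limit $\alpha(\beta)$ exists for every $\beta\ge0$, and $\alpha(\beta)=\mathcal E_\beta(\langle\cdot\rangle)+O(\beta^{12})$ in the following sense. 1. For every $B>0$ there is $C=C(B)$ such that for all $\beta\in[0,B]$ $$\limsup_{N\to\infty}\bigl|\alpha(\beta)-\mathcal E_\beta(\langle\cdot\rangle_N)\bigr|\le C\beta^{12}.$$ 2. The neglected terms are of the order of filled graphs with six lines, multiplied by $\beta^{12}$: there is a countable set $S\subset\mathbb R$ such that for every $B>0$ there is $C=C(B)$ such that, for every $\beta\in[0,B]\setminus S$, (a) if $\langle m\rangle=\lim_{N\to\infty}\langle m\rangle_N$ exists for each of the eight monomials $m$ occurring in $\mathcal E_\beta$, then $$\bigl|\alpha(\beta)-\mathcal E_\beta(\langle\cdot\rangle)\bigr|\le C\beta^{12}\limsup_{N\to\infty}\langle q_{12}^6\rangle_N;$$ (b) without any assumption on the existence of limits, with the Cesàro means $\overline{\langle m\rangle}_n=\frac1n\sum_{N<n}\langle m\rangle_N$ (the term $N=0$ being immaterial), $$\limsup_{n\to\infty}\bigl|\alpha(\beta)-\mathcal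 E_\beta(\overline{\langle\cdot\rangle}_n)\bigr|\le C\beta^{12}\limsup_{n\to\infty}\overline{\langle q_{12}^6\rangle}_n.$$ -/

import Mathlib

open Filter Topology MeasureTheory ProbabilityTheory

namespace SK

/-- Configurations of `N` Ising spins. -/
abbrev Config (N : ℕ) : Type := Fin N → ℤˣ

/-- The real value `±1` of the spin at site `i`. -/
def spin {N : ℕ} (σ : Config N) (i : Fin N) : ℝ := ((σ i : ℤ) : ℝ)

/-- The pairs of sites `i < j`. -/
abbrev Bond (N : ℕ) : Type := {p : Fin N × Fin N // p.1 < p.2}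

/-- The law of the couplings: i.i.d. standard Gaussians `J_ij`, `i < j`. -/
noncomputable def disorder (N : ℕ) : Measure (Bond N → ℝ) :=
  Measure.pi fun _ => gaussianReal 0 1

/-- The Sherrington–Kirkpatrick Hamiltonian (zero external field). -/
noncomputable def hamiltonian {N : ℕ} (J : Bond N → ℝ) (σ : Config N) : ℝ :=
  -(1 / Real.sqrt N) * ∑ b : Bond N, J b * spin σ b.1.1 * spin σ b.1.2

/-- The partition function. -/
noncomputable def partitionFunction {N : ℕ} (β : ℝ) (J : Bond N → ℝ) : ℝ :=
  ∑ σ : Config N, Real.exp (-β * hamiltonian J σ)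

/-- The Gibbs weight of a configuration. -/
noncomputable def gibbs {N : ℕ} (β : ℝ) (J : Bond N → ℝ) (σ : Config N) : ℝ :=
  Real.exp (-β * hamiltonian J σ) / partitionFunction β J

/-- The finite-volume quenched `α_N(β) = N⁻¹ E ln Z_N(β)`. -/
noncomputable def alphaN (N : ℕ) (β : ℝ) : ℝ :=
  (∫ J, Real.log (partitionFunction β J) ∂(disorder N)) / N

/-- The limit `α(β)` of `α_N(β)` as `N → ∞`. -/
noncomputable def alpha (β : ℝ) : ℝ := limUnder atTop fun N : ℕ => alphaN N β

/-- The product thermal average `Ω` over `s` replicas sharing the same couplings. -/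
noncomputable def replicaAvg {N s : ℕ} (β : ℝ) (J : Bond N → ℝ)
    (f : (Fin s → Config N) → ℝ) : ℝ :=
  ∑ τ : Fin s → Config N, (∏ a, gibbs β J (τ a)) * f τ

/-- The overlap of two configurations. -/
noncomputable def overlap {N : ℕ} (σ τ : Config N) : ℝ := (∑ i, spin σ i * spin τ i) / N

/-- An overlap graph: the vertices are replicas (numbered from `0`), and a line `(a, b)`
stands for a factor `q_ab`; repeated lines are allowed. -/
structure OverlapGraph where
  /-- number of replicas -/
  replicas : ℕ
  /-- list of lines -/
  lines : List (Fin replicas × Fin replicas)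

namespace OverlapGraph

/-- The overlap monomial attached to a graph. -/
noncomputable def monomial (G : OverlapGraph) {N : ℕ} (τ : Fin G.replicas → Config N) : ℝ :=
  (G.lines.map fun e => overlap (τ e.1) (τ e.2)).prod

/-- The number of times a replica appears in the monomial. -/
def degree (G : OverlapGraph) (a : Fin G.replicas) : ℕ :=
  (G.lines.map fun e => (if e.1 = a then 1 else 0) + (if e.2 = a then 1 else 0)).sum

/-- A graph is filled when every replica appears an even number of times. -/
def Filled (G : OverlapGraph) : Prop := ∀ a, Even (G.degree a)

/-- `q₁₂²` -/
def doubleLine : OverlapGraph := ⟨2, [(0, 1), (0, 1)]⟩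

/-- `q₁₂ q₂₃ q₃₁` -/
def triangle : OverlapGraph := ⟨3, [(0, 1), (1, 2), (2, 0)]⟩

/-- `q₁₂² q₂₃²` -/
def twoDoubleLinesJoined : OverlapGraph := ⟨3, [(0, 1), (0, 1), (1, 2), (1, 2)]⟩

/-- `q₁₂² q₃₄²` -/
def twoDoubleLinesDisjoint : OverlapGraph := ⟨4, [(0, 1), (0, 1), (2, 3), (2, 3)]⟩

/-- `q₁₂ q₂₃ q₃₄ q₄₁` -/
def square : OverlapGraph := ⟨4, [(0, 1), (1, 2), (2, 3), (3, 0)]⟩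

/-- `q₁₂ q₂₃ q₃₁ q₁₄²` -/
def triangleDoubleLineJoined : OverlapGraph := ⟨4, [(0, 1), (1, 2), (2, 0), (0, 3), (0, 3)]⟩

/-- `q₁₂ q₂₃ q₃₄ q₄₅ q₅₁` -/
def pentagon : OverlapGraph := ⟨5, [(0, 1), (1, 2), (2, 3), (3, 4), (4, 0)]⟩

/-- `q₁₂ q₂₃ q₃₁ q₄₅²` -/
def triangleDoubleLineDisjoint : OverlapGraph := ⟨5, [(0, 1), (1, 2), (2, 0), (3, 4), (3, 4)]⟩

/-- `q₁₂⁶` -/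
def sixfoldLine : OverlapGraph := ⟨2, List.replicate 6 (0, 1)⟩

end OverlapGraph

open OverlapGraph

/-- The eight graphs that occur in the expansion. -/
def expansionGraphs : List OverlapGraph :=
  [doubleLine, triangle, twoDoubleLinesJoined, twoDoubleLinesDisjoint, square,
    triangleDoubleLineJoined, pentagon, triangleDoubleLineDisjoint]

/-- The average `⟨G⟩_N = E Ω[G]` of the overlap monomial of a graph for `N` spins. -/
noncomputable def graphAvg (N : ℕ) (β : ℝ) (G : OverlapGraph) : ℝ :=
  ∫ J, replicaAvg β J (fun τ => G.monomial (N := N) τ) ∂(disorder N)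

/-- The Cesàro mean `n⁻¹ ∑_{N < n} ⟨G⟩_N`. -/
noncomputable def cesaroAvg (n : ℕ) (β : ℝ) (G : OverlapGraph) : ℝ :=
  (∑ N ∈ Finset.range n, graphAvg N β G) / n

/-- The expansion of the free energy, as a function of `β` and of the values
`g G` taken by the averages of the graphs. -/
noncomputable def expansion (β : ℝ) (g : OverlapGraph → ℝ) : ℝ :=
  Real.log 2 + β ^ 2 / 4 * (1 + (1 - β ^ 2) * g doubleLine)
    + β ^ 6 / 3 * g triangle
    + β ^ 8 / 6 * g twoDoubleLinesJoined
    - β ^ 8 / 8 * g twoDoubleLinesDisjoint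
    - 3 * β ^ 8 / 4 * g square
    - β ^ 10 * g triangleDoubleLineJoined
    + 12 * β ^ 10 / 5 * g pentagon
    + 2 * β ^ 10 / 3 * g triangleDoubleLineDisjoint

end SK

/-! The free energy is telescoped: `alphaN n` is the Cesàro mean of the increments (N+1)α_{N+1} −
Nα_N (`sum_increment_div`), so it suffices to expand one increment. After a gauge transformation the
added spin decouples and contributes log 2. What remains is the N-spin system at β' = β√(N/(N+1)),
in a Gaussian field of strength β' on the sites (`alphaN_succ`). The increment is therefore log 2,
plus the effect of the field, minus N(α_N(β) − α_N(β')); the last term is asymptotic to β²/4 · (1 −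
⟨q₁₂²⟩).

The effect of a field of strength y is expanded in y². By Gaussian integration by parts, each
derivative in y² inserts one more overlap line in every possible way
(`hasDerivAt_integral_termsMean`). At y = 0 the spin-flip symmetry of each single replica kills
every graph that is not filled. The Taylor remainder has six lines; it is bounded by ⟨q₁₂⁶⟩ in the
field, and a Gronwall estimate brings this back to y = 0 (`abs_cavityLog_sub_le`). Graphs and
coefficients are computed in the kernel (`collectTerms`).

The result contains two unwanted graphs, q₁₂⁴ and q₁₂³q₂₃q₃₁. Differentiating ⟨q₁₂²⟩ and the
triangle in β inserts double lines with a prefactor N, while the same derivatives are bounded by the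
energy fluctuations. Convexity of log Z bounds these by increments of α_N', and they are o(N) unless
β lies in the countable set where the limsup of the monotone functions α_N' is discontinuous. The
inserted combinations then vanish in the limit (`tendsto_quenchedTerms_insertLines`) and eliminate
the two graphs. The same bound allows β' to be replaced by β in all quenched means
(`tendsto_quenchedLines_sub_cavityBeta`).

The limit α exists by Fekete's lemma: interpolation between Gaussian fields (`meanLog_le_meanLog`)
makes Nα_N superadditive, and the annealed value bounds it above.

The bound Cβ¹² at every β is obtained separately. For small β the quadratic cavity bound forces α to
be the annealed value and ⟨q₁₂²⟩ → 0, so the remainder tends to 0. For β ≥ β₀ > 0 all quantities are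
bounded and β¹² is bounded below. -/

namespace SK

/-! ### Gaussian integration by parts -/

/-- The law of independent standard Gaussians indexed by a finite type. -/
noncomputable def gaussianPi (ι : Type*) [Fintype ι] : Measure (ι → ℝ) :=
  Measure.pi fun _ => gaussianReal 0 1

instance (ι : Type*) [Fintype ι] : IsProbabilityMeasure (gaussianPi ι) := by
  unfold gaussianPi; infer_instance

/-- The standard Gaussian density solves p' = −xp; this is the whole source of Gaussian integration
by parts. -/
lemma hasDerivAt_gaussianPDFReal (x : ℝ) :
    HasDerivAt (gaussianPDFReal 0 1) (-(x * gaussianPDFReal 0 1 x)) x := by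
  have h : gaussianPDFReal 0 1 = fun x => (√(2 * Real.pi))⁻¹ * Real.exp (-x ^ 2 / 2) := by
    funext y; simp [gaussianPDFReal]
  rw [h]
  have h1 : HasDerivAt (fun x : ℝ => -x ^ 2 / 2) (-x) x :=
    (((hasDerivAt_pow 2 x).neg).div_const 2).congr_deriv (by norm_num; ring)
  exact ((h1.exp).const_mul ((√(2 * Real.pi))⁻¹)).congr_deriv (by ring)

lemma integrable_id_gaussianReal : Integrable (fun x : ℝ => x) (gaussianReal 0 1) :=
  (memLp_id_gaussianReal' 1 (by simp)).integrable le_rfl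

lemma integrable_mul_gaussianPDFReal {f : ℝ → ℝ} (hf : Integrable f (gaussianReal 0 1)) :
    Integrable (fun x => gaussianPDFReal 0 1 x * f x) := by
  rw [gaussianReal_of_var_ne_zero 0 one_ne_zero] at hf
  rw [integrable_withDensity_iff_integrable_smul₀'
    (measurable_gaussianPDF 0 1).aemeasurable (ae_of_all _ fun x => gaussianPDF_lt_top)] at hf
  simpa [toReal_gaussianPDF] using hf

/-- Gaussian integration by parts on the line. -/
lemma integral_mul_gaussianReal_eq_integral_deriv {f f' : ℝ → ℝ} {C : ℝ}
    (hf : ∀ x, HasDerivAt f (f' x) x) (hC : ∀ x, |f x| ≤ C) (hC' : ∀ x, |f' x| ≤ C) :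
    ∫ x, x * f x ∂(gaussianReal 0 1) = ∫ x, f' x ∂(gaussianReal 0 1) := by
  have hcont : Continuous f := continuous_iff_continuousAt.2 fun x => (hf x).continuousAt
  have hmeas : Measurable f' := by
    have : f' = deriv f := funext fun x => (hf x).deriv.symm
    rw [this]; exact measurable_deriv f
  have hif : Integrable f (gaussianReal 0 1) :=
    Integrable.of_bound hcont.aestronglyMeasurable C (ae_of_all _ hC)
  have hif' : Integrable f' (gaussianReal 0 1) :=
    Integrable.of_bound hmeas.aestronglyMeasurable C (ae_of_all _ hC')
  have hixf : Integrable (fun x => x * f x) (gaussianReal 0 1) :=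
    integrable_id_gaussianReal.mul_bdd hcont.aestronglyMeasurable (ae_of_all _ hC)
  have := integral_mul_deriv_eq_deriv_mul_of_integrable (u := f) (u' := f')
    (v := gaussianPDFReal 0 1) (v' := fun x => -(x * gaussianPDFReal 0 1 x))
    (fun x _ => hf x) (fun x _ => hasDerivAt_gaussianPDFReal x)
    (by
      convert (integrable_mul_gaussianPDFReal hixf).neg using 1
      funext x; simp; ring)
    (by
      convert (integrable_mul_gaussianPDFReal hif') using 1
      funext x; simp; ring)
    (by
      convert (integrable_mul_gaussianPDFReal hif) using 1
      funext x; simp; ring)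
  rw [integral_gaussianReal_eq_integral_smul one_ne_zero,
    integral_gaussianReal_eq_integral_smul one_ne_zero]
  simp only [smul_eq_mul]
  have e1 : ∫ x, gaussianPDFReal 0 1 x * (x * f x) = - ∫ x, f x * -(x * gaussianPDFReal 0 1 x) := by
    rw [← integral_neg]; congr 1; funext x; ring
  rw [e1, this, neg_neg]
  congr 1; funext x; ring

section Pi
variable {ι : Type*} [Fintype ι]

/-- Resampling one coordinate preserves the Gaussian product law. -/
lemma measurePreserving_update [DecidableEq ι] (k : ι) :
    MeasurePreserving (fun p : (ι → ℝ) × ℝ => Function.update p.1 k p.2)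
      ((gaussianPi ι).prod (gaussianReal 0 1)) (gaussianPi ι) := by
  have hm : Measurable (fun p : (ι → ℝ) × ℝ => Function.update p.1 k p.2) := by
    fun_prop
  refine ⟨hm, ?_⟩
  symm
  refine Measure.pi_eq fun s hs => ?_
  rw [Measure.map_apply hm (MeasurableSet.univ_pi hs)]
  -- The preimage of a box is a box whose side k is freed in the first factor and imposed on the new
  -- coordinate instead.
  have : (fun p : (ι → ℝ) × ℝ => Function.update p.1 k p.2) ⁻¹' (Set.univ.pi s)
      = (Set.univ.pi (Function.update s k Set.univ)) ×ˢ (s k) := by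
    ext ⟨J, x⟩
    simp only [Set.mem_preimage, Set.mem_pi, Set.mem_univ, true_implies, Set.mem_prod]
    constructor
    · intro h
      refine ⟨fun i => ?_, by simpa using h k⟩
      by_cases hi : i = k
      · subst hi; simp
      · simpa [hi] using h i
    · rintro ⟨h, hx⟩ i
      by_cases hi : i = k
      · subst hi; simpa using hx
      · simpa [hi] using h i
  rw [this, Measure.prod_prod, gaussianPi, Measure.pi_pi,
    ← Finset.mul_prod_erase _ _ (Finset.mem_univ k),
    ← Finset.mul_prod_erase Finset.univ (fun i => (gaussianReal 0 1) (s i)) (Finset.mem_univ k)]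
  simp only [Function.update_self, measure_univ, one_mul]
  rw [mul_comm]
  congr 1
  refine Finset.prod_congr rfl fun i hi => ?_
  rw [Function.update_of_ne (Finset.ne_of_mem_erase hi)]

lemma integrable_eval_gaussianPi (k : ι) : Integrable (fun J : ι → ℝ => J k) (gaussianPi ι) :=
  (measurePreserving_eval (fun _ : ι => gaussianReal 0 1) k).integrable_comp_of_integrable
    integrable_id_gaussianReal

/-- Gaussian integration by parts in one coordinate. -/
lemma integral_eval_mul_gaussianPi [DecidableEq ι] {f f' : (ι → ℝ) → ℝ} {C : ℝ} (k : ι)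
    (hf : ∀ J, HasDerivAt (fun x => f (Function.update J k x)) (f' J) (J k))
    (hm : Continuous f) (hm' : Continuous f')
    (hC : ∀ J, |f J| ≤ C) (hC' : ∀ J, |f' J| ≤ C) :
    ∫ J, J k * f J ∂(gaussianPi ι) = ∫ J, f' J ∂(gaussianPi ι) := by
  have mp := measurePreserving_update k
  have hi1 : Integrable (fun J : ι → ℝ => J k * f J) (gaussianPi ι) :=
    (integrable_eval_gaussianPi k).mul_bdd hm.aestronglyMeasurable (ae_of_all _ hC)
  have hi2 : Integrable f' (gaussianPi ι) :=
    Integrable.of_bound hm'.aestronglyMeasurable C (ae_of_all _ hC')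
  -- Resampling coordinate k and applying Fubini leaves the one-dimensional formula for each frozen
  -- J.
  rw [← mp.map_eq, integral_map mp.measurable.aemeasurable
      (by rw [mp.map_eq]; exact hi1.aestronglyMeasurable),
    integral_map mp.measurable.aemeasurable (by rw [mp.map_eq]; exact hi2.aestronglyMeasurable),
    integral_prod (fun p : (ι → ℝ) × ℝ => Function.update p.1 k p.2 k *
      f (Function.update p.1 k p.2)) (mp.integrable_comp_of_integrable hi1),
    integral_prod (fun p : (ι → ℝ) × ℝ => f' (Function.update p.1 k p.2))
      (mp.integrable_comp_of_integrable hi2)]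
  congr 1
  funext J
  simp only [Function.update_self]
  refine integral_mul_gaussianReal_eq_integral_deriv (C := C) (fun x => ?_) (fun x => hC _)
    (fun x => hC' _)
  simpa using hf (Function.update J k x)

end Pi
end SK
namespace SK

/-! ### Gibbs means and their derivatives -/

section GibbsMean
variable {Ω Ω' : Type*} [Fintype Ω] [Fintype Ω']

/-- The Gibbs mean of `F` for the weights `exp (W σ)`. -/
noncomputable def gmean (W F : Ω → ℝ) : ℝ :=
  (∑ σ, Real.exp (W σ) * F σ) / ∑ σ, Real.exp (W σ)

lemma sum_exp_pos [Nonempty Ω] (W : Ω → ℝ) : 0 < ∑ σ, Real.exp (W σ) :=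
  Finset.sum_pos (fun _ _ => Real.exp_pos _) Finset.univ_nonempty

lemma gmean_add (W F G : Ω → ℝ) :
    gmean W (fun σ => F σ + G σ) = gmean W F + gmean W G := by
  simp [gmean, mul_add, Finset.sum_add_distrib, add_div]

lemma gmean_sub (W F G : Ω → ℝ) :
    gmean W (fun σ => F σ - G σ) = gmean W F - gmean W G := by
  simp [gmean, mul_sub, Finset.sum_sub_distrib, sub_div]

lemma gmean_const_mul (W F : Ω → ℝ) (c : ℝ) :
    gmean W (fun σ => c * F σ) = c * gmean W F := by
  simp only [gmean, mul_left_comm _ c, ← Finset.mul_sum, mul_div_assoc]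

lemma gmean_mul_const (W F : Ω → ℝ) (c : ℝ) :
    gmean W (fun σ => F σ * c) = gmean W F * c := by
  simp only [mul_comm _ c, gmean_const_mul]

lemma gmean_sum {κ : Type*} (s : Finset κ) (W : Ω → ℝ) (F : κ → Ω → ℝ) :
    gmean W (fun σ => ∑ k ∈ s, F k σ) = ∑ k ∈ s, gmean W (F k) := by
  simp only [gmean, Finset.mul_sum, Finset.sum_div]
  exact Finset.sum_comm

lemma gmean_const [Nonempty Ω] (W : Ω → ℝ) (c : ℝ) : gmean W (fun _ => c) = c := by
  rw [gmean, ← Finset.sum_mul]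
  exact mul_div_cancel_left₀ _ (sum_exp_pos W).ne'

lemma gmean_mono [Nonempty Ω] (W : Ω → ℝ) {F G : Ω → ℝ} (h : ∀ σ, F σ ≤ G σ) :
    gmean W F ≤ gmean W G :=
  div_le_div_of_nonneg_right
    (Finset.sum_le_sum fun σ _ => mul_le_mul_of_nonneg_left (h σ) (Real.exp_pos _).le)
    (sum_exp_pos W).le

lemma gmean_nonneg [Nonempty Ω] (W : Ω → ℝ) {F : Ω → ℝ} (h : ∀ σ, 0 ≤ F σ) : 0 ≤ gmean W F := by
  simpa [gmean_const] using gmean_mono W (F := fun _ => 0) h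

lemma abs_gmean_le_gmean [Nonempty Ω] (W F : Ω → ℝ) : |gmean W F| ≤ gmean W (fun σ => |F σ|) := by
  rw [abs_le]
  constructor
  · rw [neg_le, ← neg_one_mul, ← gmean_const_mul]
    exact gmean_mono W fun σ => by rw [neg_one_mul]; exact neg_le_abs _
  · exact gmean_mono W fun σ => le_abs_self _

lemma abs_gmean_le [Nonempty Ω] (W : Ω → ℝ) {F : Ω → ℝ} {C : ℝ} (h : ∀ σ, |F σ| ≤ C) :
    |gmean W F| ≤ C :=
  (abs_gmean_le_gmean W F).trans ((gmean_mono W h).trans (gmean_const W C).le)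

lemma hasDerivAt_sum_exp {W : ℝ → Ω → ℝ} {W' : Ω → ℝ} {x : ℝ} (F : Ω → ℝ)
    (h : ∀ σ, HasDerivAt (fun y => W y σ) (W' σ) x) :
    HasDerivAt (fun y => ∑ σ, Real.exp (W y σ) * F σ)
      (∑ σ, Real.exp (W x σ) * (F σ * W' σ)) x := by
  refine (HasDerivAt.fun_sum fun σ _ => ((h σ).exp.mul_const (F σ))).congr_deriv ?_
  exact Finset.sum_congr rfl fun σ _ => by ring

/-- By the quotient rule, moving the energy differentiates a Gibbs mean into a covariance with the
derivative of the energy. -/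
lemma hasDerivAt_gmean [Nonempty Ω] {W : ℝ → Ω → ℝ} {W' : Ω → ℝ} {x : ℝ} (F : Ω → ℝ)
    (h : ∀ σ, HasDerivAt (fun y => W y σ) (W' σ) x) :
    HasDerivAt (fun y => gmean (W y) F)
      (gmean (W x) (fun σ => F σ * W' σ) - gmean (W x) F * gmean (W x) W') x := by
  have h1 := hasDerivAt_sum_exp F h
  have h2 := hasDerivAt_sum_exp (fun _ => 1) h
  simp only [mul_one, one_mul] at h2
  have hz := (sum_exp_pos (W x)).ne'
  refine (h1.div h2 hz).congr_deriv ?_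
  simp only [gmean]
  field_simp

lemma hasDerivAt_log_sum_exp [Nonempty Ω] {W : ℝ → Ω → ℝ} {W' : Ω → ℝ} {x : ℝ}
    (h : ∀ σ, HasDerivAt (fun y => W y σ) (W' σ) x) :
    HasDerivAt (fun y => Real.log (∑ σ, Real.exp (W y σ))) (gmean (W x) W') x := by
  have h2 := hasDerivAt_sum_exp (fun _ => 1) h
  simp only [mul_one, one_mul] at h2
  exact h2.log (sum_exp_pos (W x)).ne'

lemma continuous_gmean [Nonempty Ω] {X : Type*} [TopologicalSpace X] {W : X → Ω → ℝ}
    {F : X → Ω → ℝ} (hW : ∀ σ, Continuous fun x => W x σ) (hF : ∀ σ, Continuous fun x => F x σ) :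
    Continuous fun x => gmean (W x) (F x) := by
  refine Continuous.div ?_ ?_ fun x => (sum_exp_pos (W x)).ne'
  · exact continuous_finsetSum _ fun σ _ => (Real.continuous_exp.comp (hW σ)).mul (hF σ)
  · exact continuous_finsetSum _ fun σ _ => Real.continuous_exp.comp (hW σ)

lemma continuous_log_sum_exp [Nonempty Ω] {X : Type*} [TopologicalSpace X] {W : X → Ω → ℝ}
    (hW : ∀ σ, Continuous fun x => W x σ) :
    Continuous fun x => Real.log (∑ σ, Real.exp (W x σ)) :=
  Continuous.log (continuous_finsetSum _ fun σ _ => Real.continuous_exp.comp (hW σ))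
    fun x => (sum_exp_pos (W x)).ne'

/-- The sum lies between a single term and `card Ω` times the largest one. Applied with C linear in
the |J k|, this gives integrability of log Z. -/
lemma abs_log_sum_exp_le [Nonempty Ω] {W : Ω → ℝ} {C : ℝ} (h : ∀ σ, |W σ| ≤ C) :
    |Real.log (∑ σ, Real.exp (W σ))| ≤ Real.log (Fintype.card Ω) + C := by
  have hc : (1 : ℝ) ≤ Fintype.card Ω := by exact_mod_cast Fintype.card_pos
  have hup : ∑ σ, Real.exp (W σ) ≤ Fintype.card Ω * Real.exp C := by
    refine (Finset.sum_le_sum fun σ _ => Real.exp_le_exp.2 ((abs_le.1 (h σ)).2)).trans ?_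
    simp
  have hlo : Real.exp (-C) ≤ ∑ σ, Real.exp (W σ) := by
    obtain ⟨σ⟩ := ‹Nonempty Ω›
    exact (Real.exp_le_exp.2 (abs_le.1 (h σ)).1).trans
      (Finset.single_le_sum (f := fun σ => Real.exp (W σ)) (fun _ _ => (Real.exp_pos _).le)
        (Finset.mem_univ σ))
  have h1 := Real.log_le_log (sum_exp_pos W) hup
  rw [Real.log_mul (by positivity) (Real.exp_pos _).ne', Real.log_exp] at h1
  have h2 := Real.log_le_log (Real.exp_pos _) hlo
  rw [Real.log_exp] at h2
  have := Real.log_nonneg hc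
  rw [abs_le]
  constructor <;> linarith

lemma gmean_comp_equiv (e : Ω ≃ Ω') (W F : Ω' → ℝ) :
    gmean (fun σ => W (e σ)) (fun σ => F (e σ)) = gmean W F := by
  rw [gmean, gmean, e.sum_comp (fun σ => Real.exp (W σ) * F σ),
    e.sum_comp (fun σ => Real.exp (W σ))]

lemma gmean_prod (W : Ω → ℝ) (W' : Ω' → ℝ) (F : Ω → ℝ) (G : Ω' → ℝ) :
    gmean (fun p : Ω × Ω' => W p.1 + W' p.2) (fun p => F p.1 * G p.2) =
      gmean W F * gmean W' G := by
  simp only [gmean, Real.exp_add, Fintype.sum_prod_type]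
  rw [div_mul_div_comm, Finset.sum_mul_sum, Finset.sum_mul_sum]
  congr 1
  exact Finset.sum_congr rfl fun i _ => Finset.sum_congr rfl fun j _ => by ring

end GibbsMean

/-! ### Families of independent replicas -/

section Replicas
variable {Ω R R' C : Type*} [Fintype Ω] [Fintype R] [Fintype R'] [Fintype C]

/-- The energy of a family of replicas. -/
def repEnergy (R : Type*) [Fintype R] (W : Ω → ℝ) (τ : R → Ω) : ℝ := ∑ a, W (τ a)

variable [DecidableEq R] [DecidableEq R'] [DecidableEq C]

/-- The energy is additive over replicas, so the Boltzmann weights of two groups factorise. -/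
lemma gmean_sumType (W : Ω → ℝ) (F : (R → Ω) → ℝ) (G : (C → Ω) → ℝ) :
    gmean (repEnergy (R ⊕ C) W) (fun τ => F (fun a => τ (Sum.inl a)) * G (fun a => τ (Sum.inr a)))
      = gmean (repEnergy R W) F * gmean (repEnergy C W) G := by
  rw [← gmean_prod, ← gmean_comp_equiv (Equiv.sumArrowEquivProdArrow R C Ω)]
  congr 1
  funext τ
  simp [repEnergy, Equiv.sumArrowEquivProdArrow]

/-- Replicas that do not occur can be dropped. -/
lemma gmean_comp_injective [Nonempty Ω] (W : Ω → ℝ) (F : (R → Ω) → ℝ) {e : R → R'}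
    (he : Function.Injective e) :
    gmean (repEnergy R' W) (fun τ => F (fun a => τ (e a))) = gmean (repEnergy R W) F := by
  classical
  -- The replicas outside the range of `e` form a second group carrying the observable 1.
  let C' := {x : R' // x ∉ Set.range e}
  let E : R ⊕ C' ≃ R' :=
    ((Equiv.ofInjective e he).sumCongr (Equiv.refl _)).trans (Equiv.Set.sumCompl (Set.range e))
  have hE : ∀ a, E (Sum.inl a) = e a := fun a => rfl
  have h := gmean_sumType (C := C') W F (fun _ => 1)
  rw [gmean_const, mul_one] at h
  rw [← h, ← gmean_comp_equiv (E.arrowCongr (Equiv.refl Ω)).symm]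
  congr 1
  · funext τ
    simp only [repEnergy]
    rw [← E.sum_comp]
    rfl
  · funext τ
    rw [mul_one]
    rfl

/-- Disjoint groups of replicas are independent. -/
lemma gmean_mul_of_disjoint [Nonempty Ω] (W : Ω → ℝ) (F : (R → Ω) → ℝ) (G : (C → Ω) → ℝ)
    {e : R → R'} {e' : C → R'} (h : Function.Injective (Sum.elim e e')) :
    gmean (repEnergy R' W) (fun τ => F (fun a => τ (e a)) * G (fun a => τ (e' a)))
      = gmean (repEnergy R W) F * gmean (repEnergy C W) G := by
  rw [← gmean_sumType, ← gmean_comp_injective W _ h]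
  rfl

lemma gmean_unique (W : Ω → ℝ) [Unique R] (g : Ω → ℝ) :
    gmean (repEnergy R W) (fun τ => g (τ default)) = gmean W g := by
  rw [← gmean_comp_equiv (Equiv.funUnique R Ω) W g]
  congr 1
  funext τ
  simp [repEnergy]

lemma gmean_repEnergy_apply [Nonempty Ω] (W : Ω → ℝ) (g : Ω → ℝ) (a : R) :
    gmean (repEnergy R W) (fun τ => g (τ a)) = gmean W g := by
  rw [← gmean_unique (R := Unit) W g]
  exact gmean_comp_injective W (fun τ : Unit → Ω => g (τ default)) (e := fun _ => a)
    (Function.injective_of_subsingleton _)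

end Replicas
end SK
namespace SK

/-! ### Gaussian fields: differentiation along a path of amplitudes -/

section Field
variable {ι Ω : Type*} [Fintype ι]

/-- The Gaussian field with amplitudes `a` and patterns `c`. -/
def field (a : ι → ℝ) (c : ι → Ω → ℝ) (J : ι → ℝ) (σ : Ω) : ℝ := ∑ k, a k * c k σ * J k

lemma continuous_field (a : ι → ℝ) (c : ι → Ω → ℝ) (σ : Ω) : Continuous fun J => field a c J σ := by
  unfold field; fun_prop

lemma hasDerivAt_field {a a' : ι → ℝ → ℝ} (ha : ∀ k x, HasDerivAt (a k) (a' k x) x)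
    (c : ι → Ω → ℝ) (J : ι → ℝ) (x : ℝ) (σ : Ω) :
    HasDerivAt (fun y => field (fun k => a k y) c J σ) (field (fun k => a' k x) c J σ) x :=
  HasDerivAt.fun_sum fun k _ => ((ha k x).mul_const _).mul_const _

lemma hasDerivAt_field_update [DecidableEq ι] (a : ι → ℝ) (c : ι → Ω → ℝ) (J : ι → ℝ) (k : ι)
    (σ : Ω) (x : ℝ) :
    HasDerivAt (fun y => field a c (Function.update J k y) σ) (a k * c k σ) x := by
  have : ∀ i ∈ Finset.univ, HasDerivAt (fun y => a i * c i σ * Function.update J k y i)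
      (if i = k then a k * c k σ else 0) x := by
    intro i _
    by_cases hi : i = k
    · subst hi
      simpa using (hasDerivAt_id x).const_mul (a i * c i σ)
    · simpa [hi] using hasDerivAt_const x (a i * c i σ * J i)
  refine (HasDerivAt.fun_sum this).congr_deriv ?_
  simp

lemma abs_field_le {a : ι → ℝ} {A : ℝ} (ha : ∀ k, |a k| ≤ A) {c : ι → Ω → ℝ} {M : ℝ}
    (hc : ∀ k σ, |c k σ| ≤ M) (J : ι → ℝ) (σ : Ω) :
    |field a c J σ| ≤ A * M * ∑ k, |J k| := by
  rw [Finset.mul_sum]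
  refine (Finset.abs_sum_le_sum_abs _ _).trans (Finset.sum_le_sum fun k _ => ?_)
  rw [abs_mul, abs_mul]
  have := (abs_nonneg _).trans (ha k)
  gcongr
  · exact ha k
  · exact hc k σ

lemma integrable_sum_abs : Integrable (fun J : ι → ℝ => ∑ k, |J k|) (gaussianPi ι) :=
  integrable_finsetSum _ fun k _ => (integrable_eval_gaussianPi k).abs

variable [Fintype Ω]

lemma exists_abs_le (f : ι → Ω → ℝ) : ∃ M, 0 ≤ M ∧ ∀ k σ, |f k σ| ≤ M := by
  refine ⟨∑ k, ∑ σ, |f k σ|, by positivity, fun k σ => ?_⟩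
  exact (Finset.single_le_sum (f := fun σ => |f k σ|) (fun _ _ => abs_nonneg _)
    (Finset.mem_univ σ)).trans (Finset.single_le_sum (f := fun k => ∑ σ, |f k σ|)
      (fun _ _ => by positivity) (Finset.mem_univ k))

lemma exists_abs_le_one (f : ι → ℝ) : ∃ M, 0 ≤ M ∧ ∀ k, |f k| ≤ M := by
  obtain ⟨M, h0, h⟩ := exists_abs_le (Ω := Unit) (fun k _ => f k)
  exact ⟨M, h0, fun k => h k ()⟩

/-- Expanding the field exhibits each coupling `J k` as a factor, the form on which integration by
parts acts. -/
lemma gmean_mul_field (W F : Ω → ℝ) (b : ι → ℝ) (c : ι → Ω → ℝ) (J : ι → ℝ) :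
    gmean W (fun σ => F σ * field b c J σ) = ∑ k, b k * (J k * gmean W (fun σ => F σ * c k σ)) := by
  simp only [field, Finset.mul_sum]
  rw [gmean_sum]
  refine Finset.sum_congr rfl fun k _ => ?_
  rw [← mul_assoc, ← gmean_const_mul]
  congr 1; funext σ; ring

lemma gmean_field (W : Ω → ℝ) (b : ι → ℝ) (c : ι → Ω → ℝ) (J : ι → ℝ) :
    gmean W (field b c J) = ∑ k, b k * (J k * gmean W (c k)) := by
  have := gmean_mul_field W (fun _ => 1) b c J
  simpa using this

variable [Nonempty Ω]

lemma integrable_of_continuous_bounded {f : (ι → ℝ) → ℝ} (hf : Continuous f) {C : ℝ}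
    (hC : ∀ J, |f J| ≤ C) : Integrable f (gaussianPi ι) :=
  Integrable.of_bound hf.aestronglyMeasurable C (ae_of_all _ hC)

lemma continuous_gmean_field (a : ι → ℝ) (c : ι → Ω → ℝ) (F : Ω → ℝ) :
    Continuous fun J => gmean (field a c J) F :=
  continuous_gmean (continuous_field a c) fun _ => continuous_const

lemma integrable_gmean_field (a : ι → ℝ) (c : ι → Ω → ℝ) (F : Ω → ℝ) :
    Integrable (fun J => gmean (field a c J) F) (gaussianPi ι) := by
  obtain ⟨M, -, hM⟩ := exists_abs_le_one F
  exact integrable_of_continuous_bounded (continuous_gmean_field a c F)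
    fun J => abs_gmean_le _ hM

lemma integrable_log_sum_exp_field (a : ι → ℝ) (c : ι → Ω → ℝ) :
    Integrable (fun J => Real.log (∑ σ, Real.exp (field a c J σ))) (gaussianPi ι) := by
  obtain ⟨M, hM0, hM⟩ := exists_abs_le c
  obtain ⟨A, hA0, hA⟩ := exists_abs_le_one a
  refine Integrable.mono' ((integrable_const (Real.log (Fintype.card Ω))).add
    (integrable_sum_abs.const_mul (A * M)))
    (continuous_log_sum_exp (continuous_field a c)).aestronglyMeasurable (ae_of_all _ fun J => ?_)
  exact abs_log_sum_exp_le (abs_field_le hA hM J)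

variable {a a' : ι → ℝ → ℝ}

/-- The derivative of the mean free energy along a path of amplitudes. -/
lemma hasDerivAt_integral_log (ha : ∀ k x, HasDerivAt (a k) (a' k x) x)
    (hb : ∀ k x, |a' k x| ≤ 1) (c : ι → Ω → ℝ) (x : ℝ) :
    HasDerivAt (fun y => ∫ J, Real.log (∑ σ, Real.exp (field (fun k => a k y) c J σ))
        ∂(gaussianPi ι))
      (∫ J, gmean (field (fun k => a k x) c J) (field (fun k => a' k x) c J) ∂(gaussianPi ι)) x := by
  obtain ⟨M, hM0, hM⟩ := exists_abs_le c
  have h1 : ∀ᶠ y in 𝓝 x, AEStronglyMeasurable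
      (fun J => Real.log (∑ σ, Real.exp (field (fun k => a k y) c J σ))) (gaussianPi ι) :=
    Eventually.of_forall fun y =>
      (continuous_log_sum_exp (continuous_field _ c)).aestronglyMeasurable
  have h2 : ∀ᵐ J ∂(gaussianPi ι), ∀ y ∈ Set.univ,
      ‖gmean (field (fun k => a k y) c J) (field (fun k => a' k y) c J)‖ ≤
        1 * M * ∑ k, |J k| :=
    ae_of_all _ fun J y _ => abs_gmean_le _ (abs_field_le (hb · y) hM J)
  have h3 : ∀ᵐ J ∂(gaussianPi ι), ∀ y ∈ Set.univ,
      HasDerivAt (fun y => Real.log (∑ σ, Real.exp (field (fun k => a k y) c J σ)))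
        (gmean (field (fun k => a k y) c J) (field (fun k => a' k y) c J)) y :=
    ae_of_all _ fun J y _ => hasDerivAt_log_sum_exp
      (W := fun y => field (fun k => a k y) c J) (hasDerivAt_field ha c J y)
  have h4 : AEStronglyMeasurable (fun J => gmean (field (fun k => a k x) c J)
      (field (fun k => a' k x) c J)) (gaussianPi ι) :=
    (continuous_gmean (continuous_field _ c) (continuous_field _ c)).aestronglyMeasurable
  exact (hasDerivAt_integral_of_dominated_loc_of_deriv_le Filter.univ_mem h1
    (integrable_log_sum_exp_field (fun k => a k x) c) h4 h2 (integrable_sum_abs.const_mul (1 * M))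
    h3).2

lemma abs_gmean_cov_le {W F W' : Ω → ℝ} {A B : ℝ} (hF : ∀ σ, |F σ| ≤ A) (hW : ∀ σ, |W' σ| ≤ B) :
    |gmean W (fun σ => F σ * W' σ) - gmean W F * gmean W W'| ≤ 2 * A * B := by
  have h1 : |gmean W (fun σ => F σ * W' σ)| ≤ A * B := abs_gmean_le W fun σ => by
    rw [abs_mul]
    have := (abs_nonneg _).trans (hF σ)
    gcongr
    exacts [hF σ, hW σ]
  have h2 : |gmean W F * gmean W W'| ≤ A * B := by
    rw [abs_mul]
    have := (abs_nonneg _).trans (abs_gmean_le W hF)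
    gcongr
    exacts [abs_gmean_le W hF, abs_gmean_le W hW]
  exact (abs_sub _ _).trans (by linarith)

/-- The derivative of a quenched mean along a path of amplitudes. -/
lemma hasDerivAt_integral_gmean (ha : ∀ k x, HasDerivAt (a k) (a' k x) x)
    (hb : ∀ k x, |a' k x| ≤ 1) (c : ι → Ω → ℝ) (F : Ω → ℝ) (x : ℝ) :
    HasDerivAt (fun y => ∫ J, gmean (field (fun k => a k y) c J) F ∂(gaussianPi ι))
      (∫ J, (gmean (field (fun k => a k x) c J) (fun σ => F σ * field (fun k => a' k x) c J σ)
        - gmean (field (fun k => a k x) c J) F *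
          gmean (field (fun k => a k x) c J) (field (fun k => a' k x) c J)) ∂(gaussianPi ι)) x := by
  obtain ⟨M, hM0, hM⟩ := exists_abs_le c
  obtain ⟨A, hA0, hA⟩ := exists_abs_le_one F
  refine (hasDerivAt_integral_of_dominated_loc_of_deriv_le (s := Set.univ)
    (bound := fun J => 2 * A * (1 * M * ∑ k, |J k|))
    (F' := fun y J => gmean (field (fun k => a k y) c J) (fun σ => F σ * field (fun k => a' k y) c J σ)
        - gmean (field (fun k => a k y) c J) F *
          gmean (field (fun k => a k y) c J) (field (fun k => a' k y) c J))
    Filter.univ_mem ?_ (integrable_gmean_field _ c F) ?_ ?_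
    ((integrable_sum_abs.const_mul _).const_mul _) ?_).2
  · exact Eventually.of_forall fun y => (continuous_gmean_field _ c F).aestronglyMeasurable
  · refine Continuous.aestronglyMeasurable ?_
    exact (continuous_gmean (continuous_field _ c)
      fun σ => continuous_const.mul (continuous_field _ c σ)).sub
      ((continuous_gmean_field _ c F).mul
        (continuous_gmean (continuous_field _ c) (continuous_field _ c)))
  · exact ae_of_all _ fun J y _ => abs_gmean_cov_le hA (abs_field_le (hb · y) hM J)
  · exact ae_of_all _ fun J y _ => hasDerivAt_gmean F (hasDerivAt_field ha c J y)

lemma hasDerivAt_gmean_update [DecidableEq ι] (b : ι → ℝ) (c : ι → Ω → ℝ) (F : Ω → ℝ) (k : ι)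
    (J : ι → ℝ) :
    HasDerivAt (fun x => gmean (field b c (Function.update J k x)) F)
      (b k * (gmean (field b c J) (fun σ => F σ * c k σ)
        - gmean (field b c J) F * gmean (field b c J) (c k))) (J k) := by
  refine (hasDerivAt_gmean F fun σ => hasDerivAt_field_update b c J k σ (J k)).congr_deriv ?_
  rw [Function.update_eq_self, gmean_const_mul]
  have : gmean (field b c J) (fun σ => F σ * (b k * c k σ)) =
      b k * gmean (field b c J) (fun σ => F σ * c k σ) := by
    rw [← gmean_const_mul]; congr 1; funext σ; ring
  rw [this]; ring

/-- Integration by parts for the derivative of the mean free energy. -/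
lemma integral_gmean_field (b b' : ι → ℝ) (c : ι → Ω → ℝ) :
    ∫ J, gmean (field b c J) (field b' c J) ∂(gaussianPi ι) =
      ∫ J, ∑ k, b k * b' k * (gmean (field b c J) (fun σ => c k σ * c k σ)
        - gmean (field b c J) (c k) ^ 2) ∂(gaussianPi ι) := by
  classical
  obtain ⟨M, hM0, hM⟩ := exists_abs_le c
  obtain ⟨A, hA0, hA⟩ := exists_abs_le_one b
  have hcont : ∀ k, Continuous fun J => b k * (gmean (field b c J) (fun σ => c k σ * c k σ)
        - gmean (field b c J) (c k) * gmean (field b c J) (c k)) := fun k =>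
    continuous_const.mul ((continuous_gmean_field _ _ _).sub
        ((continuous_gmean_field _ _ _).mul (continuous_gmean_field _ _ _)))
  simp only [gmean_field]
  rw [integral_finsetSum _ fun k _ => ?_, integral_finsetSum _ fun k _ => ?_]
  -- Integration by parts uses one constant bounding both the function and its derivative, hence the
  -- maximum below.
  · refine Finset.sum_congr rfl fun k _ => ?_
    rw [integral_const_mul, mul_comm (b k), integral_eval_mul_gaussianPi
      (C := max M (A * (2 * M * M))) k
      (hasDerivAt_gmean_update b c (c k) k) (continuous_gmean_field _ _ _)
      (hcont k)
      (fun J => (abs_gmean_le _ (hM k)).trans (le_max_left _ _))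
      (fun J => ?_), ← integral_const_mul]
    · congr 1; funext J; ring
    · refine le_trans ?_ (le_max_right _ _)
      rw [abs_mul]
      gcongr
      exacts [hA k, abs_gmean_cov_le (hM k) (hM k)]
  · exact (((integrable_gmean_field b c _).sub (by
      simp only [sq]
      exact (integrable_gmean_field b c _).mul_bdd (continuous_gmean_field b c _).aestronglyMeasurable
        (ae_of_all _ fun J => abs_gmean_le _ (hM k)))).const_mul _)
  · exact ((integrable_eval_gaussianPi k).mul_bdd
      (continuous_gmean_field b c _).aestronglyMeasurable
      (ae_of_all _ fun J => abs_gmean_le _ (hM k))).const_mul _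

/-- The derivative of a truncated correlation with respect to one Gaussian. -/
lemma hasDerivAt_gmean_cov_update [DecidableEq ι] (b : ι → ℝ) (c : ι → Ω → ℝ) (F : Ω → ℝ) (k : ι)
    (J : ι → ℝ) :
    HasDerivAt (fun x => gmean (field b c (Function.update J k x)) (fun σ => F σ * c k σ)
        - gmean (field b c (Function.update J k x)) F *
          gmean (field b c (Function.update J k x)) (c k))
      (b k * (gmean (field b c J) (fun σ => F σ * (c k σ * c k σ))
        - 2 * (gmean (field b c J) (fun σ => F σ * c k σ) * gmean (field b c J) (c k))
        - gmean (field b c J) F * gmean (field b c J) (fun σ => c k σ * c k σ)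
        + 2 * (gmean (field b c J) F * gmean (field b c J) (c k) ^ 2))) (J k) := by
  refine ((hasDerivAt_gmean_update b c _ k J).sub ((hasDerivAt_gmean_update b c F k J).mul
    (hasDerivAt_gmean_update b c (c k) k J))).congr_deriv ?_
  simp only [Function.update_eq_self, mul_assoc]
  ring

/-- Integration by parts for the derivative of a quenched mean. -/
lemma integral_gmean_cov_field (b b' : ι → ℝ) (c : ι → Ω → ℝ) (F : Ω → ℝ) :
    ∫ J, (gmean (field b c J) (fun σ => F σ * field b' c J σ)
        - gmean (field b c J) F * gmean (field b c J) (field b' c J)) ∂(gaussianPi ι) =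
      ∫ J, ∑ k, b k * b' k * (gmean (field b c J) (fun σ => F σ * (c k σ * c k σ))
        - 2 * (gmean (field b c J) (fun σ => F σ * c k σ) * gmean (field b c J) (c k))
        - gmean (field b c J) F * gmean (field b c J) (fun σ => c k σ * c k σ)
        + 2 * (gmean (field b c J) F * gmean (field b c J) (c k) ^ 2)) ∂(gaussianPi ι) := by
  classical
  obtain ⟨M, hM0, hM⟩ := exists_abs_le c
  obtain ⟨A, hA0, hA⟩ := exists_abs_le_one b
  obtain ⟨K, hK0, hK⟩ := exists_abs_le_one F
  have hcont : ∀ G : Ω → ℝ, Continuous fun J => gmean (field b c J) G := continuous_gmean_field b c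
  have hcont2 : ∀ k, Continuous fun J => gmean (field b c J) (fun σ => F σ * c k σ)
      - gmean (field b c J) F * gmean (field b c J) (c k) := fun k =>
    (hcont _).sub ((hcont _).mul (hcont _))
  have hcont3 : ∀ k, Continuous fun J => gmean (field b c J) (fun σ => F σ * (c k σ * c k σ))
        - 2 * (gmean (field b c J) (fun σ => F σ * c k σ) * gmean (field b c J) (c k))
        - gmean (field b c J) F * gmean (field b c J) (fun σ => c k σ * c k σ)
        + 2 * (gmean (field b c J) F * gmean (field b c J) (c k) ^ 2) := fun k => by
    have h1 := hcont (fun σ => F σ * (c k σ * c k σ))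
    have h2 := hcont (fun σ => F σ * c k σ)
    have h3 := hcont (c k)
    have h4 := hcont F
    have h5 := hcont (fun σ => c k σ * c k σ)
    fun_prop
  have hcont4 := fun k => (hcont3 k).const_mul (b k)
  -- The four products are each at most K·M·M and enter with weights 1, 2, 1, 2, which add up to 6.
  have hbd : ∀ k J, |gmean (field b c J) (fun σ => F σ * (c k σ * c k σ))
        - 2 * (gmean (field b c J) (fun σ => F σ * c k σ) * gmean (field b c J) (c k))
        - gmean (field b c J) F * gmean (field b c J) (fun σ => c k σ * c k σ)
        + 2 * (gmean (field b c J) F * gmean (field b c J) (c k) ^ 2)| ≤ 6 * (K * M * M) := by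
    intro k J
    set W := field b c J
    have e1 : |gmean W (fun σ => F σ * (c k σ * c k σ))| ≤ K * M * M := abs_gmean_le W fun σ => by
      rw [abs_mul, abs_mul, mul_assoc]
      gcongr
      exacts [hK σ, hM k σ, hM k σ]
    have e2 : |gmean W (fun σ => F σ * c k σ)| ≤ K * M := abs_gmean_le W fun σ => by
      rw [abs_mul]
      gcongr
      exacts [hK σ, hM k σ]
    have e3 : |gmean W (c k)| ≤ M := abs_gmean_le W (hM k)
    have e4 : |gmean W F| ≤ K := abs_gmean_le W hK
    have e5 : |gmean W (fun σ => c k σ * c k σ)| ≤ M * M := abs_gmean_le W fun σ => by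
      rw [abs_mul]
      gcongr
      exacts [hM k σ, hM k σ]
    have f2 : |gmean W (fun σ => F σ * c k σ) * gmean W (c k)| ≤ K * M * M := by
      rw [abs_mul]; gcongr
    have f3 : |gmean W F * gmean W (fun σ => c k σ * c k σ)| ≤ K * M * M := by
      rw [abs_mul, mul_assoc]; gcongr
    have f4 : |gmean W F * gmean W (c k) ^ 2| ≤ K * M * M := by
      rw [abs_mul, abs_pow, sq, mul_assoc]; gcongr
    rw [abs_le] at *
    constructor <;> linarith
  have hrw : ∀ J, gmean (field b c J) (fun σ => F σ * field b' c J σ)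
        - gmean (field b c J) F * gmean (field b c J) (field b' c J) =
      ∑ k, b' k * (J k * (gmean (field b c J) (fun σ => F σ * c k σ)
        - gmean (field b c J) F * gmean (field b c J) (c k))) := by
    intro J
    rw [gmean_mul_field, gmean_field, Finset.mul_sum, ← Finset.sum_sub_distrib]
    exact Finset.sum_congr rfl fun k _ => by ring
  simp only [hrw]
  rw [integral_finsetSum _ fun k _ => ?_, integral_finsetSum _ fun k _ => ?_]
  · refine Finset.sum_congr rfl fun k _ => ?_
    rw [integral_const_mul, mul_comm (b k), integral_eval_mul_gaussianPi
      (C := max (2 * K * M) (A * (6 * (K * M * M)))) k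
      (hasDerivAt_gmean_cov_update b c F k) (hcont2 k) (hcont4 k)
      (fun J => (abs_gmean_cov_le hK (hM k)).trans (le_max_left _ _)) (fun J => ?_),
      ← integral_const_mul]
    · congr 1; funext J; ring
    · refine le_trans ?_ (le_max_right _ _)
      rw [abs_mul]
      gcongr
      exacts [hA k, hbd k J]
  · exact (integrable_of_continuous_bounded (hcont3 k) (hbd k)).const_mul _
  · exact ((integrable_eval_gaussianPi k).mul_bdd
      (hcont2 k).aestronglyMeasurable
      (ae_of_all _ fun J => abs_gmean_cov_le hK (hM k))).const_mul _

end Field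
end SK
namespace SK

/-! ### Integration by parts as a mean over two additional replicas -/

section ReplicaFormula
variable {ι Ω R R' : Type*} [Fintype ι] [Fintype R] [Fintype R']

/-- The pattern of a family of replicas. -/
def repPattern (R : Type*) [Fintype R] (c : ι → Ω → ℝ) (k : ι) (τ : R → Ω) : ℝ := ∑ a, c k (τ a)

/-- A replicated system is again a Gaussian field with the same couplings and summed patterns, so
the derivative formulas for fields apply to replica means without change. -/
lemma field_repPattern (a : ι → ℝ) (c : ι → Ω → ℝ) (J : ι → ℝ) :
    field a (repPattern R c) J = repEnergy R (field a c J) := by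
  funext τ
  simp only [field, repPattern, repEnergy, Finset.mul_sum, Finset.sum_mul]
  exact Finset.sum_comm

variable [Fintype Ω] [Nonempty Ω] [DecidableEq R] [DecidableEq R']

omit [Fintype ι] in
lemma gmean_repPattern (W : Ω → ℝ) (c : ι → Ω → ℝ) (k : ι) :
    gmean (repEnergy R W) (repPattern R c k) = Fintype.card R * gmean W (c k) := by
  have : gmean (repEnergy R W) (fun τ => ∑ a, c k (τ a)) = ∑ _a : R, gmean W (c k) := by
    rw [gmean_sum]
    exact Finset.sum_congr rfl fun a _ => gmean_repEnergy_apply W (c k) a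
  exact this.trans (by simp)

lemma gmean_apply_mul_apply (W : Ω → ℝ) (g h : Ω → ℝ) {a b : R} (hab : a ≠ b) :
    gmean (repEnergy R W) (fun τ => g (τ a) * h (τ b)) = gmean W g * gmean W h := by
  rw [← gmean_unique (R := Unit) W g, ← gmean_unique (R := Unit) W h]
  refine gmean_mul_of_disjoint W (fun τ : Unit → Ω => g (τ default))
    (fun τ : Unit → Ω => h (τ default)) (e := fun _ => a) (e' := fun _ => b) ?_
  rintro (_ | _) (_ | _) h <;> simp_all [eq_comm]

omit [Fintype ι] in
lemma gmean_repPattern_mul (W : Ω → ℝ) (c : ι → Ω → ℝ) (k : ι) :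
    gmean (repEnergy R W) (fun τ => repPattern R c k τ * repPattern R c k τ) =
      Fintype.card R * gmean W (fun σ => c k σ * c k σ) +
        (Fintype.card R * (Fintype.card R - 1)) * gmean W (c k) ^ 2 := by
  simp only [repPattern, Finset.sum_mul_sum]
  rw [gmean_sum]
  have : ∀ a : R, gmean (repEnergy R W) (fun τ => ∑ b, c k (τ a) * c k (τ b)) =
      gmean W (fun σ => c k σ * c k σ) + (Fintype.card R - 1) * gmean W (c k) ^ 2 := by
    intro a
    rw [gmean_sum, ← Finset.add_sum_erase _ _ (Finset.mem_univ a),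
      gmean_repEnergy_apply W (fun σ => c k σ * c k σ) a]
    congr 1
    rw [Finset.sum_congr rfl fun b hb => gmean_apply_mul_apply W (c k) (c k)
      (Finset.ne_of_mem_erase hb).symm, Finset.sum_const, Finset.card_erase_of_mem (Finset.mem_univ a),
      nsmul_eq_mul, Finset.card_univ, Nat.cast_sub (Fintype.card_pos_iff.2 ⟨a⟩)]
    simp [sq]
  rw [Finset.sum_congr rfl fun a _ => this a, Finset.sum_const, nsmul_eq_mul, Finset.card_univ]
  ring

/-- The integration-by-parts expression of a replica mean is a mean over two more replicas. -/
lemma sum_replica_eq (W : Ω → ℝ) (c : ι → Ω → ℝ) (w : ι → ℝ) (κ : Ω → Ω → ℝ)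
    (hκ : ∀ σ σ', κ σ σ' = ∑ k, w k * (c k σ * c k σ')) (F : (R → Ω) → ℝ)
    {e : R → R'} {l₁ l₂ : R'} (he : Function.Injective e) (h1 : ∀ a, e a ≠ l₁) (h2 : ∀ a, e a ≠ l₂)
    (h12 : l₁ ≠ l₂) :
    ∑ k, w k * (gmean (repEnergy R W) (fun τ => F τ * (repPattern R c k τ * repPattern R c k τ))
        - 2 * (gmean (repEnergy R W) (fun τ => F τ * repPattern R c k τ) *
            gmean (repEnergy R W) (repPattern R c k))
        - gmean (repEnergy R W) F *
            gmean (repEnergy R W) (fun τ => repPattern R c k τ * repPattern R c k τ)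
        + 2 * (gmean (repEnergy R W) F * gmean (repEnergy R W) (repPattern R c k) ^ 2)) =
      gmean (repEnergy R' W) (fun τ => F (fun a => τ (e a)) *
        (∑ a, ∑ b, κ (τ (e a)) (τ (e b)) - 2 * Fintype.card R * ∑ a, κ (τ (e a)) (τ l₁)
          - Fintype.card R * κ (τ l₁) (τ l₁)
          + Fintype.card R * (Fintype.card R + 1) * κ (τ l₁) (τ l₂))) := by
  have e1 : ∀ k, gmean (repEnergy R W) (fun τ => F τ * (repPattern R c k τ * repPattern R c k τ)) =
      gmean (repEnergy R' W) (fun τ => F (fun a => τ (e a)) *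
        ∑ a, ∑ b, c k (τ (e a)) * c k (τ (e b))) := by
    intro k
    rw [← gmean_comp_injective W _ he]
    simp only [repPattern, Finset.sum_mul_sum]
  have e2 : ∀ k, gmean (repEnergy R W) (fun τ => F τ * repPattern R c k τ) * gmean W (c k) =
      gmean (repEnergy R' W) (fun τ => F (fun a => τ (e a)) *
        ∑ a, c k (τ (e a)) * c k (τ l₁)) := by
    intro k
    rw [← gmean_unique (R := Unit) W (c k), ← gmean_mul_of_disjoint (R' := R') W _ _ (e := e)
      (e' := fun _ => l₁)]
    · simp only [repPattern, mul_assoc, Finset.sum_mul]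
    · rintro (a | _) (b | _) h
      · simpa using he h
      · exact absurd h (h1 a)
      · exact absurd h.symm (h1 b)
      · rfl
  have e3 : ∀ k, gmean (repEnergy R W) F * gmean W (fun σ => c k σ * c k σ) =
      gmean (repEnergy R' W) (fun τ => F (fun a => τ (e a)) * (c k (τ l₁) * c k (τ l₁))) := by
    intro k
    rw [← gmean_unique (R := Unit) W, ← gmean_mul_of_disjoint (R' := R') W _ _ (e := e)
      (e' := fun _ => l₁)]
    rintro (a | _) (b | _) h
    · simpa using he h
    · exact absurd h (h1 a)
    · exact absurd h.symm (h1 b)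
    · rfl
  have e4 : ∀ k, gmean (repEnergy R W) F * gmean W (c k) ^ 2 =
      gmean (repEnergy R' W) (fun τ => F (fun a => τ (e a)) * (c k (τ l₁) * c k (τ l₂))) := by
    intro k
    rw [sq, ← gmean_apply_mul_apply (R := Bool) W (c k) (c k) (a := true) (b := false) (by simp),
      ← gmean_mul_of_disjoint (R' := R') W _ _ (e := e) (e' := fun b => bif b then l₁ else l₂)]
    · simp only [cond_true, cond_false]
    · rintro (a | (_ | _)) (b | (_ | _)) h <;> simp at h
      · simpa using he h
      · exact absurd h (h2 a)
      · exact absurd h (h1 a)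
      · exact absurd h.symm (h2 b)
      · rfl
      · exact absurd h.symm h12
      · exact absurd h.symm (h1 b)
      · exact absurd h h12
      · rfl
  -- For n replicas the pattern P satisfies ⟨P⟩ = n⟨c⟩ and ⟨P²⟩ = n⟨c²⟩ + n(n−1)⟨c⟩². The total
  -- weight of ⟨F⟩⟨c⟩² is thus 2n² − n(n−1) = n(n+1).
  have key : ∀ k, gmean (repEnergy R W) (fun τ => F τ * (repPattern R c k τ * repPattern R c k τ))
        - 2 * (gmean (repEnergy R W) (fun τ => F τ * repPattern R c k τ) *
            gmean (repEnergy R W) (repPattern R c k))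
        - gmean (repEnergy R W) F *
            gmean (repEnergy R W) (fun τ => repPattern R c k τ * repPattern R c k τ)
        + 2 * (gmean (repEnergy R W) F * gmean (repEnergy R W) (repPattern R c k) ^ 2) =
      gmean (repEnergy R' W) (fun τ => F (fun a => τ (e a)) *
        (∑ a, ∑ b, c k (τ (e a)) * c k (τ (e b))
          - 2 * Fintype.card R * ∑ a, c k (τ (e a)) * c k (τ l₁)
          - Fintype.card R * (c k (τ l₁) * c k (τ l₁))
          + Fintype.card R * (Fintype.card R + 1) * (c k (τ l₁) * c k (τ l₂)))) := by
    intro k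
    have : (fun τ : R' → Ω => F (fun a => τ (e a)) *
        (∑ a, ∑ b, c k (τ (e a)) * c k (τ (e b))
          - 2 * Fintype.card R * ∑ a, c k (τ (e a)) * c k (τ l₁)
          - Fintype.card R * (c k (τ l₁) * c k (τ l₁))
          + Fintype.card R * (Fintype.card R + 1) * (c k (τ l₁) * c k (τ l₂)))) =
        fun τ => F (fun a => τ (e a)) * (∑ a, ∑ b, c k (τ (e a)) * c k (τ (e b)))
          - (2 * Fintype.card R) * (F (fun a => τ (e a)) * ∑ a, c k (τ (e a)) * c k (τ l₁))
          - Fintype.card R * (F (fun a => τ (e a)) * (c k (τ l₁) * c k (τ l₁)))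
          + Fintype.card R * (Fintype.card R + 1) *
            (F (fun a => τ (e a)) * (c k (τ l₁) * c k (τ l₂))) := by
      funext τ; ring
    rw [this, gmean_add, gmean_sub, gmean_sub, gmean_const_mul, gmean_const_mul, gmean_const_mul,
      ← e1, ← e2, ← e3, ← e4, gmean_repPattern, gmean_repPattern_mul]
    ring
  refine (Finset.sum_congr rfl fun k _ => (congrArg (w k * ·) (key k)).trans
    (gmean_const_mul _ _ _).symm).trans ?_
  rw [← gmean_sum]
  congr 1
  funext τ
  simp only [hκ, mul_add, mul_sub, Finset.sum_add_distrib, Finset.sum_sub_distrib, Finset.mul_sum]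
  congr 1
  · congr 1
    · congr 1
      · rw [Finset.sum_comm]
        refine Finset.sum_congr rfl fun a _ => ?_
        rw [Finset.sum_comm]
        exact Finset.sum_congr rfl fun b _ => Finset.sum_congr rfl fun k _ => by ring
      · rw [Finset.sum_comm]
        exact Finset.sum_congr rfl fun b _ => Finset.sum_congr rfl fun k _ => by ring
    · exact Finset.sum_congr rfl fun k _ => by ring
  · exact Finset.sum_congr rfl fun k _ => by ring

end ReplicaFormula
end SK
namespace SK

/-! ### Products of overlap lines and the insertion of lines -/

section Lines
variable {Ω : Type*}

/-- The product of the two-replica observables `q` along a list of lines. -/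
def lineProd (q : Ω → Ω → ℝ) (m : List (ℕ × ℕ)) (τ : ℕ → Ω) : ℝ :=
  (m.map fun e => q (τ e.1) (τ e.2)).prod

lemma lineProd_append (q : Ω → Ω → ℝ) (m m' : List (ℕ × ℕ)) (τ : ℕ → Ω) :
    lineProd q (m ++ m') τ = lineProd q m τ * lineProd q m' τ := by
  simp [lineProd]

lemma lineProd_cons (q : Ω → Ω → ℝ) (e : ℕ × ℕ) (m : List (ℕ × ℕ)) (τ : ℕ → Ω) :
    lineProd q (e :: m) τ = q (τ e.1) (τ e.2) * lineProd q m τ := by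
  simp [lineProd]

lemma lineProd_replicate (q : Ω → Ω → ℝ) (r : ℕ) (e : ℕ × ℕ) (τ : ℕ → Ω) :
    lineProd q (List.replicate r e) τ = q (τ e.1) (τ e.2) ^ r := by
  simp [lineProd]

lemma lineProd_congr (q : Ω → Ω → ℝ) {m : List (ℕ × ℕ)} {τ τ' : ℕ → Ω}
    (h : ∀ e ∈ m, τ e.1 = τ' e.1 ∧ τ e.2 = τ' e.2) : lineProd q m τ = lineProd q m τ' := by
  unfold lineProd
  congr 1
  exact List.map_congr_left fun e he => by rw [(h e he).1, (h e he).2]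

lemma abs_lineProd_le_one {q : Ω → Ω → ℝ} (hq : ∀ σ τ, |q σ τ| ≤ 1) (m : List (ℕ × ℕ))
    (τ : ℕ → Ω) : |lineProd q m τ| ≤ 1 := by
  induction m with
  | nil => simp [lineProd]
  | cons e m ih =>
    rw [lineProd_cons, abs_mul]
    exact mul_le_one₀ (hq _ _) (abs_nonneg _) ih

/-- The lines join distinct replicas with labels below `s`. -/
def LinesBelow (s : ℕ) (m : List (ℕ × ℕ)) : Prop := ∀ e ∈ m, e.1 < s ∧ e.2 < s ∧ e.1 ≠ e.2

instance (s : ℕ) (m : List (ℕ × ℕ)) : Decidable (LinesBelow s m) := by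
  unfold LinesBelow; infer_instance

lemma LinesBelow.mono {s s' : ℕ} {m : List (ℕ × ℕ)} (h : LinesBelow s m) (hs : s ≤ s') :
    LinesBelow s' m := fun e he =>
  ⟨(h e he).1.trans_le hs, (h e he).2.1.trans_le hs, (h e he).2.2⟩

variable [Nonempty Ω]

/-- Extend a finite family of replicas to all labels. -/
noncomputable def extendReplicas {s : ℕ} (τ : Fin s → Ω) (n : ℕ) : Ω :=
  if h : n < s then τ ⟨n, h⟩ else Classical.arbitrary Ω

lemma extendReplicas_of_lt {s : ℕ} (τ : Fin s → Ω) {n : ℕ} (h : n < s) :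
    extendReplicas τ n = τ ⟨n, h⟩ := dif_pos h

variable [Fintype Ω]

/-- The mean of a product of lines between `s` replicas. -/
noncomputable def linesMean (q : Ω → Ω → ℝ) (W : Ω → ℝ) (s : ℕ) (m : List (ℕ × ℕ)) : ℝ :=
  gmean (repEnergy (Fin s) W) fun τ => lineProd q m (extendReplicas τ)

/-- Replicas are exchangeable and unused ones integrate out, so only the shape of the graph matters,
not its labels or the number of replicas provided. -/
lemma linesMean_map (q : Ω → Ω → ℝ) (W : Ω → ℝ) {s s' : ℕ} {m : List (ℕ × ℕ)} (f : ℕ → ℕ)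
    (hm : LinesBelow s m) (hf : ∀ a < s, f a < s') (hi : ∀ a < s, ∀ b < s, f a = f b → a = b) :
    linesMean q W s' (m.map (Prod.map f f)) = linesMean q W s m := by
  have he : Function.Injective (fun a : Fin s => (⟨f a, hf a a.2⟩ : Fin s')) := fun a b h =>
    Fin.ext (hi a a.2 b b.2 (by simpa using h))
  rw [linesMean, linesMean, ← gmean_comp_injective W _ he]
  congr 1
  funext τ
  simp only [lineProd, List.map_map]
  congr 1
  refine List.map_congr_left fun e hem => ?_
  obtain ⟨h1, h2, -⟩ := hm e hem
  simp only [Function.comp, Prod.map]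
  rw [extendReplicas_of_lt _ (hf _ h1), extendReplicas_of_lt _ (hf _ h2),
    extendReplicas_of_lt _ h1, extendReplicas_of_lt _ h2]

lemma linesMean_of_le (q : Ω → Ω → ℝ) (W : Ω → ℝ) {s s' : ℕ} {m : List (ℕ × ℕ)}
    (hm : LinesBelow s m) (h : s ≤ s') : linesMean q W s' m = linesMean q W s m := by
  have := linesMean_map q W (s' := s') id hm (fun a ha => ha.trans_le h) (fun _ _ _ _ h => h)
  simpa using this

/-- The mean of a formal combination of terms (coefficient, number of replicas, lines). -/
noncomputable def termsMean (q : Ω → Ω → ℝ) (W : Ω → ℝ) (L : List (ℤ × ℕ × List (ℕ × ℕ))) : ℝ :=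
  (L.map fun t => (t.1 : ℝ) * linesMean q W t.2.1 t.2.2).sum

lemma termsMean_nil (q : Ω → Ω → ℝ) (W : Ω → ℝ) : termsMean q W [] = 0 := rfl

lemma termsMean_cons (q : Ω → Ω → ℝ) (W : Ω → ℝ) (t) (L : List (ℤ × ℕ × List (ℕ × ℕ))) :
    termsMean q W (t :: L) = t.1 * linesMean q W t.2.1 t.2.2 + termsMean q W L := by
  simp [termsMean]

lemma termsMean_append (q : Ω → Ω → ℝ) (W : Ω → ℝ) (L L' : List (ℤ × ℕ × List (ℕ × ℕ))) :
    termsMean q W (L ++ L') = termsMean q W L + termsMean q W L' := by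
  simp [termsMean]

lemma termsMean_scale (q : Ω → Ω → ℝ) (W : Ω → ℝ) (c : ℤ) (L : List (ℤ × ℕ × List (ℕ × ℕ))) :
    termsMean q W (L.map fun u => (c * u.1, u.2)) = c * termsMean q W L := by
  induction L with
  | nil => simp [termsMean_nil]
  | cons t L ih =>
    rw [List.map_cons, termsMean_cons, termsMean_cons, ih]
    push_cast
    ring

end Lines

/-- The pairs `a < b < s`. -/
def pairsBelow (s : ℕ) : List (ℕ × ℕ) :=
  (List.range s).flatMap fun b => (List.range b).map fun a => (a, b)

/-- Insert `r` parallel lines in all possible ways, with the weights of Gaussian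
integration by parts. -/
def insertLines (r s : ℕ) (m : List (ℕ × ℕ)) : List (ℤ × ℕ × List (ℕ × ℕ)) :=
  (pairsBelow s).map (fun e => (1, s, List.replicate r e ++ m)) ++
    ((List.range s).map (fun a => (-(s : ℤ), s + 1, List.replicate r (a, s) ++ m)) ++
      [(((s * (s + 1) / 2 : ℕ) : ℤ), s + 2, List.replicate r (s, s + 1) ++ m)])

/-- `insertLines` extended to formal combinations. -/
def insertAll (r : ℕ) (L : List (ℤ × ℕ × List (ℕ × ℕ))) : List (ℤ × ℕ × List (ℕ × ℕ)) :=
  L.flatMap fun t => (insertLines r t.2.1 t.2.2).map fun u => (t.1 * u.1, u.2)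

/-- All terms of a combination have their lines between distinct replicas below their bound. -/
def TermsBelow (L : List (ℤ × ℕ × List (ℕ × ℕ))) : Prop := ∀ t ∈ L, LinesBelow t.2.1 t.2.2

lemma LinesBelow.replicate_append {r s s' a b : ℕ} {m : List (ℕ × ℕ)} (h : LinesBelow s m)
    (hs : s ≤ s') (ha : a < s') (hb : b < s') (hab : a ≠ b) :
    LinesBelow s' (List.replicate r (a, b) ++ m) := by
  intro e he
  rcases List.mem_append.1 he with he | he
  · rw [List.eq_of_mem_replicate he]
    exact ⟨ha, hb, hab⟩
  · exact h.mono hs e he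

lemma mem_pairsBelow {s : ℕ} {e : ℕ × ℕ} (h : e ∈ pairsBelow s) : e.1 < e.2 ∧ e.2 < s := by
  simp only [pairsBelow, List.mem_flatMap, List.mem_range, List.mem_map] at h
  obtain ⟨b, hb, a, ha, rfl⟩ := h
  exact ⟨ha, hb⟩

lemma mem_insertLines {r s : ℕ} {m : List (ℕ × ℕ)} {t : ℤ × ℕ × List (ℕ × ℕ)}
    (h : t ∈ insertLines r s m) : ∃ e : ℕ × ℕ, e.1 < t.2.1 ∧ e.2 < t.2.1 ∧ e.1 ≠ e.2 ∧
      s ≤ t.2.1 ∧ t.2.1 ≤ s + 2 ∧ t.2.2 = List.replicate r e ++ m := by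
  simp only [insertLines, List.mem_append, List.mem_map, List.mem_range, List.mem_singleton] at h
  rcases h with ⟨e, he, rfl⟩ | ⟨a, ha, rfl⟩ | rfl
  · obtain ⟨h1, h2⟩ := mem_pairsBelow he
    exact ⟨e, h1.trans h2, h2, h1.ne, le_rfl, by simp, rfl⟩
  · exact ⟨(a, s), by simp; omega, by simp, ha.ne, by simp, by simp, rfl⟩
  · exact ⟨(s, s + 1), by simp, by simp, by simp, by simp, by simp, rfl⟩

lemma LinesBelow.insertLines {r s : ℕ} {m : List (ℕ × ℕ)} (h : LinesBelow s m) :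
    TermsBelow (insertLines r s m) := by
  intro t ht
  obtain ⟨⟨a, b⟩, ha, hb, hab, hs, -, he⟩ := mem_insertLines ht
  rw [he]
  exact h.replicate_append hs ha hb hab

lemma mem_insertAll {r : ℕ} {L : List (ℤ × ℕ × List (ℕ × ℕ))} {t : ℤ × ℕ × List (ℕ × ℕ)}
    (h : t ∈ insertAll r L) : ∃ u ∈ L, ∃ v ∈ insertLines r u.2.1 u.2.2, t = (u.1 * v.1, v.2) := by
  simp only [insertAll, List.mem_flatMap, List.mem_map] at h
  obtain ⟨u, hu, v, hv, rfl⟩ := h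
  exact ⟨u, hu, v, hv, rfl⟩

lemma TermsBelow.insertAll {r : ℕ} {L : List (ℤ × ℕ × List (ℕ × ℕ))} (h : TermsBelow L) :
    TermsBelow (insertAll r L) := by
  intro t ht
  obtain ⟨u, hu, v, hv, rfl⟩ := mem_insertAll ht
  exact (h u hu).insertLines v hv

lemma length_insertAll {r n : ℕ} {L : List (ℤ × ℕ × List (ℕ × ℕ))}
    (h : ∀ t ∈ L, t.2.2.length = n) : ∀ t ∈ insertAll r L, t.2.2.length = r + n := by
  intro t ht
  obtain ⟨u, hu, v, hv, rfl⟩ := mem_insertAll ht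
  obtain ⟨e, -, -, -, -, -, he⟩ := mem_insertLines hv
  simp [he, h u hu]

lemma sum_sum_range_eq {s : ℕ} (f : ℕ → ℕ → ℝ) (hf : ∀ a b, f a b = f b a) :
    ∑ a ∈ Finset.range s, ∑ b ∈ Finset.range s, f a b =
      2 * ((pairsBelow s).map fun e => f e.1 e.2).sum + ∑ a ∈ Finset.range s, f a a := by
  induction s with
  | zero => simp [pairsBelow]
  | succ s ih =>
    have h1 : ((pairsBelow (s + 1)).map fun e => f e.1 e.2).sum =
        ((pairsBelow s).map fun e => f e.1 e.2).sum + ∑ a ∈ Finset.range s, f a s := by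
      simp [pairsBelow, List.range_succ, List.flatMap_append, Finset.sum_range, List.map_map,
        Function.comp_def, ← List.sum_ofFn, List.ofFn_eq_map]
      congr 1
      rw [← List.map_coe_finRange_eq_range, List.map_map]
      rfl
    rw [h1, Finset.sum_range_succ, Finset.sum_range_succ (fun a => f a a)]
    simp only [Finset.sum_range_succ (fun b => f _ b)]
    rw [Finset.sum_add_distrib, ih]
    simp only [hf s]
    ring

/-! ### Derivatives of quenched means insert lines -/

section Insert
variable {ι Ω : Type*} [Fintype ι] [Fintype Ω] [Nonempty Ω]

lemma termsMean_eq_gmean (q : Ω → Ω → ℝ) (W : Ω → ℝ) (n : ℕ) {L : List (ℤ × ℕ × List (ℕ × ℕ))}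
    (hL : TermsBelow L) (hn : ∀ t ∈ L, t.2.1 ≤ n) :
    termsMean q W L = gmean (repEnergy (Fin n) W) fun τ =>
      (L.map fun t => (t.1 : ℝ) * lineProd q t.2.2 (extendReplicas τ)).sum := by
  induction L with
  | nil => simp [termsMean_nil, gmean_const]
  | cons t L ih =>
    simp only [List.map_cons, List.sum_cons]
    rw [termsMean_cons, gmean_add, gmean_const_mul, ih (fun u hu => hL u (by simp [hu]))
      (fun u hu => hn u (by simp [hu])), ← linesMean_of_le q W (hL t (by simp)) (hn t (by simp))]
    rfl

-- Matches the combinatorial weights 1, −s, s(s+1)/2 of `insertLines` with the analytic expression.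
-- Doubling accounts for unordered pairs and removes the natural-number division, which is exact
-- since s(s+1) is even.
omit [Fintype Ω] [Nonempty Ω] in
lemma sum_insertLines (q : Ω → Ω → ℝ) (r s : ℕ) (m : List (ℕ × ℕ)) (T : ℕ → Ω) :
    2 * ((insertLines r s m).map fun t => (t.1 : ℝ) * lineProd q t.2.2 T).sum =
      lineProd q m T * (2 * ((pairsBelow s).map fun e => q (T e.1) (T e.2) ^ r).sum
        - 2 * s * ∑ a ∈ Finset.range s, q (T a) (T s) ^ r
        + s * (s + 1) * q (T s) (T (s + 1)) ^ r) := by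
  have h2 : (((s * (s + 1) / 2 : ℕ) : ℤ) : ℝ) = s * (s + 1) / 2 := by
    rw [Int.cast_natCast, Nat.cast_div (Nat.even_mul_succ_self s).two_dvd (by norm_num)]
    push_cast; ring
  have h1 : ((List.range s).map fun a => (((-(s : ℤ)) : ℤ) : ℝ) *
      (q (T a) (T s) ^ r * lineProd q m T)).sum =
      -(s * (lineProd q m T * ∑ a ∈ Finset.range s, q (T a) (T s) ^ r)) := by
    rw [← List.sum_toFinset _ List.nodup_range, List.toFinset_range, Finset.mul_sum,
      Finset.mul_sum, ← Finset.sum_neg_distrib]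
    exact Finset.sum_congr rfl fun a _ => by push_cast; ring
  have h3 : ((pairsBelow s).map fun e => (((1 : ℤ)) : ℝ) *
      (q (T e.1) (T e.2) ^ r * lineProd q m T)).sum =
      lineProd q m T * ((pairsBelow s).map fun e => q (T e.1) (T e.2) ^ r).sum := by
    rw [← List.sum_map_mul_left]
    congr 1
    exact List.map_congr_left fun e _ => by push_cast; ring
  simp only [insertLines, List.map_append, List.map_map, Function.comp_def, List.sum_append,
    lineProd_append, lineProd_replicate, List.map_cons, List.map_nil, List.sum_cons, List.sum_nil,
    h1, h2, h3]
  ring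

/-- Gaussian integration by parts inserts lines. -/
lemma sum_linesMean_eq (W : Ω → ℝ) (c : ι → Ω → ℝ) (w : ι → ℝ) (q : Ω → Ω → ℝ) (r : ℕ)
    (w₁ w₀ : ℝ) (hκ : ∀ σ σ', w₁ * q σ σ' ^ r + w₀ = ∑ k, w k * (c k σ * c k σ'))
    (hq : ∀ σ σ', q σ σ' = q σ' σ) (hd : ∀ σ, q σ σ = 1) {s : ℕ} {m : List (ℕ × ℕ)}
    (hm : LinesBelow s m) :
    ∑ k, w k * (gmean (repEnergy (Fin s) W) (fun τ => lineProd q m (extendReplicas τ) *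
          (repPattern (Fin s) c k τ * repPattern (Fin s) c k τ))
        - 2 * (gmean (repEnergy (Fin s) W) (fun τ => lineProd q m (extendReplicas τ) *
            repPattern (Fin s) c k τ) * gmean (repEnergy (Fin s) W) (repPattern (Fin s) c k))
        - gmean (repEnergy (Fin s) W) (fun τ => lineProd q m (extendReplicas τ)) *
            gmean (repEnergy (Fin s) W) (fun τ => repPattern (Fin s) c k τ * repPattern (Fin s) c k τ)
        + 2 * (gmean (repEnergy (Fin s) W) (fun τ => lineProd q m (extendReplicas τ)) *
            gmean (repEnergy (Fin s) W) (repPattern (Fin s) c k) ^ 2)) =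
      2 * w₁ * termsMean q W (insertLines r s m) := by
  have hn : ∀ t ∈ insertLines r s m, t.2.1 ≤ s + 2 := fun t ht => by
    obtain ⟨e, -, -, -, -, h, -⟩ := mem_insertLines ht
    exact h
  rw [sum_replica_eq W c w (fun σ σ' => w₁ * q σ σ' ^ r + w₀) hκ _
      (e := Fin.castAdd 2) (l₁ := ⟨s, by omega⟩) (l₂ := ⟨s + 1, by omega⟩)
      (Fin.castAdd_injective s 2) (fun a h => by
        have := congrArg Fin.val h
        simp at this; omega) (fun a h => by
        have := congrArg Fin.val h
        simp at this; omega) (by simp [Fin.ext_iff]),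
    termsMean_eq_gmean q W (s + 2) hm.insertLines hn, ← gmean_const_mul]
  congr 1
  funext τ
  set T := extendReplicas τ with hT
  have e1 : lineProd q m (extendReplicas fun a : Fin s => τ (Fin.castAdd 2 a)) = lineProd q m T := by
    refine lineProd_congr q fun e he => ?_
    obtain ⟨h1, h2, -⟩ := hm e he
    rw [extendReplicas_of_lt _ h1, extendReplicas_of_lt _ h2, hT,
      extendReplicas_of_lt _ (by omega), extendReplicas_of_lt _ (by omega)]
    exact ⟨rfl, rfl⟩
  have e2 : ∀ a : Fin s, τ (Fin.castAdd 2 a) = T a := fun a => by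
    rw [hT, extendReplicas_of_lt _ (by omega)]; rfl
  have e3 : τ ⟨s, by omega⟩ = T s := by rw [hT, extendReplicas_of_lt _ (by omega)]
  have e4 : τ ⟨s + 1, by omega⟩ = T (s + 1) := by rw [hT, extendReplicas_of_lt _ (by omega)]
  have e5 : ∑ a : Fin s, ∑ b : Fin s, (w₁ * q (T a) (T b) ^ r + w₀) =
      w₁ * (2 * ((pairsBelow s).map fun e => q (T e.1) (T e.2) ^ r).sum + s) + s * s * w₀ := by
    have h1 : ∀ a : Fin s, ∑ b : Fin s, (w₁ * q (T a) (T b) ^ r + w₀) =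
        ∑ b ∈ Finset.range s, (w₁ * q (T a) (T b) ^ r + w₀) := fun a =>
      Fin.sum_univ_eq_sum_range (fun b => w₁ * q (T a) (T b) ^ r + w₀) s
    simp only [h1]
    rw [Fin.sum_univ_eq_sum_range
      (fun a => ∑ b ∈ Finset.range s, (w₁ * q (T a) (T b) ^ r + w₀)) s]
    simp only [Finset.sum_add_distrib, ← Finset.mul_sum]
    rw [sum_sum_range_eq (fun a b => q (T a) (T b) ^ r) (fun a b => by rw [hq])]
    simp [hd]
    ring
  have e6 : ∑ a : Fin s, (w₁ * q (T a) (T s) ^ r + w₀) =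
      w₁ * ∑ a ∈ Finset.range s, q (T a) (T s) ^ r + s * w₀ := by
    rw [← Finset.sum_range (fun a => w₁ * q (T a) (T s) ^ r + w₀), Finset.sum_add_distrib,
      ← Finset.mul_sum]
    simp
  rw [e1]
  simp only [e2, e3, e4, Fintype.card_fin]
  rw [e5, e6, hd]
  -- The s diagonal terms, where q = 1, cancel against −s·κ at the extra replica, and the constant
  -- w₀ disappears because s² − 2s² − s + s(s+1) = 0.
  linear_combination -w₁ * sum_insertLines q r s m T

variable {a a' : ι → ℝ → ℝ}

lemma integrable_linesMean (b : ι → ℝ) (c : ι → Ω → ℝ) (q : Ω → Ω → ℝ) (s : ℕ)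
    (m : List (ℕ × ℕ)) : Integrable (fun J => linesMean q (field b c J) s m) (gaussianPi ι) := by
  simp only [linesMean, ← field_repPattern]
  exact integrable_gmean_field b _ _

lemma integrable_termsMean (b : ι → ℝ) (c : ι → Ω → ℝ) (q : Ω → Ω → ℝ)
    (L : List (ℤ × ℕ × List (ℕ × ℕ))) :
    Integrable (fun J => termsMean q (field b c J) L) (gaussianPi ι) := by
  induction L with
  | nil => simp [termsMean_nil]
  | cons t L ih =>
    simp only [termsMean_cons]
    exact ((integrable_linesMean b c q _ _).const_mul _).add ih

/-- The derivative of the quenched mean of a product of lines along a path of amplitudes. -/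
lemma hasDerivAt_integral_linesMean (ha : ∀ k x, HasDerivAt (a k) (a' k x) x)
    (hb : ∀ k x, |a' k x| ≤ 1) (c : ι → Ω → ℝ) (q : Ω → Ω → ℝ) (r : ℕ) (x w₁ w₀ : ℝ)
    (hκ : ∀ σ σ', w₁ * q σ σ' ^ r + w₀ = ∑ k, (a k x * a' k x) * (c k σ * c k σ'))
    (hq : ∀ σ σ', q σ σ' = q σ' σ) (hd : ∀ σ, q σ σ = 1) {s : ℕ} {m : List (ℕ × ℕ)}
    (hm : LinesBelow s m) :
    HasDerivAt (fun y => ∫ J, linesMean q (field (fun k => a k y) c J) s m ∂(gaussianPi ι))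
      (2 * w₁ * ∫ J, termsMean q (field (fun k => a k x) c J) (insertLines r s m)
        ∂(gaussianPi ι)) x := by
  have h := hasDerivAt_integral_gmean ha hb (repPattern (Fin s) c)
    (fun τ => lineProd q m (extendReplicas τ)) x
  rw [integral_gmean_cov_field (fun k => a k x) (fun k => a' k x)] at h
  simp only [field_repPattern] at h
  refine h.congr_deriv ?_
  rw [← integral_const_mul]
  congr 1
  funext J
  exact sum_linesMean_eq _ c _ q r w₁ w₀ hκ hq hd hm

lemma hasDerivAt_integral_termsMean (ha : ∀ k x, HasDerivAt (a k) (a' k x) x)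
    (hb : ∀ k x, |a' k x| ≤ 1) (c : ι → Ω → ℝ) (q : Ω → Ω → ℝ) (r : ℕ) (x w₁ w₀ : ℝ)
    (hκ : ∀ σ σ', w₁ * q σ σ' ^ r + w₀ = ∑ k, (a k x * a' k x) * (c k σ * c k σ'))
    (hq : ∀ σ σ', q σ σ' = q σ' σ) (hd : ∀ σ, q σ σ = 1) {L : List (ℤ × ℕ × List (ℕ × ℕ))}
    (hL : TermsBelow L) :
    HasDerivAt (fun y => ∫ J, termsMean q (field (fun k => a k y) c J) L ∂(gaussianPi ι))
      (2 * w₁ * ∫ J, termsMean q (field (fun k => a k x) c J) (insertAll r L)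
        ∂(gaussianPi ι)) x := by
  induction L with
  | nil => simpa [termsMean_nil, insertAll] using hasDerivAt_const x (0 : ℝ)
  | cons t L ih =>
    have e1 : ∀ y, ∫ J, termsMean q (field (fun k => a k y) c J) (t :: L) ∂(gaussianPi ι) =
        t.1 * ∫ J, linesMean q (field (fun k => a k y) c J) t.2.1 t.2.2 ∂(gaussianPi ι) +
          ∫ J, termsMean q (field (fun k => a k y) c J) L ∂(gaussianPi ι) := by
      intro y
      simp only [termsMean_cons]
      rw [integral_add ((integrable_linesMean _ c q _ _).const_mul _)
        (integrable_termsMean _ c q L), integral_const_mul]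
    have e2 : ∫ J, termsMean q (field (fun k => a k x) c J) (insertAll r (t :: L)) ∂(gaussianPi ι) =
        t.1 * ∫ J, termsMean q (field (fun k => a k x) c J) (insertLines r t.2.1 t.2.2)
          ∂(gaussianPi ι) +
          ∫ J, termsMean q (field (fun k => a k x) c J) (insertAll r L) ∂(gaussianPi ι) := by
      have : insertAll r (t :: L) = ((insertLines r t.2.1 t.2.2).map fun u => (t.1 * u.1, u.2)) ++
        insertAll r L := by simp [insertAll]
      simp only [this, termsMean_append, termsMean_scale]
      rw [integral_add ((integrable_termsMean _ c q _).const_mul _)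
        (integrable_termsMean _ c q _), integral_const_mul]
    simp only [e1, e2]
    refine (((hasDerivAt_integral_linesMean ha hb c q r x w₁ w₀ hκ hq hd
      (hL t (by simp))).const_mul _).add (ih fun u hu => hL u (by simp [hu]))).congr_deriv ?_
    ring

end Insert
end SK
namespace SK

/-! ### Collecting filled graphs by computation, and bounds on line products -/

/-- The bits of this number are the parities of the numbers of line ends at the replicas. -/
def parityMask (m : List (ℕ × ℕ)) : ℕ :=
  m.foldr (fun e x => Nat.xor (Nat.pow 2 e.1) (Nat.xor (Nat.pow 2 e.2) x)) 0

/-- Some replica carries an odd number of line ends. -/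
def hasOddReplica (m : List (ℕ × ℕ)) : Bool := !(parityMask m).beq 0

/-- Relabelling of the replicas by a list. -/
def relabel (p : List ℕ) (n : ℕ) : ℕ := p.getD n 0

/-- A line with its ends in increasing order. -/
def orientLine (e : ℕ × ℕ) : ℕ × ℕ := if e.1 ≤ e.2 then e else (e.2, e.1)

/-- All orderings of `0, …, n - 1`. -/
def orderings : ℕ → List (List ℕ)
  | 0 => [[]]
  | n + 1 => (orderings n).flatMap fun p => (List.range (n + 1)).map fun i => p.insertIdx i n

/-- A test for isomorphism of two graphs on `s` replicas. -/
def isoTest (s : ℕ) (m g : List (ℕ × ℕ)) : Bool :=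
  -- Comparing the numbers of distinct lines is a quick rejection only. The final checks on `p` make
  -- the test sound without any theorem about `orderings`.
  (m.map orientLine).dedup.length == (g.map orientLine).dedup.length &&
    (orderings s).any fun p =>
      ((m.map (Prod.map (relabel p) (relabel p))).map orientLine).isPerm (g.map orientLine) &&
        (decide p.Nodup && (decide (p.length = s) && p.all fun a => a < s))

/-- The coefficients of the given graphs in a combination, if no other graph occurs. -/
def collectTerms : List (ℕ × List (ℕ × ℕ)) → List (ℤ × ℕ × List (ℕ × ℕ)) → Option (List ℤ)
  | [], L => if L.isEmpty then some [] else none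
  | g :: gs, L =>
    (collectTerms gs (L.filter fun t => !(t.2.1 == g.1 && isoTest g.1 t.2.2 g.2))).map
      (((L.filter fun t => t.2.1 == g.1 && isoTest g.1 t.2.2 g.2).map fun t => t.1).sum :: ·)

/-- The terms without odd replicas. -/
def filledTerms (L : List (ℤ × ℕ × List (ℕ × ℕ))) : List (ℤ × ℕ × List (ℕ × ℕ)) :=
  L.filter fun t => !hasOddReplica t.2.2

section Evaluation
variable {Ω : Type*} [Fintype Ω] [Nonempty Ω]

omit [Fintype Ω] [Nonempty Ω] in
lemma lineProd_flip {q : Ω → Ω → ℝ} {flip : Ω → Ω} (h1 : ∀ σ τ, q (flip σ) τ = -q σ τ)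
    (h2 : ∀ σ τ, q σ (flip τ) = -q σ τ) (v : ℕ) (m : List (ℕ × ℕ)) (T : ℕ → Ω) :
    lineProd q m (fun n => if n = v then flip (T n) else T n) =
      (if (parityMask m).testBit v then -1 else 1) * lineProd q m T := by
  induction m with
  | nil => simp [lineProd, parityMask]
  | cons e m ih =>
    have hd : (parityMask (e :: m)).testBit v =
        (decide (e.1 = v) ^^ (decide (e.2 = v) ^^ (parityMask m).testBit v)) := by
      change (2 ^ e.1 ^^^ (2 ^ e.2 ^^^ parityMask m)).testBit v = _
      simp [Nat.testBit_xor, Nat.testBit_two_pow]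
    rw [lineProd_cons, lineProd_cons, ih, hd]
    by_cases ha : e.1 = v <;> by_cases hb : e.2 = v <;> cases (parityMask m).testBit v <;>
      simp [ha, hb, h1, h2]

/-- Flipping all spins of one odd replica preserves the Gibbs weight and reverses the sign of the
product, so the mean equals its own negative. -/
lemma linesMean_eq_zero {q : Ω → Ω → ℝ} {flip : Ω → Ω} (hf : Function.Involutive flip)
    (h1 : ∀ σ τ, q (flip σ) τ = -q σ τ) (h2 : ∀ σ τ, q σ (flip τ) = -q σ τ)
    {W : Ω → ℝ} (hW : ∀ σ, W (flip σ) = W σ) {s : ℕ} {m : List (ℕ × ℕ)} (hm : LinesBelow s m)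
    (ho : hasOddReplica m = true) : linesMean q W s m = 0 := by
  obtain ⟨v, hodd⟩ := Nat.exists_testBit_of_ne_zero
    (show parityMask m ≠ 0 from fun h => by
      rw [hasOddReplica, h] at ho
      exact absurd ho (by decide))
  let E : (Fin s → Ω) ≃ (Fin s → Ω) :=
    Equiv.piCongrRight fun a => if (a : ℕ) = v then hf.toPerm else Equiv.refl Ω
  have hE : ∀ τ a, E τ a = if (a : ℕ) = v then flip (τ a) else τ a := fun τ a => by
    by_cases h : (a : ℕ) = v <;> simp [E, h]
  have key : linesMean q W s m = -1 * linesMean q W s m := by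
    conv_lhs => rw [linesMean, ← gmean_comp_equiv E]
    rw [linesMean, ← gmean_const_mul]
    congr 1
    · funext τ
      refine Finset.sum_congr rfl fun a _ => ?_
      rw [hE]
      split_ifs
      · rw [hW]
      · rfl
    · funext τ
      have : lineProd q m (extendReplicas (E τ)) = lineProd q m
          (fun n => if n = v then flip (extendReplicas τ n) else extendReplicas τ n) := by
        refine lineProd_congr q fun e he => ?_
        obtain ⟨ha, hb, -⟩ := hm e he
        simp only [extendReplicas_of_lt _ ha, extendReplicas_of_lt _ hb, hE, and_self]
      rw [this, lineProd_flip h1 h2, hodd, if_pos rfl]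
  linarith

omit [Fintype Ω] [Nonempty Ω] in
lemma lineProd_orient {q : Ω → Ω → ℝ} (hq : ∀ σ τ, q σ τ = q τ σ) (m : List (ℕ × ℕ)) (T : ℕ → Ω) :
    lineProd q (m.map orientLine) T = lineProd q m T := by
  induction m with
  | nil => rfl
  | cons e m ih =>
    rw [List.map_cons, lineProd_cons, lineProd_cons, ih]
    congr 1
    unfold orientLine
    split_ifs
    · rfl
    · exact hq _ _

/-- Only soundness of the test is needed: a missed isomorphism would make `collectTerms` fail or
return other coefficients, never give a false identity. -/
lemma linesMean_eq_of_isoTest {q : Ω → Ω → ℝ} (hq : ∀ σ τ, q σ τ = q τ σ) (W : Ω → ℝ) {s : ℕ}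
    {m g : List (ℕ × ℕ)} (hm : LinesBelow s m) (h : isoTest s m g = true) :
    linesMean q W s m = linesMean q W s g := by
  simp only [isoTest, Bool.and_eq_true, List.any_eq_true, decide_eq_true_eq, List.all_eq_true,
    List.isPerm_iff] at h
  obtain ⟨-, p, -, hp, hn, hl, hb⟩ := h
  have hr : ∀ a (ha : a < s), relabel p a = p[a]'(hl ▸ ha) := fun a ha => by
    simp [relabel, List.getD_eq_getElem?_getD, hl ▸ ha]
  rw [← linesMean_map q W (s' := s) (relabel p) hm]
  · unfold linesMean
    congr 1
    funext τ
    rw [← lineProd_orient hq, ← lineProd_orient hq g]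
    exact (hp.map _).prod_eq
  · intro a ha
    rw [hr a ha]
    exact hb _ (List.getElem_mem _)
  · intro a ha b hb' hab
    rw [hr a ha, hr b hb'] at hab
    exact (hn.getElem_inj_iff).1 hab

lemma termsMean_filter_add (q : Ω → Ω → ℝ) (W : Ω → ℝ) (P : ℤ × ℕ × List (ℕ × ℕ) → Bool)
    (L : List (ℤ × ℕ × List (ℕ × ℕ))) :
    termsMean q W L = termsMean q W (L.filter P) + termsMean q W (L.filter fun t => !P t) := by
  induction L with
  | nil => simp [termsMean_nil]
  | cons t L ih =>
    by_cases h : P t <;> simp [h, termsMean_cons, ih] <;> ring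

/-- Each listed graph absorbs the terms isomorphic to it, and success means that nothing was left
over. A graph identity thereby becomes a decidable equation between integer lists. -/
lemma termsMean_eq_of_collectTerms {q : Ω → Ω → ℝ} (hq : ∀ σ τ, q σ τ = q τ σ) (W : Ω → ℝ)
    (gs : List (ℕ × List (ℕ × ℕ))) : ∀ {L : List (ℤ × ℕ × List (ℕ × ℕ))} {cs : List ℤ},
    TermsBelow L → collectTerms gs L = some cs →
    termsMean q W L = (List.zipWith (fun (c : ℤ) g => (c : ℝ) * linesMean q W g.1 g.2) cs gs).sum := by
  induction gs with
  | nil =>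
    intro L cs hL h
    simp only [collectTerms] at h
    split_ifs at h with h0
    rw [List.isEmpty_iff] at h0
    simp [h0, termsMean_nil]
  | cons g gs ih =>
    intro L cs hL h
    simp only [collectTerms, Option.map_eq_some_iff] at h
    obtain ⟨ds, h1, rfl⟩ := h
    rw [termsMean_filter_add q W (fun t => t.2.1 == g.1 && isoTest g.1 t.2.2 g.2),
      ih (fun t ht => hL t (List.mem_of_mem_filter ht)) h1, List.zipWith_cons_cons, List.sum_cons]
    congr 1
    have : ∀ L' : List (ℤ × ℕ × List (ℕ × ℕ)), TermsBelow L' →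
        (∀ t ∈ L', (t.2.1 == g.1 && isoTest g.1 t.2.2 g.2) = true) →
        termsMean q W L' = (((L'.map fun t => t.1).sum : ℤ) : ℝ) * linesMean q W g.1 g.2 := by
      intro L'
      induction L' with
      | nil => intro _ _; simp [termsMean_nil]
      | cons t L' ih' =>
        intro hb hP
        rw [termsMean_cons, ih' (fun u hu => hb u (by simp [hu])) (fun u hu => hP u (by simp [hu]))]
        have ht := hP t (by simp)
        rw [Bool.and_eq_true, beq_iff_eq] at ht
        have hbt := hb t (by simp)
        rw [ht.1] at hbt
        rw [ht.1, linesMean_eq_of_isoTest hq W hbt ht.2]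
        push_cast [List.map_cons, List.sum_cons]
        ring
    exact this _ (fun t ht => hL t (List.mem_of_mem_filter ht)) fun t ht => by
      simpa using List.of_mem_filter ht

lemma termsMean_filledTerms {q : Ω → Ω → ℝ} {flip : Ω → Ω} (hf : Function.Involutive flip)
    (h1 : ∀ σ τ, q (flip σ) τ = -q σ τ) (h2 : ∀ σ τ, q σ (flip τ) = -q σ τ)
    {W : Ω → ℝ} (hW : ∀ σ, W (flip σ) = W σ) {L : List (ℤ × ℕ × List (ℕ × ℕ))}
    (hL : TermsBelow L) : termsMean q W L = termsMean q W (filledTerms L) := by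
  induction L with
  | nil => rfl
  | cons t L ih =>
    rw [termsMean_cons, ih fun u hu => hL u (by simp [hu])]
    by_cases h : hasOddReplica t.2.2
    · rw [linesMean_eq_zero hf h1 h2 hW (hL t (by simp)) h]
      simp [filledTerms, h]
    · simp [filledTerms, h, termsMean_cons]

/-- A product of lines is dominated by the power of a single line. -/
lemma gmean_abs_lineProd_le {q : Ω → Ω → ℝ} (W : Ω → ℝ) {s : ℕ} {m : List (ℕ × ℕ)}
    (hm : LinesBelow s m) {n : ℕ} (hn : m.length = n) (hn0 : n ≠ 0) (he : Even n) :
    gmean (repEnergy (Fin s) W) (fun τ => |lineProd q m (extendReplicas τ)|) ≤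
      n * linesMean q W 2 (List.replicate n (0, 1)) := by
  have h1 : gmean (repEnergy (Fin s) W) (fun τ => |lineProd q m (extendReplicas τ)|) ≤
      gmean (repEnergy (Fin s) W) fun τ =>
        (m.map fun e => lineProd q (List.replicate n e) (extendReplicas τ)).sum := by
    refine gmean_mono _ fun τ => ?_
    set T := extendReplicas τ
    simp only [lineProd_replicate]
    have hne : (m.map fun e => |q (T e.1) (T e.2)|) ≠ [] := by
      intro h
      rw [List.map_eq_nil_iff] at h
      simp [h] at hn
      exact hn0 hn.symm
    -- For fixed replicas the product is at most the n-th power of its largest factor; as n is even,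
    -- that power is one of the nonnegative terms of the sum over lines.
    obtain ⟨x, hx⟩ : ∃ x, (m.map fun e => |q (T e.1) (T e.2)|).max? = some x :=
      Option.ne_none_iff_exists'.1 (by simpa [List.max?_eq_none_iff] using hne)
    rw [List.max?_eq_some_iff] at hx
    obtain ⟨hmem, hmax⟩ := hx
    obtain ⟨e₀, he₀, rfl⟩ := List.mem_map.1 hmem
    have hmax' : ∀ e ∈ m, |q (T e.1) (T e.2)| ≤ |q (T e₀.1) (T e₀.2)| := fun e he' =>
      hmax _ (List.mem_map.2 ⟨e, he', rfl⟩)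
    have hprod : ∀ m' : List (ℕ × ℕ), (∀ e ∈ m', e ∈ m) →
        |lineProd q m' T| ≤ |q (T e₀.1) (T e₀.2)| ^ m'.length := by
      intro m'
      induction m' with
      | nil => intro _; simp [lineProd]
      | cons e m' ih =>
        intro h
        rw [lineProd_cons, abs_mul, List.length_cons, pow_succ']
        exact mul_le_mul (hmax' e (h e (by simp))) (ih fun u hu => h u (by simp [hu]))
          (abs_nonneg _) (abs_nonneg _)
    calc |lineProd q m T| ≤ |q (T e₀.1) (T e₀.2)| ^ n := by
          rw [← hn]; exact hprod m fun _ h => h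
      _ = q (T e₀.1) (T e₀.2) ^ n := he.pow_abs _
      _ ≤ _ := List.single_le_sum (by
          simp only [List.mem_map]; rintro _ ⟨u, -, rfl⟩; exact he.pow_nonneg _) _
          (List.mem_map.2 ⟨e₀, he₀, rfl⟩)
  refine h1.trans (le_of_eq ?_)
  -- All n summands have the same mean, since any line can be relabelled to join replicas 0 and 1;
  -- this produces the factor n.
  have h2 : ∀ e ∈ m, linesMean q W s (List.replicate n e) =
      linesMean q W 2 (List.replicate n (0, 1)) := by
    intro e he'
    obtain ⟨ha, hb, hab⟩ := hm e he'
    rw [← linesMean_map q W (s := 2) (s' := s) (m := List.replicate n (0, 1))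
      (fun i => if i = 0 then e.1 else e.2)]
    · simp [Prod.map]
    · intro u hu
      rw [List.eq_of_mem_replicate hu]; simp
    · intro a _
      split_ifs <;> assumption
    · intro a ha' b hb' h
      split_ifs at h <;> omega
  have h3 : ∀ m' : List (ℕ × ℕ), (∀ e ∈ m', e ∈ m) → gmean (repEnergy (Fin s) W) (fun τ =>
      (m'.map fun e => lineProd q (List.replicate n e) (extendReplicas τ)).sum) =
      m'.length * linesMean q W 2 (List.replicate n (0, 1)) := by
    intro m'
    induction m' with
    | nil => intro _; simp [gmean_const]
    | cons e m' ih =>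
      intro h
      simp only [List.map_cons, List.sum_cons]
      rw [gmean_add, ih fun u hu => h u (by simp [hu])]
      have := h2 e (h e (by simp))
      rw [linesMean] at this
      rw [this]
      push_cast [List.length_cons]
      ring
  rw [h3 m fun _ h => h, hn]

lemma abs_linesMean_le {q : Ω → Ω → ℝ} (W : Ω → ℝ) {s : ℕ} {m : List (ℕ × ℕ)}
    (hm : LinesBelow s m) {n : ℕ} (hn : m.length = n) (hn0 : n ≠ 0) (he : Even n) :
    |linesMean q W s m| ≤ n * linesMean q W 2 (List.replicate n (0, 1)) :=
  (abs_gmean_le_gmean _ _).trans (gmean_abs_lineProd_le W hm hn hn0 he)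

/-- A product of at least two lines is dominated by the square of a single line. -/
lemma abs_linesMean_cons_cons_le {q : Ω → Ω → ℝ} (hq : ∀ σ τ, |q σ τ| ≤ 1) (W : Ω → ℝ) {s : ℕ}
    {e e' : ℕ × ℕ} {m : List (ℕ × ℕ)} (hm : LinesBelow s (e :: e' :: m)) :
    |linesMean q W s (e :: e' :: m)| ≤ 2 * linesMean q W 2 (List.replicate 2 (0, 1)) := by
  have h := gmean_abs_lineProd_le (q := q) W (s := s) (m := [e, e']) (n := 2)
    (fun u hu => hm u (List.mem_of_mem_take (i := 2) hu)) rfl two_ne_zero even_two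
  refine (abs_gmean_le_gmean _ _).trans ((gmean_mono _ fun τ => ?_).trans (h.trans_eq (by simp)))
  rw [show e :: e' :: m = [e, e'] ++ m from rfl, lineProd_append, abs_mul]
  exact mul_le_of_le_one_right (abs_nonneg _) (abs_lineProd_le_one hq _ _)

/-- The sum of the absolute values of the coefficients. -/
def coeffNorm (L : List (ℤ × ℕ × List (ℕ × ℕ))) : ℝ := (L.map fun t => |(t.1 : ℝ)|).sum

lemma coeffNorm_nonneg (L : List (ℤ × ℕ × List (ℕ × ℕ))) : 0 ≤ coeffNorm L :=
  List.sum_nonneg (by simp only [List.mem_map]; rintro _ ⟨u, -, rfl⟩; positivity)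

lemma abs_termsMean_le_of_forall {q : Ω → Ω → ℝ} {W : Ω → ℝ} {K : ℝ}
    {L : List (ℤ × ℕ × List (ℕ × ℕ))} (h : ∀ t ∈ L, |linesMean q W t.2.1 t.2.2| ≤ K) :
    |termsMean q W L| ≤ coeffNorm L * K := by
  induction L with
  | nil => simp [termsMean_nil, coeffNorm]
  | cons t L ih =>
    have hc : coeffNorm (t :: L) = |(t.1 : ℝ)| + coeffNorm L := by simp [coeffNorm]
    rw [termsMean_cons, hc, add_mul]
    refine (abs_add_le _ _).trans (add_le_add ?_ (ih fun u hu => h u (by simp [hu])))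
    rw [abs_mul]
    exact mul_le_mul_of_nonneg_left (h t (by simp)) (abs_nonneg _)

/-- Inserting one line into an even power of a line does not increase it. -/
lemma abs_termsMean_insertLines_le {q : Ω → Ω → ℝ} (hq : ∀ σ τ, |q σ τ| ≤ 1) (W : Ω → ℝ) {n : ℕ}
    (he : Even n) (r : ℕ) :
    |termsMean q W (insertLines r 2 (List.replicate n (0, 1)))| ≤
      coeffNorm (insertLines r 2 (List.replicate n (0, 1))) *
        linesMean q W 2 (List.replicate n (0, 1)) := by
  have hb : LinesBelow 2 (List.replicate n (0, 1)) := fun u hu => by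
    rw [List.eq_of_mem_replicate hu]; simp
  refine abs_termsMean_le_of_forall fun t ht => ?_
  obtain ⟨e, -, -, -, hs, -, hl⟩ := mem_insertLines ht
  rw [← linesMean_of_le q W hb hs]
  refine (abs_gmean_le_gmean _ _).trans (gmean_mono _ fun τ => ?_)
  rw [hl, lineProd_append, abs_mul]
  refine (mul_le_of_le_one_left (abs_nonneg _) (abs_lineProd_le_one hq _ _)).trans (le_of_eq ?_)
  rw [lineProd_replicate]
  exact abs_of_nonneg (he.pow_nonneg _)

end Evaluation
end SK
namespace SK

/-! ### Gaussian comparison of mean free energies -/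

section Comparison
variable {ι ι' Ω Ω' : Type*} [Fintype ι] [Fintype ι'] [Fintype Ω] [Nonempty Ω] [Fintype Ω']
  [Nonempty Ω']

lemma measurePreserving_gaussianPi_sum :
    MeasurePreserving (MeasurableEquiv.sumPiEquivProdPi fun _ : ι ⊕ ι' => ℝ)
      (gaussianPi (ι ⊕ ι')) ((gaussianPi ι).prod (gaussianPi ι')) :=
  measurePreserving_sumPiEquivProdPi fun _ => gaussianReal 0 1

lemma measurePreserving_comp_inl :
    MeasurePreserving (fun (J : ι ⊕ ι' → ℝ) (k : ι) => J (Sum.inl k))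
      (gaussianPi (ι ⊕ ι')) (gaussianPi ι) :=
  (measurePreserving_fst (μ := gaussianPi ι) (ν := gaussianPi ι')).comp
    measurePreserving_gaussianPi_sum

lemma measurePreserving_comp_inr :
    MeasurePreserving (fun (J : ι ⊕ ι' → ℝ) (k : ι') => J (Sum.inr k))
      (gaussianPi (ι ⊕ ι')) (gaussianPi ι') :=
  (measurePreserving_snd (μ := gaussianPi ι) (ν := gaussianPi ι')).comp
    measurePreserving_gaussianPi_sum

lemma integral_comp_inl {f : (ι → ℝ) → ℝ} (hf : Continuous f) :
    ∫ J, f (fun k => J (Sum.inl k)) ∂(gaussianPi (ι ⊕ ι')) = ∫ J, f J ∂(gaussianPi ι) := by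
  have h := measurePreserving_comp_inl (ι := ι) (ι' := ι')
  exact (integral_map h.measurable.aemeasurable hf.aestronglyMeasurable).symm.trans
    (by rw [h.map_eq])

lemma integral_comp_inr {f : (ι' → ℝ) → ℝ} (hf : Continuous f) :
    ∫ J, f (fun k => J (Sum.inr k)) ∂(gaussianPi (ι ⊕ ι')) = ∫ J, f J ∂(gaussianPi ι') := by
  have h := measurePreserving_comp_inr (ι := ι) (ι' := ι')
  exact (integral_map h.measurable.aemeasurable hf.aestronglyMeasurable).symm.trans
    (by rw [h.map_eq])

/-- The mean free energy `E log ∑ exp` of the Gaussian field with patterns `c`. -/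
noncomputable def meanLog (c : ι → Ω → ℝ) : ℝ :=
  ∫ J, Real.log (∑ σ, Real.exp (field (fun _ => 1) c J σ)) ∂(gaussianPi ι)

lemma continuous_log_field (a : ι → ℝ) (c : ι → Ω → ℝ) :
    Continuous fun J => Real.log (∑ σ, Real.exp (field a c J σ)) :=
  continuous_log_sum_exp (continuous_field a c)

/-- With a second replica, the thermal variances become a mean of self-covariance minus mutual
covariance, which can be compared pointwise. -/
lemma sum_variance_eq_gmean (W : Ω → ℝ) (c : ι → Ω → ℝ) :
    ∑ k, (gmean W (fun σ => c k σ * c k σ) - gmean W (c k) ^ 2) =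
      gmean (fun p : Ω × Ω => W p.1 + W p.2)
        (fun p => ∑ k, c k p.1 * c k p.1 - ∑ k, c k p.1 * c k p.2) := by
  rw [gmean_sub, gmean_sum, gmean_sum, ← Finset.sum_sub_distrib]
  refine Finset.sum_congr rfl fun k _ => ?_
  have h1 := gmean_prod W W (fun σ => c k σ * c k σ) (fun _ => 1)
  rw [gmean_const, mul_one] at h1
  simp only [mul_one] at h1
  rw [sq, ← gmean_prod, ← h1]

/-- Comparison of mean free energies through the covariances of the fields. -/
theorem meanLog_le_meanLog (c : ι → Ω → ℝ) (c' : ι' → Ω → ℝ)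
    (h : ∀ σ τ, ∑ k, c k σ * c k σ - ∑ k, c k σ * c k τ ≤
      ∑ k, c' k σ * c' k σ - ∑ k, c' k σ * c' k τ) : meanLog c ≤ meanLog c' := by
  -- Trigonometric interpolation has amplitude derivatives bounded by 1, and the products a·a' are ±
  -- sin x cos x. The derivative of φ is thus one nonnegative weight times a mean of the difference
  -- of the two sides of `h`.
  let a : ι' ⊕ ι → ℝ → ℝ := Sum.elim (fun _ => Real.sin) (fun _ => Real.cos)
  let a' : ι' ⊕ ι → ℝ → ℝ := Sum.elim (fun _ => Real.cos) (fun _ x => -Real.sin x)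
  have ha : ∀ k x, HasDerivAt (a k) (a' k x) x := by
    rintro (k | k) x
    · exact Real.hasDerivAt_sin x
    · exact Real.hasDerivAt_cos x
  have hb : ∀ k x, |a' k x| ≤ 1 := by
    rintro (k | k) x
    · exact Real.abs_cos_le_one x
    · simpa [a'] using Real.abs_sin_le_one x
  let C : ι' ⊕ ι → Ω → ℝ := Sum.elim c' c
  let φ : ℝ → ℝ := fun x => ∫ J, Real.log (∑ σ, Real.exp (field (fun k => a k x) C J σ))
    ∂(gaussianPi (ι' ⊕ ι))
  have hφ := hasDerivAt_integral_log ha hb C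
  have hfield : ∀ x (J : ι' ⊕ ι → ℝ) σ, field (fun k => a k x) C J σ =
      Real.sin x * field (fun _ => 1) c' (fun k => J (Sum.inl k)) σ +
      Real.cos x * field (fun _ => 1) c (fun k => J (Sum.inr k)) σ := by
    intro x J σ
    simp [field, a, C, Finset.mul_sum, mul_assoc]
  have h0 : φ 0 = meanLog c := by
    simp only [φ, hfield, Real.sin_zero, Real.cos_zero, zero_mul, one_mul, zero_add]
    exact integral_comp_inr (continuous_log_field _ c)
  have h1 : φ (Real.pi / 2) = meanLog c' := by
    simp only [φ, hfield, Real.sin_pi_div_two, Real.cos_pi_div_two, zero_mul, one_mul, add_zero]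
    exact integral_comp_inl (continuous_log_field _ c')
  rw [← h0, ← h1]
  have hmono : MonotoneOn φ (Set.Icc 0 (Real.pi / 2)) := by
    refine monotoneOn_of_deriv_nonneg (convex_Icc _ _)
      (fun x _ => (hφ x).continuousAt.continuousWithinAt)
      (fun x _ => (hφ x).differentiableAt.differentiableWithinAt) fun x hx => ?_
    rw [interior_Icc] at hx
    rw [show deriv φ x = _ from (hφ x).deriv, integral_gmean_field (fun k => a k x) (fun k => a' k x)]
    refine integral_nonneg fun J => ?_
    set W := field (fun k => a k x) C J
    have : ∑ k, a k x * a' k x * (gmean W (fun σ => C k σ * C k σ) - gmean W (C k) ^ 2) =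
        Real.sin x * Real.cos x * gmean (fun p : Ω × Ω => W p.1 + W p.2)
          (fun p => (∑ k, c' k p.1 * c' k p.1 - ∑ k, c' k p.1 * c' k p.2) -
            (∑ k, c k p.1 * c k p.1 - ∑ k, c k p.1 * c k p.2)) := by
      rw [gmean_sub (F := fun p : Ω × Ω => ∑ k, c' k p.1 * c' k p.1 - ∑ k, c' k p.1 * c' k p.2),
        ← sum_variance_eq_gmean, ← sum_variance_eq_gmean, Fintype.sum_sum_type]
      simp only [a, a', C, Sum.elim_inl, Sum.elim_inr, mul_sub, Finset.mul_sum]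
      rw [sub_eq_add_neg, ← Finset.sum_neg_distrib]
      congr 1
      exact Finset.sum_congr rfl fun k _ => by ring
    show 0 ≤ ∑ k, a k x * a' k x * (gmean W (fun σ => C k σ * C k σ) - gmean W (C k) ^ 2)
    rw [this]
    refine mul_nonneg (mul_nonneg (Real.sin_nonneg_of_nonneg_of_le_pi hx.1.le ?_)
      (Real.cos_nonneg_of_neg_pi_div_two_le_of_le ?_ hx.2.le)) (gmean_nonneg _ fun p => ?_)
    · linarith [hx.2, Real.pi_pos]
    · linarith [hx.1, Real.pi_pos]
    · linarith [h p.1 p.2]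
  have hpi : (0 : ℝ) ≤ Real.pi / 2 := by positivity
  exact hmono (Set.left_mem_Icc.2 hpi) (Set.right_mem_Icc.2 hpi) hpi

/-- The mean free energy depends on the covariance only. -/
theorem meanLog_congr (c : ι → Ω → ℝ) (c' : ι' → Ω → ℝ)
    (h : ∀ σ τ, ∑ k, c k σ * c k τ = ∑ k, c' k σ * c' k τ) : meanLog c = meanLog c' :=
  le_antisymm (meanLog_le_meanLog c c' fun σ τ => by rw [h, h])
    (meanLog_le_meanLog c' c fun σ τ => by rw [h, h])

omit [Nonempty Ω] [Nonempty Ω'] in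
lemma meanLog_comp_equiv (e : Ω ≃ Ω') (c : ι → Ω' → ℝ) :
    meanLog (fun k σ => c k (e σ)) = meanLog c := by
  unfold meanLog
  congr 1
  funext J
  congr 1
  exact e.sum_comp (fun σ => Real.exp (field (fun _ => 1) c J σ))

/-- The mean free energy of two independent systems. -/
lemma meanLog_prod (c : ι → Ω → ℝ) (c' : ι' → Ω' → ℝ) :
    meanLog (Sum.elim (fun k (p : Ω × Ω') => c k p.1) (fun k p => c' k p.2)) =
      meanLog c + meanLog c' := by
  have h1 : ∀ J : ι ⊕ ι' → ℝ, Real.log (∑ p : Ω × Ω', Real.exp (field (fun _ => 1)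
      (Sum.elim (fun k (p : Ω × Ω') => c k p.1) (fun k p => c' k p.2)) J p)) =
      Real.log (∑ σ, Real.exp (field (fun _ => 1) c (fun k => J (Sum.inl k)) σ)) +
      Real.log (∑ σ, Real.exp (field (fun _ => 1) c' (fun k => J (Sum.inr k)) σ)) := by
    intro J
    rw [← Real.log_mul (sum_exp_pos _).ne' (sum_exp_pos _).ne', Finset.sum_mul_sum,
      Fintype.sum_prod_type]
    congr 1
    refine Finset.sum_congr rfl fun σ _ => Finset.sum_congr rfl fun τ _ => ?_
    rw [← Real.exp_add]
    simp [field]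
  unfold meanLog
  simp only [h1]
  rw [integral_add, integral_comp_inl (continuous_log_field _ c),
    integral_comp_inr (continuous_log_field _ c')]
  · exact measurePreserving_comp_inl.integrable_comp_of_integrable
      (integrable_log_sum_exp_field _ c)
  · exact measurePreserving_comp_inr.integrable_comp_of_integrable
      (integrable_log_sum_exp_field _ c')

end Comparison
end SK
namespace SK

/-! ### Spins, overlaps and the covariance of the Hamiltonian -/

section Spins
variable {N : ℕ}

lemma spin_mul_self (σ : Config N) (i : Fin N) : spin σ i * spin σ i = 1 := by
  rcases Int.units_eq_one_or (σ i) with h | h <;> simp [spin, h]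

lemma abs_spin (σ : Config N) (i : Fin N) : |spin σ i| = 1 := by
  rcases Int.units_eq_one_or (σ i) with h | h <;> simp [spin, h]

lemma spin_neg (σ : Config N) (i : Fin N) : spin (-σ) i = -spin σ i := by simp [spin]

lemma overlap_comm (σ τ : Config N) : overlap σ τ = overlap τ σ := by
  unfold overlap; congr 1; exact Finset.sum_congr rfl fun i _ => mul_comm _ _

lemma overlap_self (hN : N ≠ 0) (σ : Config N) : overlap σ σ = 1 := by
  simp [overlap, spin_mul_self, hN]

lemma overlap_neg_left (σ τ : Config N) : overlap (-σ) τ = -overlap σ τ := by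
  simp [overlap, spin_neg, neg_div]

lemma overlap_neg_right (σ τ : Config N) : overlap σ (-τ) = -overlap σ τ := by
  simp [overlap, spin_neg, neg_div]

lemma abs_overlap_le_one (σ τ : Config N) : |overlap σ τ| ≤ 1 := by
  rw [overlap, abs_div, Nat.abs_cast]
  refine div_le_one_of_le₀ ((Finset.abs_sum_le_sum_abs _ _).trans ?_) (Nat.cast_nonneg _)
  simp [abs_mul, abs_spin]

lemma sum_spin_mul (σ τ : Config N) : ∑ i, spin σ i * spin τ i = N * overlap σ τ := by
  rcases eq_or_ne N 0 with rfl | hN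
  · simp
  · rw [overlap, mul_div_cancel₀ _ (by exact_mod_cast hN)]

/-- The square of a sum in terms of the pairs of sites. -/
lemma sum_bond_mul (x : Fin N → ℝ) :
    2 * ∑ b : Bond N, x b.1.1 * x b.1.2 = (∑ i, x i) ^ 2 - ∑ i, x i * x i := by
  have h1 : ∑ b : Bond N, x b.1.1 * x b.1.2 =
      ∑ i, ∑ j, if i < j then x i * x j else 0 := by
    rw [← Fintype.sum_prod_type' (f := fun i j => if i < j then x i * x j else 0),
      ← Finset.sum_filter]
    exact (Finset.sum_subtype (Finset.univ.filter fun p : Fin N × Fin N => p.1 < p.2)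
      (fun p => by simp) (fun p => x p.1 * x p.2)).symm
  have h2 : ∑ i, ∑ j, (if i < j then x i * x j else 0) =
      ∑ i, ∑ j, if j < i then x i * x j else 0 := by
    rw [Finset.sum_comm]
    exact Finset.sum_congr rfl fun i _ => Finset.sum_congr rfl fun j _ => by
      split_ifs
      · exact mul_comm _ _
      · rfl
  have h3 : (∑ i, x i) ^ 2 = ∑ i, ∑ j, (if i < j then x i * x j else 0) +
      ∑ i, ∑ j, (if j < i then x i * x j else 0) + ∑ i, x i * x i := by
    rw [sq, Finset.sum_mul_sum, ← Finset.sum_add_distrib, ← Finset.sum_add_distrib]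
    refine Finset.sum_congr rfl fun i _ => ?_
    rw [← Finset.sum_add_distrib]
    have : x i * x i = ∑ j, if i = j then x i * x j else 0 := by simp
    rw [this, ← Finset.sum_add_distrib]
    refine Finset.sum_congr rfl fun j _ => ?_
    rcases lt_trichotomy i j with h | h | h
    · simp [h, h.not_gt, h.ne]
    · simp [h]
    · simp [h, h.not_gt, h.ne']
  rw [h3, ← h2, h1]; ring

/-- The bond patterns of the Hamiltonian. -/
noncomputable def bondPattern (N : ℕ) (b : Bond N) (σ : Config N) : ℝ :=
  (1 / Real.sqrt N) * (spin σ b.1.1 * spin σ b.1.2)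

/-- The patterns of a random field on the sites. -/
noncomputable def sitePattern (N : ℕ) (i : Fin N) (σ : Config N) : ℝ := (1 / Real.sqrt N) * spin σ i

/-- The bond patterns followed by the site patterns. -/
noncomputable def cavityPattern (N : ℕ) : Bond N ⊕ Fin N → Config N → ℝ :=
  Sum.elim (bondPattern N) (sitePattern N)

lemma one_div_sqrt_sq (N : ℕ) : (1 / Real.sqrt N) * (1 / Real.sqrt N) = 1 / N := by
  rw [div_mul_div_comm, Real.mul_self_sqrt (Nat.cast_nonneg _), one_mul]

lemma sum_sitePattern_mul (hN : N ≠ 0) (σ τ : Config N) :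
    ∑ i, sitePattern N i σ * sitePattern N i τ = overlap σ τ := by
  have : ∀ i, sitePattern N i σ * sitePattern N i τ = 1 / N * (spin σ i * spin τ i) := fun i => by
    rw [← one_div_sqrt_sq, sitePattern, sitePattern]; ring
  simp only [this, ← Finset.mul_sum, sum_spin_mul]
  field_simp

/-- The energy covariance is a function of the overlap alone; the −1 is the missing diagonal i = j.
-/
lemma sum_bondPattern_mul (hN : N ≠ 0) (σ τ : Config N) :
    ∑ b, bondPattern N b σ * bondPattern N b τ = (N * overlap σ τ ^ 2 - 1) / 2 := by
  have : ∀ b : Bond N, bondPattern N b σ * bondPattern N b τ =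
      1 / N * ((spin σ b.1.1 * spin τ b.1.1) * (spin σ b.1.2 * spin τ b.1.2)) := fun b => by
    rw [← one_div_sqrt_sq, bondPattern, bondPattern]; ring
  have h2 := sum_bond_mul fun i => spin σ i * spin τ i
  have h3 : ∑ i, spin σ i * spin τ i * (spin σ i * spin τ i) = N := by
    simp [mul_mul_mul_comm, spin_mul_self]
  rw [h3, sum_spin_mul] at h2
  simp only [this, ← Finset.mul_sum]
  have hN' : (N : ℝ) ≠ 0 := by exact_mod_cast hN
  generalize ∑ b : Bond N, spin σ b.1.1 * spin τ b.1.1 * (spin σ b.1.2 * spin τ b.1.2) = S at h2 ⊢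
  field_simp
  linear_combination h2

lemma field_bondPattern (β : ℝ) (J : Bond N → ℝ) (σ : Config N) :
    field (fun _ => β) (bondPattern N) J σ = -β * hamiltonian J σ := by
  simp only [field, bondPattern, hamiltonian, Finset.mul_sum]
  exact Finset.sum_congr rfl fun b _ => by ring

lemma gibbs_eq (β : ℝ) (J : Bond N → ℝ) (σ : Config N) :
    gibbs β J σ = Real.exp (field (fun _ => β) (bondPattern N) J σ) /
      ∑ τ, Real.exp (field (fun _ => β) (bondPattern N) J τ) := by
  simp only [gibbs, partitionFunction, field_bondPattern]

/-- The product of the single-replica partition functions is the partition function of the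
replicated system, so Ω is itself a Gibbs mean. -/
lemma replicaAvg_eq {s : ℕ} (β : ℝ) (J : Bond N → ℝ) (f : (Fin s → Config N) → ℝ) :
    replicaAvg β J f = gmean (repEnergy (Fin s) (field (fun _ => β) (bondPattern N) J)) f := by
  unfold replicaAvg gmean
  set W := field (fun _ => β) (bondPattern N) J
  have hZ : ∑ τ : Fin s → Config N, Real.exp (repEnergy (Fin s) W τ) =
      ∏ _a : Fin s, ∑ σ, Real.exp (W σ) := by
    rw [Finset.prod_univ_sum, Fintype.piFinset_univ]
    exact Finset.sum_congr rfl fun τ _ => Real.exp_sum _ _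
  rw [hZ, Finset.sum_div]
  refine Finset.sum_congr rfl fun τ _ => ?_
  simp only [gibbs_eq, Finset.prod_div_distrib]
  rw [repEnergy, Real.exp_sum]
  ring

/-- The lines of an overlap graph as pairs of natural numbers. -/
def OverlapGraph.natLines (G : OverlapGraph) : List (ℕ × ℕ) := G.lines.map fun e => (e.1, e.2)

lemma graphAvg_eq (β : ℝ) (G : OverlapGraph) :
    graphAvg N β G = ∫ J, linesMean overlap (field (fun _ => β) (bondPattern N) J) G.replicas
      G.natLines ∂(gaussianPi (Bond N)) := by
  unfold graphAvg
  show ∫ J, _ ∂(gaussianPi (Bond N)) = _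
  congr 1
  funext J
  rw [replicaAvg_eq, linesMean]
  congr 1
  funext τ
  simp only [OverlapGraph.monomial, lineProd, OverlapGraph.natLines, List.map_map]
  congr 1
  refine List.map_congr_left fun e _ => ?_
  simp [extendReplicas_of_lt]

lemma alphaN_mul (hN : N ≠ 0) (β : ℝ) : N * alphaN N β =
    ∫ J, Real.log (∑ σ, Real.exp (field (fun _ => β) (bondPattern N) J σ)) ∂(gaussianPi (Bond N)) := by
  rw [alphaN, mul_div_cancel₀ _ (by exact_mod_cast hN)]
  simp only [partitionFunction, field_bondPattern]
  rfl

lemma field_const_smul {ι Ω : Type*} [Fintype ι] (β : ℝ) (c : ι → Ω → ℝ) (J : ι → ℝ) (σ : Ω) :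
    field (fun _ => β) c J σ = field (fun _ => 1) (fun k τ => β * c k τ) J σ := by
  simp [field]

lemma alphaN_mul_eq_meanLog (hN : N ≠ 0) (β : ℝ) :
    N * alphaN N β = meanLog fun b σ => β * bondPattern N b σ := by
  rw [alphaN_mul hN, meanLog]
  simp only [← field_const_smul]

end Spins
end SK
namespace SK

/-! ### Derivative of the free energy, existence of the limit, adding a spin -/

section General
variable {ι Ω : Type*} [Fintype ι] [Fintype Ω] [Nonempty Ω] {a a' : ι → ℝ → ℝ}

omit [Nonempty Ω] in
lemma gmean_pair (W : Ω → ℝ) (g : Ω → Ω → ℝ) :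
    gmean (fun p : Ω × Ω => W p.1 + W p.2) (fun p => g p.1 p.2) =
      gmean (repEnergy (Fin 2) W) (fun τ => g (τ 0) (τ 1)) := by
  rw [← gmean_comp_equiv (finTwoArrowEquiv Ω)]
  congr 1
  funext τ
  simp [repEnergy, Fin.sum_univ_two]

lemma linesMean_replicate (q : Ω → Ω → ℝ) (W : Ω → ℝ) (r : ℕ) :
    linesMean q W 2 (List.replicate r (0, 1)) =
      gmean (fun p : Ω × Ω => W p.1 + W p.2) (fun p => q p.1 p.2 ^ r) := by
  rw [gmean_pair W fun σ τ => q σ τ ^ r, linesMean]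
  congr 1
  funext τ
  rw [lineProd_replicate, extendReplicas_of_lt _ (by norm_num : 0 < 2),
    extendReplicas_of_lt _ (by norm_num : 1 < 2)]
  rfl

/-- The derivative of the mean free energy when the covariance is a function of the overlap. -/
lemma hasDerivAt_integral_log_lines (ha : ∀ k x, HasDerivAt (a k) (a' k x) x)
    (hb : ∀ k x, |a' k x| ≤ 1) (c : ι → Ω → ℝ) (q : Ω → Ω → ℝ) (r : ℕ) (x w₁ w₀ : ℝ)
    (hκ : ∀ σ σ', w₁ * q σ σ' ^ r + w₀ = ∑ k, (a k x * a' k x) * (c k σ * c k σ'))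
    (hd : ∀ σ, q σ σ = 1) :
    HasDerivAt (fun y => ∫ J, Real.log (∑ σ, Real.exp (field (fun k => a k y) c J σ))
        ∂(gaussianPi ι))
      (w₁ * (1 - ∫ J, linesMean q (field (fun k => a k x) c J) 2 (List.replicate r (0, 1))
        ∂(gaussianPi ι))) x := by
  have h := hasDerivAt_integral_log ha hb c x
  rw [integral_gmean_field (fun k => a k x) (fun k => a' k x)] at h
  refine h.congr_deriv ?_
  have hI : (1 : ℝ) = ∫ _J : ι → ℝ, (1 : ℝ) ∂(gaussianPi ι) := by simp
  rw [hI, ← integral_sub (integrable_const _) (integrable_linesMean _ c q _ _),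
    ← integral_const_mul]
  congr 1
  funext J
  set W := field (fun k => a k x) c J
  rw [linesMean_replicate, ← gmean_const (fun p : Ω × Ω => W p.1 + W p.2) 1, ← gmean_sub,
    ← gmean_const_mul]
  have h1 : ∀ k, a k x * a' k x * (gmean W (fun σ => c k σ * c k σ) - gmean W (c k) ^ 2) =
      gmean (fun p : Ω × Ω => W p.1 + W p.2)
        (fun p => a k x * a' k x * (c k p.1 * c k p.1 - c k p.1 * c k p.2)) := by
    intro k
    have h1 := gmean_prod W W (fun σ => c k σ * c k σ) (fun _ => 1)
    rw [gmean_const, mul_one] at h1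
    simp only [mul_one] at h1
    rw [gmean_const_mul, gmean_sub, sq, ← gmean_prod, ← h1]
  rw [Finset.sum_congr rfl fun k _ => h1 k, ← gmean_sum]
  congr 1
  funext p
  simp only [mul_sub, Finset.sum_sub_distrib]
  rw [← hκ, ← hκ, hd, one_pow]
  ring

end General

/-- The quenched mean of a product of overlaps between `s` replicas. -/
noncomputable def quenchedLines (N : ℕ) (β : ℝ) (s : ℕ) (m : List (ℕ × ℕ)) : ℝ :=
  ∫ J, linesMean overlap (field (fun _ => β) (bondPattern N) J) s m ∂(gaussianPi (Bond N))

lemma graphAvg_eq_quenchedLines (N : ℕ) (β : ℝ) (G : OverlapGraph) :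
    graphAvg N β G = quenchedLines N β G.replicas G.natLines := graphAvg_eq β G

/-- The quenched mean squared overlap. -/
noncomputable def overlapSq (N : ℕ) (β : ℝ) : ℝ := quenchedLines N β 2 (List.replicate 2 (0, 1))

/-- The form w₁qʳ + w₀ for moving the temperature: r = 2, so a β-derivative inserts double lines,
and w₁ carries the factor N. -/
lemma bond_covariance {N : ℕ} (hN : N ≠ 0) (x : ℝ) (σ τ : Config N) :
    x * N / 2 * overlap σ τ ^ 2 + -x / 2 =
      ∑ k, (x * 1) * (bondPattern N k σ * bondPattern N k τ) := by
  rw [← Finset.mul_sum, sum_bondPattern_mul hN]; ring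

/-- The derivative of `alphaN`. -/
lemma hasDerivAt_alphaN {N : ℕ} (hN : N ≠ 0) (x : ℝ) :
    HasDerivAt (fun β => alphaN N β) (x / 2 * (1 - overlapSq N x)) x := by
  have h := hasDerivAt_integral_log_lines (ι := Bond N) (a := fun _ y => y) (a' := fun _ _ => 1)
    (fun _ y => hasDerivAt_id y) (by simp) (bondPattern N) overlap 2 x (x * N / 2) (-x / 2)
    (bond_covariance hN x) (overlap_self hN)
  have hN' : (N : ℝ) ≠ 0 := by exact_mod_cast hN
  refine ((h.div_const N).congr_deriv ?_).congr_of_eventuallyEq (Eventually.of_forall fun β => ?_)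
  · rw [overlapSq, quenchedLines]; field_simp
  · dsimp only
    rw [← alphaN_mul hN]; field_simp

lemma quenchedLines_nonneg_of_even (N : ℕ) (β : ℝ) {n : ℕ} (hn : Even n) :
    0 ≤ quenchedLines N β 2 (List.replicate n (0, 1)) :=
  integral_nonneg fun J => gmean_nonneg _ fun τ => by
    rw [lineProd_replicate]; exact hn.pow_nonneg _

lemma abs_quenchedLines_le_one (N : ℕ) (β : ℝ) (s : ℕ) (m : List (ℕ × ℕ)) :
    |quenchedLines N β s m| ≤ 1 := by
  refine (abs_integral_le_integral_abs).trans ?_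
  have : ∫ _J : Bond N → ℝ, (1 : ℝ) ∂(gaussianPi (Bond N)) = 1 := by simp
  rw [← this]
  refine integral_mono (integrable_linesMean _ _ _ _ _).abs (integrable_const _) fun J => ?_
  exact abs_gmean_le _ fun τ => abs_lineProd_le_one abs_overlap_le_one _ _

lemma overlapSq_nonneg (N : ℕ) (β : ℝ) : 0 ≤ overlapSq N β :=
  quenchedLines_nonneg_of_even N β even_two

lemma overlapSq_le_one (N : ℕ) (β : ℝ) : overlapSq N β ≤ 1 :=
  (abs_le.1 (abs_quenchedLines_le_one N β _ _)).2

lemma alphaN_zero_right {N : ℕ} (hN : N ≠ 0) : alphaN N 0 = Real.log 2 := by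
  have h := alphaN_mul hN 0
  simp [field] at h
  exact h.resolve_right hN

/-- The gap to the annealed free energy is monotone. -/
lemma monotoneOn_annealed_sub_alphaN {N : ℕ} (hN : N ≠ 0) :
    MonotoneOn (fun y => Real.log 2 + y ^ 2 / 4 - alphaN N y) (Set.Ici 0) := by
  have hd : ∀ x, HasDerivAt (fun y => Real.log 2 + y ^ 2 / 4 - alphaN N y)
      (x / 2 * overlapSq N x) x := fun x =>
    ((((hasDerivAt_pow 2 x).div_const 4).const_add (Real.log 2)).sub
      (hasDerivAt_alphaN hN x)).congr_deriv (by push_cast; ring)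
  refine monotoneOn_of_deriv_nonneg (convex_Ici 0)
    (fun x _ => (hd x).continuousAt.continuousWithinAt)
    (fun x _ => (hd x).differentiableAt.differentiableWithinAt) fun x hx => ?_
  rw [interior_Ici] at hx
  rw [(hd x).deriv]
  exact mul_nonneg (by have : 0 < x := hx; positivity) (overlapSq_nonneg N x)

/-- The annealed bound. -/
lemma alphaN_le {N : ℕ} (hN : N ≠ 0) {β : ℝ} (hβ : 0 ≤ β) :
    alphaN N β ≤ Real.log 2 + β ^ 2 / 4 := by
  have := monotoneOn_annealed_sub_alphaN hN (Set.mem_Ici.2 le_rfl) (Set.mem_Ici.2 hβ) hβ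
  simp only [alphaN_zero_right hN] at this
  linarith

/-- Convexity of the square: the overlap of the joint system is the weighted mean of the overlaps of
its parts. This is the covariance inequality behind superadditivity. -/
lemma convex_sq_overlap {M N : ℕ} (hM : M ≠ 0) (hN : N ≠ 0) (x y : ℝ) :
    (M + N : ℝ) * ((M * x + N * y) / (M + N)) ^ 2 ≤ M * x ^ 2 + N * y ^ 2 := by
  have hM' : (0 : ℝ) < M := by exact_mod_cast Nat.pos_of_ne_zero hM
  have hN' : (0 : ℝ) < N := by exact_mod_cast Nat.pos_of_ne_zero hN
  have : (M + N : ℝ) * ((M * x + N * y) / (M + N)) ^ 2 = (M * x + N * y) ^ 2 / (M + N) := by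
    field_simp
  rw [this, div_le_iff₀ (by positivity)]
  nlinarith [mul_nonneg (mul_nonneg hM'.le hN'.le) (sq_nonneg (x - y))]

/-- Superadditivity of the free energy. -/
lemma superadditive_alphaN {M N : ℕ} (hM : M ≠ 0) (hN : N ≠ 0) (β : ℝ) :
    M * alphaN M β + N * alphaN N β ≤ (M + N : ℕ) * alphaN (M + N) β := by
  have hMN : M + N ≠ 0 := by omega
  rw [alphaN_mul_eq_meanLog hM, alphaN_mul_eq_meanLog hN, alphaN_mul_eq_meanLog hMN,
    ← meanLog_prod, ← meanLog_comp_equiv (Fin.appendEquiv M N)]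
  -- Only self-covariance minus mutual covariance is compared, so the diagonal constants −1/2
  -- cancel, although two independent systems have two of them.
  refine meanLog_le_meanLog _ _ fun σ τ => ?_
  have hM' : (M : ℝ) ≠ 0 := by exact_mod_cast hM
  have hN' : (N : ℝ) ≠ 0 := by exact_mod_cast hN
  have ho : overlap (Fin.appendEquiv M N σ) (Fin.appendEquiv M N τ) =
      (M * overlap σ.1 τ.1 + N * overlap σ.2 τ.2) / (M + N) := by
    rw [← sum_spin_mul, ← sum_spin_mul, overlap, Fin.sum_univ_add]
    simp [spin, Fin.appendEquiv]
  have hc : ∀ σ τ : Config M × Config N,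
      ∑ k, Sum.elim (fun k (p : Config M × Config N) => β * bondPattern M k p.1)
        (fun k p => β * bondPattern N k p.2) k σ *
        Sum.elim (fun k (p : Config M × Config N) => β * bondPattern M k p.1)
        (fun k p => β * bondPattern N k p.2) k τ =
      β ^ 2 * ((M * overlap σ.1 τ.1 ^ 2 - 1) / 2 + (N * overlap σ.2 τ.2 ^ 2 - 1) / 2) := by
    intro σ τ
    simp only [Fintype.sum_sum_type, Sum.elim_inl, Sum.elim_inr, mul_mul_mul_comm, ← Finset.mul_sum,
      sum_bondPattern_mul hM, sum_bondPattern_mul hN]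
    ring
  simp only [hc, mul_mul_mul_comm, ← Finset.mul_sum, sum_bondPattern_mul hMN, ho,
    overlap_self hMN, overlap_self hM, overlap_self hN]
  have := mul_le_mul_of_nonneg_left
    (convex_sq_overlap hM hN (overlap σ.1 τ.1) (overlap σ.2 τ.2)) (sq_nonneg β)
  push_cast
  nlinarith [this]

/-- The infinite-volume limit exists. -/
theorem tendsto_alphaN {β : ℝ} (hβ : 0 ≤ β) :
    Tendsto (fun N : ℕ => alphaN N β) atTop (𝓝 (alpha β)) := by
  -- Fekete's lemma is applied to −Nα_N, whose ratios to N are bounded below by the annealed bound.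
  have hs : Subadditive fun N : ℕ => -(N * alphaN N β) := by
    intro M N
    rcases eq_or_ne M 0 with rfl | hM
    · simp
    rcases eq_or_ne N 0 with rfl | hN
    · simp
    have := superadditive_alphaN hM hN β
    linarith
  have hbdd : BddBelow (Set.range fun N : ℕ => -(N * alphaN N β) / N) := by
    refine ⟨-(Real.log 2 + β ^ 2 / 4), ?_⟩
    rintro _ ⟨N, rfl⟩
    rcases eq_or_ne N 0 with rfl | hN
    · have := Real.log_nonneg (by norm_num : (1 : ℝ) ≤ 2)
      have := sq_nonneg β
      simp
      linarith
    · have hN' : (N : ℝ) ≠ 0 := by exact_mod_cast hN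
      dsimp only
      rw [neg_div, mul_div_cancel_left₀ _ hN']
      linarith [alphaN_le hN hβ]
  have h := (hs.tendsto_lim hbdd).neg
  have h' : Tendsto (fun N : ℕ => alphaN N β) atTop (𝓝 (-hs.lim)) := by
    refine h.congr' ((eventually_ne_atTop 0).mono fun N hN => ?_)
    have hN' : (N : ℝ) ≠ 0 := by exact_mod_cast hN
    rw [neg_div, neg_neg, mul_div_cancel_left₀ _ hN']
  exact tendsto_nhds_limUnder ⟨_, h'⟩

/-- The mean free energy of `N` spins in an additional random field of strength `y`. -/
noncomputable def cavityLog (N : ℕ) (β y : ℝ) : ℝ :=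
  ∫ J, Real.log (∑ σ, Real.exp (field (Sum.elim (fun _ => β) fun _ => y) (cavityPattern N) J σ))
    ∂(gaussianPi (Bond N ⊕ Fin N))

/-- Adding a spin, up to a gauge transformation. -/
def gaugeEquiv (N : ℕ) : Config N × ℤˣ ≃ Config (N + 1) where
  toFun p := Fin.snoc (α := fun _ => ℤˣ) (fun i => p.1 i * p.2) p.2
  invFun τ := (fun i => τ i.castSucc * τ (Fin.last N), τ (Fin.last N))
  left_inv p := by
    ext i
    · simp [mul_assoc]
    · simp
  right_inv τ := by
    funext i
    refine Fin.lastCases ?_ (fun j => ?_) i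
    · simp
    · simp [mul_assoc]

/-- The inverse temperature of the `N`-spin subsystem of `N + 1` spins. -/
noncomputable def cavityBeta (N : ℕ) (β : ℝ) : ℝ := β * Real.sqrt (N / (N + 1))

lemma cavityBeta_sq (N : ℕ) (β : ℝ) : cavityBeta N β ^ 2 = β ^ 2 * (N / (N + 1)) := by
  rw [cavityBeta, mul_pow, Real.sq_sqrt (by positivity)]

/-- The cavity decomposition of the free energy of `N + 1` spins. -/
lemma alphaN_succ {N : ℕ} (hN : N ≠ 0) (β : ℝ) :
    (N + 1 : ℕ) * alphaN (N + 1) β =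
      Real.log 2 + cavityLog N (cavityBeta N β) (cavityBeta N β) := by
  rw [alphaN_mul_eq_meanLog (by omega), ← meanLog_comp_equiv (gaugeEquiv N)]
  let C : Bond N ⊕ Fin N → Config N → ℝ := fun k σ => cavityBeta N β * cavityPattern N k σ
  -- In the gauge σᵢ ↦ σᵢε the last spin ε carries no energy: it is an independent system without
  -- couplings, whose two states give log 2.
  let C' : Empty → ℤˣ → ℝ := fun _ _ => 0
  have h1 : cavityLog N (cavityBeta N β) (cavityBeta N β) = meanLog C := by
    unfold cavityLog meanLog
    congr 1
    funext J
    congr 1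
    refine Finset.sum_congr rfl fun σ _ => ?_
    congr 1
    simp [field, C]
  have h2 : meanLog C' = Real.log 2 := by
    simp [meanLog, field]
  rw [h1, ← h2, add_comm (meanLog C'), ← meanLog_prod]
  refine meanLog_congr _ _ fun σ τ => ?_
  have hN' : (N : ℝ) ≠ 0 := by exact_mod_cast hN
  -- The new overlap is ±(Nq + 1)/(N + 1). In its square the sign drops, the term quadratic in q is
  -- the N-spin covariance at β', and the linear term is the covariance of the site field.
  have ho : ((N : ℝ) + 1) * overlap (gaugeEquiv N σ) (gaugeEquiv N τ) =
      ((σ.2 : ℤ) : ℝ) * ((τ.2 : ℤ) : ℝ) * (N * overlap σ.1 τ.1 + 1) := by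
    have := sum_spin_mul (gaugeEquiv N σ) (gaugeEquiv N τ)
    rw [Nat.cast_add, Nat.cast_one] at this
    rw [← this, Fin.sum_univ_castSucc, ← sum_spin_mul, mul_add, Finset.mul_sum, mul_one]
    congr 1
    · refine Finset.sum_congr rfl fun i _ => ?_
      simp [spin, gaugeEquiv]
      ring
    · simp [spin, gaugeEquiv]
  have hu : ∀ u : ℤˣ, ((u : ℤ) : ℝ) ^ 2 = 1 := fun u => by
    rcases Int.units_eq_one_or u with h | h <;> simp [h]
  have hsq : ((N : ℝ) + 1) ^ 2 * overlap (gaugeEquiv N σ) (gaugeEquiv N τ) ^ 2 =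
      (N * overlap σ.1 τ.1 + 1) ^ 2 := by
    rw [← mul_pow, ho, mul_pow, mul_pow, hu, hu, one_mul, one_mul]
  have hR : ∑ k, Sum.elim (fun k (p : Config N × ℤˣ) => C k p.1) (fun k p => C' k p.2) k σ *
      Sum.elim (fun k (p : Config N × ℤˣ) => C k p.1) (fun k p => C' k p.2) k τ =
      β ^ 2 * (N / (N + 1)) * ((N * overlap σ.1 τ.1 ^ 2 - 1) / 2 + overlap σ.1 τ.1) := by
    simp only [Fintype.sum_sum_type, Sum.elim_inl, Sum.elim_inr, C, C', cavityPattern,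
      mul_mul_mul_comm, ← Finset.mul_sum, sum_bondPattern_mul hN, sum_sitePattern_mul hN]
    rw [← cavityBeta_sq]
    simp only [Finset.univ_eq_empty, Finset.sum_empty]
    ring
  rw [hR]
  simp only [mul_mul_mul_comm, ← Finset.mul_sum, sum_bondPattern_mul (Nat.succ_ne_zero N)]
  have hpos : ((N : ℝ) + 1) ≠ 0 := by positivity
  push_cast
  field_simp
  linear_combination β ^ 2 * hsq

end SK
namespace SK

/-! ### Taylor and Gronwall estimates in the squared field strength -/

/-- A Taylor estimate in the variable `y ^ 2`. -/
lemma abs_sub_taylor_le {Y : ℝ} {K : ℝ} (n : ℕ) : ∀ {f : ℕ → ℝ → ℝ},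
    (∀ k < n, ∀ y, HasDerivAt (f k) (2 * y * f (k + 1) y) y) →
    (∀ y, 0 ≤ y → y ≤ Y → |f n y| ≤ K) → ∀ y, 0 ≤ y → y ≤ Y →
    |f 0 y - ∑ k ∈ Finset.range n, f k 0 * y ^ (2 * k) / k.factorial| ≤ K * y ^ (2 * n) := by
  induction n with
  | zero => intro f _ hK y h0 hY; simpa using hK y h0 hY
  | succ n ih =>
    intro f hf hK y h0 hY
    have h1 := ih (f := fun k => f (k + 1)) (fun k hk => hf (k + 1) (by omega)) hK
    let P : ℝ → ℝ := fun y => ∑ k ∈ Finset.range (n + 1), f k 0 * y ^ (2 * k) / k.factorial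
    let P' : ℝ → ℝ := fun y => ∑ k ∈ Finset.range n, f (k + 1) 0 * y ^ (2 * k) / k.factorial
    have hP : ∀ y, HasDerivAt P (2 * y * P' y) y := by
      intro y
      have hk : ∀ k ∈ Finset.range n, HasDerivAt
          (fun y : ℝ => f (k + 1) 0 * y ^ (2 * (k + 1)) / (k + 1).factorial)
          (2 * y * (f (k + 1) 0 * y ^ (2 * k) / k.factorial)) y := by
        intro k _
        refine (((hasDerivAt_pow (2 * (k + 1)) y).const_mul (f (k + 1) 0)).div_const _).congr_deriv ?_
        have hk1 : ((k + 1 : ℕ) : ℝ) ≠ 0 := by positivity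
        have hk2 : (k.factorial : ℝ) ≠ 0 := by positivity
        rw [Nat.factorial_succ, show 2 * (k + 1) - 1 = 2 * k + 1 by omega]
        push_cast at hk1 ⊢
        field_simp
        ring
      refine ((HasDerivAt.fun_sum hk).add_const (f 0 0)).congr_of_eventuallyEq ?_ |>.congr_deriv ?_
      · refine Eventually.of_forall fun z => ?_
        simp [P, Finset.sum_range_succ' _ n]
      · simp [P', Finset.mul_sum]
    have hpow : ∀ y : ℝ, HasDerivAt (fun y : ℝ => K * y ^ (2 * (n + 1)))
        (K * ((2 * (n + 1) : ℕ) * y ^ (2 * n + 1))) y := fun y =>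
      ((hasDerivAt_pow (2 * (n + 1)) y).const_mul K)
    have hbd : ∀ y, 0 ≤ y → y ≤ Y → |2 * y * (f 1 y - P' y)| ≤
        K * ((2 * (n + 1) : ℕ) * y ^ (2 * n + 1)) := by
      intro y h0 hY
      have hK0 : 0 ≤ K := (abs_nonneg _).trans (hK y h0 hY)
      rw [abs_mul, abs_of_nonneg (by positivity)]
      calc 2 * y * |f 1 y - P' y| ≤ 2 * y * (K * y ^ (2 * n)) := by
            gcongr; exact h1 y h0 hY
        _ = 2 * (K * y ^ (2 * n + 1)) := by ring
        -- The factor n + 1 is given away so that the bound is exactly the derivative of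
        -- K·y^(2(n+1)), with no factorial in the conclusion.
        _ ≤ (2 * (n + 1)) * (K * y ^ (2 * n + 1)) := by
            gcongr
            linarith [(Nat.cast_nonneg n : (0 : ℝ) ≤ n)]
        _ = _ := by push_cast; ring
    have hz : f 0 0 - P 0 = 0 := by simp [P, Finset.sum_range_succ' _ n]
    -- Both signs of the remainder are treated at once: K·y^(2(n+1)) ± remainder vanishes at 0 and
    -- is nondecreasing on [0, Y].
    have mono : ∀ ε : ℝ, |ε| = 1 →
        0 ≤ K * y ^ (2 * (n + 1)) + ε * (f 0 y - P y) := by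
      intro ε hε
      have hd : ∀ y, HasDerivAt (fun y => K * y ^ (2 * (n + 1)) + ε * (f 0 y - P y))
          (K * ((2 * (n + 1) : ℕ) * y ^ (2 * n + 1)) + ε * (2 * y * (f 1 y - P' y))) y := fun y =>
        ((hpow y).add (((hf 0 (by omega) y).sub (hP y)).const_mul ε)).congr_deriv (by ring)
      have hm : MonotoneOn (fun y => K * y ^ (2 * (n + 1)) + ε * (f 0 y - P y)) (Set.Icc 0 Y) := by
        refine monotoneOn_of_deriv_nonneg (convex_Icc _ _)
          (fun x _ => (hd x).continuousAt.continuousWithinAt)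
          (fun x _ => (hd x).differentiableAt.differentiableWithinAt) fun x hx => ?_
        rw [interior_Icc] at hx
        rw [(hd x).deriv]
        have h2 := hbd x hx.1.le hx.2.le
        have h3 : |ε * (2 * x * (f 1 x - P' x))| = |2 * x * (f 1 x - P' x)| := by
          rw [abs_mul, hε, one_mul]
        linarith [neg_abs_le (ε * (2 * x * (f 1 x - P' x)))]
      have := hm (Set.left_mem_Icc.2 (h0.trans hY)) (Set.mem_Icc.2 ⟨h0, hY⟩) h0
      simpa [hz] using this
    rw [abs_le]
    constructor
    · linarith [mono 1 (by simp)]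
    · linarith [mono (-1) (by simp)]

/-- A Gronwall estimate in the variable `y ^ 2`. -/
lemma le_exp_mul_of_deriv_le {u u' : ℝ → ℝ} {c : ℝ} (hu : ∀ y, HasDerivAt u (2 * y * u' y) y)
    (h : ∀ y, u' y ≤ c * u y) {y : ℝ} (hy : 0 ≤ y) : u y ≤ Real.exp (c * y ^ 2) * u 0 := by
  have hd : ∀ y, HasDerivAt (fun y => Real.exp (-(c * y ^ 2)) * u y)
      (2 * y * (Real.exp (-(c * y ^ 2)) * (u' y - c * u y))) y := fun y => by
    have h1 : HasDerivAt (fun y : ℝ => -(c * y ^ 2)) (-(c * (2 * y))) y :=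
      (((hasDerivAt_pow 2 y).const_mul c).neg).congr_deriv (by norm_num)
    exact (h1.exp.mul (hu y)).congr_deriv (by ring)
  have hm : AntitoneOn (fun y => Real.exp (-(c * y ^ 2)) * u y) (Set.Ici 0) := by
    refine antitoneOn_of_deriv_nonpos (convex_Ici 0)
      (fun x _ => (hd x).continuousAt.continuousWithinAt)
      (fun x _ => (hd x).differentiableAt.differentiableWithinAt) fun x hx => ?_
    rw [interior_Ici] at hx
    have hx' : 0 < x := hx
    rw [(hd x).deriv]
    exact mul_nonpos_of_nonneg_of_nonpos (by positivity)
      (mul_nonpos_of_nonneg_of_nonpos (Real.exp_pos _).le (by linarith [h x]))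
  have := hm (Set.mem_Ici.2 le_rfl) (Set.mem_Ici.2 hy) hy
  simp only [ne_eq, OfNat.ofNat_ne_zero, not_false_eq_true, zero_pow, mul_zero, neg_zero,
    Real.exp_zero, one_mul] at this
  calc u y = Real.exp (c * y ^ 2) * (Real.exp (-(c * y ^ 2)) * u y) := by
        rw [← mul_assoc, ← Real.exp_add]; simp
    _ ≤ _ := by gcongr

/-! ### Expansion of the free energy of the cavity field -/

section Cavity
variable {N : ℕ}

/-- The quenched mean of a combination of terms. -/
noncomputable def quenchedTerms (N : ℕ) (β : ℝ) (L : List (ℤ × ℕ × List (ℕ × ℕ))) : ℝ :=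
  ∫ J, termsMean overlap (field (fun _ => β) (bondPattern N) J) L ∂(gaussianPi (Bond N))

/-- The quenched mean of a combination of terms in an additional random field. -/
noncomputable def cavityTerms (N : ℕ) (β y : ℝ) (L : List (ℤ × ℕ × List (ℕ × ℕ))) : ℝ :=
  ∫ J, termsMean overlap (field (Sum.elim (fun _ => β) fun _ => y) (cavityPattern N) J) L
    ∂(gaussianPi (Bond N ⊕ Fin N))

lemma field_cavity_zero (β : ℝ) (J : Bond N ⊕ Fin N → ℝ) :
    field (Sum.elim (fun _ => β) fun _ => 0) (cavityPattern N) J =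
      field (fun _ => β) (bondPattern N) fun k => J (Sum.inl k) := by
  funext σ
  simp [field, cavityPattern]

lemma continuous_termsMean {ι Ω : Type*} [Fintype ι] [Fintype Ω] [Nonempty Ω] (b : ι → ℝ)
    (c : ι → Ω → ℝ) (q : Ω → Ω → ℝ) (L : List (ℤ × ℕ × List (ℕ × ℕ))) :
    Continuous fun J => termsMean q (field b c J) L := by
  induction L with
  | nil => simp only [termsMean_nil]; exact continuous_const
  | cons t L ih =>
    simp only [termsMean_cons, linesMean, ← field_repPattern]
    exact ((continuous_gmean_field b _ _).const_mul _).add ih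

lemma cavityTerms_zero (β : ℝ) (L : List (ℤ × ℕ × List (ℕ × ℕ))) :
    cavityTerms N β 0 L = quenchedTerms N β L := by
  simp only [cavityTerms, field_cavity_zero]
  exact integral_comp_inl (continuous_termsMean _ _ _ L)

lemma cavityLog_zero (hN : N ≠ 0) (β : ℝ) : cavityLog N β 0 = N * alphaN N β := by
  simp only [cavityLog, field_cavity_zero, alphaN_mul hN]
  exact integral_comp_inl (continuous_log_field _ (bondPattern N))

/-- The amplitudes of the cavity system. -/
def cavityAmplitude (N : ℕ) (β : ℝ) : Bond N ⊕ Fin N → ℝ → ℝ :=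
  Sum.elim (fun _ _ => β) (fun _ y => y)

/-- The derivatives of the amplitudes of the cavity system. -/
def cavityAmplitudeDeriv (N : ℕ) : Bond N ⊕ Fin N → ℝ → ℝ :=
  Sum.elim (fun _ _ => 0) (fun _ _ => 1)

lemma cavityAmplitude_apply (β y : ℝ) :
    (fun k => cavityAmplitude N β k y) = Sum.elim (fun _ => β) (fun _ => y) := by
  funext k
  rcases k with k | k <;> rfl

lemma hasDerivAt_cavityAmplitude (β : ℝ) (k : Bond N ⊕ Fin N) (y : ℝ) :
    HasDerivAt (cavityAmplitude N β k) (cavityAmplitudeDeriv N k y) y := by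
  rcases k with k | k
  · exact hasDerivAt_const y β
  · exact hasDerivAt_id y

lemma abs_cavityAmplitudeDeriv (k : Bond N ⊕ Fin N) (y : ℝ) : |cavityAmplitudeDeriv N k y| ≤ 1 := by
  rcases k with k | k <;> simp [cavityAmplitudeDeriv]

/-- Only the site amplitudes move, and their covariance is linear in the overlap. Hence r = 1 and
single lines are inserted, without a factor N. -/
lemma cavity_covariance (hN : N ≠ 0) (β y : ℝ) (σ τ : Config N) :
    y * overlap σ τ ^ 1 + 0 = ∑ k, (cavityAmplitude N β k y * cavityAmplitudeDeriv N k y) *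
      (cavityPattern N k σ * cavityPattern N k τ) := by
  simp [Fintype.sum_sum_type, cavityAmplitude, cavityAmplitudeDeriv, cavityPattern,
    ← Finset.mul_sum, sum_sitePattern_mul hN]

lemma hasDerivAt_cavityTerms (hN : N ≠ 0) (β y : ℝ) {L : List (ℤ × ℕ × List (ℕ × ℕ))}
    (hL : TermsBelow L) : HasDerivAt (fun y => cavityTerms N β y L)
      (2 * y * cavityTerms N β y (insertAll 1 L)) y := by
  have h := hasDerivAt_integral_termsMean (hasDerivAt_cavityAmplitude β) abs_cavityAmplitudeDeriv
    (cavityPattern N) overlap 1 y y 0 (cavity_covariance hN β y) overlap_comm (overlap_self hN) hL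
  simp only [cavityAmplitude_apply] at h
  exact h

/-- One line between two replicas. -/
def singleLine : List (ℤ × ℕ × List (ℕ × ℕ)) := [(1, 2, [(0, 1)])]

lemma hasDerivAt_cavityLog (hN : N ≠ 0) (β y : ℝ) :
    HasDerivAt (cavityLog N β) (y * (1 - cavityTerms N β y singleLine)) y := by
  have h := hasDerivAt_integral_log_lines (hasDerivAt_cavityAmplitude β) abs_cavityAmplitudeDeriv
    (cavityPattern N) overlap 1 y y 0 (cavity_covariance hN β y) (overlap_self hN)
  simp only [cavityAmplitude_apply] at h
  have e : cavityTerms N β y singleLine = ∫ J, linesMean overlap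
      (field (Sum.elim (fun _ => β) fun _ => y) (cavityPattern N) J) 2 (List.replicate 1 (0, 1))
      ∂(gaussianPi (Bond N ⊕ Fin N)) := by
    simp [cavityTerms, singleLine, termsMean]
  rw [e]
  exact h

lemma abs_cavityTerms_le {β y K : ℝ} {L : List (ℤ × ℕ × List (ℕ × ℕ))} {n : ℕ}
    (h : ∀ J, |termsMean overlap (field (Sum.elim (fun _ => β) fun _ => y) (cavityPattern N) J) L| ≤
      K * linesMean overlap (field (Sum.elim (fun _ => β) fun _ => y) (cavityPattern N) J) 2
        (List.replicate n (0, 1))) :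
    |cavityTerms N β y L| ≤ K * cavityTerms N β y [(1, 2, List.replicate n (0, 1))] := by
  refine abs_integral_le_integral_abs.trans ?_
  rw [cavityTerms, ← integral_const_mul]
  refine integral_mono (integrable_termsMean _ _ _ _).abs
    ((integrable_termsMean _ _ _ _).const_mul _) fun J => ?_
  simpa [termsMean] using h J

/-- Even powers of the overlap change at most by a factor in the additional random field. -/
lemma cavityTerms_replicate_le (hN : N ≠ 0) {n : ℕ} (hn : Even n) (β : ℝ) {y : ℝ} (hy : 0 ≤ y) :
    cavityTerms N β y [(1, 2, List.replicate n (0, 1))] ≤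
      Real.exp (coeffNorm (insertLines 1 2 (List.replicate n (0, 1))) * y ^ 2) *
        quenchedLines N β 2 (List.replicate n (0, 1)) := by
  have hb : TermsBelow [(1, 2, List.replicate n (0, 1))] := by
    intro t ht u hu
    rw [List.mem_singleton.1 ht] at hu ⊢
    rw [List.eq_of_mem_replicate hu]; simp
  have h := le_exp_mul_of_deriv_le (u := fun y => cavityTerms N β y [(1, 2, List.replicate n (0, 1))])
    (c := coeffNorm (insertLines 1 2 (List.replicate n (0, 1))))
    (fun y => hasDerivAt_cavityTerms hN β y hb) (fun y => ?_) hy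
  · refine h.trans (le_of_eq ?_)
    rw [cavityTerms_zero]
    simp [quenchedTerms, quenchedLines, termsMean]
  · refine (le_abs_self _).trans (abs_cavityTerms_le fun J => ?_)
    have : insertAll 1 [((1 : ℤ), 2, List.replicate n (0, 1))] =
        insertLines 1 2 (List.replicate n (0, 1)) := by
      simp [insertAll]
    rw [this]
    exact abs_termsMean_insertLines_le abs_overlap_le_one _ hn 1

/-- `k` further lines inserted into a single line. -/
def insertedLines (k : ℕ) : List (ℤ × ℕ × List (ℕ × ℕ)) := (insertAll 1)^[k] singleLine

lemma insertedLines_succ (k : ℕ) : insertedLines (k + 1) = insertAll 1 (insertedLines k) :=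
  Function.iterate_succ_apply' _ _ _

lemma termsBelow_insertedLines (k : ℕ) : TermsBelow (insertedLines k) := by
  induction k with
  | zero =>
    intro t ht u hu
    rw [List.mem_singleton.1 ht] at hu ⊢
    rw [List.mem_singleton.1 hu]; simp
  | succ k ih => rw [insertedLines_succ]; exact ih.insertAll

lemma length_insertedLines (k : ℕ) : ∀ t ∈ insertedLines k, t.2.2.length = k + 1 := by
  induction k with
  | zero =>
    intro t ht
    rw [List.mem_singleton.1 ht]; rfl
  | succ k ih =>
    rw [insertedLines_succ, add_comm (k + 1) 1]
    exact length_insertAll ih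

/-- The expansion of the free energy of a cavity field, with remainder controlled by an even
power of the overlap. -/
lemma abs_cavityLog_sub_le (B : ℝ) (n : ℕ) (hn : Even (n + 1)) : ∃ C, 0 ≤ C ∧ ∀ N : ℕ, N ≠ 0 →
    ∀ β y : ℝ, 0 ≤ y → y ≤ B →
    |cavityLog N β y - N * alphaN N β - y ^ 2 / 2 + 1 / 2 * ∑ k ∈ Finset.range n,
      quenchedTerms N β (insertedLines k) * y ^ (2 * (k + 1)) / (k + 1).factorial| ≤
      C * y ^ (2 * (n + 1)) * quenchedLines N β 2 (List.replicate (n + 1) (0, 1)) := by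
  set E := Real.exp (coeffNorm (insertLines 1 2 (List.replicate (n + 1) (0, 1))) * B ^ 2)
  set D := coeffNorm (insertedLines n) * (n + 1 : ℕ)
  have hD : 0 ≤ D := mul_nonneg (coeffNorm_nonneg _) (Nat.cast_nonneg _)
  refine ⟨1 / 2 * (D * E), by positivity, fun N hN β y h0 hB => ?_⟩
  set U := quenchedLines N β 2 (List.replicate (n + 1) (0, 1))
  have hU : 0 ≤ U := quenchedLines_nonneg_of_even N β hn
  -- The free energy enters as y² − 2·`cavityLog`, whose derivative is 2y⟨q₁₂⟩. The whole sequence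
  -- then obeys f_k' = 2y·f_{k+1}, one inserted line per step.
  let f : ℕ → ℝ → ℝ
    | 0, y => y ^ 2 - 2 * cavityLog N β y
    | k + 1, y => cavityTerms N β y (insertedLines k)
  have hf : ∀ k < n + 1, ∀ y, HasDerivAt (f k) (2 * y * f (k + 1) y) y := by
    intro k _ y
    rcases k with _ | k
    · exact ((hasDerivAt_pow 2 y).sub ((hasDerivAt_cavityLog hN β y).const_mul 2)).congr_deriv (by
        simp only [f, insertedLines, Function.iterate_zero, id]
        norm_num
        ring)
    · have := hasDerivAt_cavityTerms hN β y (termsBelow_insertedLines k)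
      rw [← insertedLines_succ] at this
      exact this
  -- Every term of the last derivative has n + 1 lines: D dominates it by the (n+1)-st moment of the
  -- overlap in the field, and the Gronwall factor E replaces the field by zero field.
  have hK : ∀ y, 0 ≤ y → y ≤ B → |f (n + 1) y| ≤ D * (E * U) := by
    intro y h0 hB
    refine (abs_cavityTerms_le (n := n + 1) (K := D) fun J => ?_).trans ?_
    · rw [mul_assoc]
      exact abs_termsMean_le_of_forall fun t ht => abs_linesMean_le _
        (termsBelow_insertedLines n t ht) (length_insertedLines n t ht) (by omega) hn
    · gcongr
      refine (cavityTerms_replicate_le hN hn β h0).trans ?_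
      gcongr
      exact Real.exp_le_exp.2 (mul_le_mul_of_nonneg_left (pow_le_pow_left₀ h0 hB 2)
        (coeffNorm_nonneg _))
  have h := abs_sub_taylor_le (n + 1) hf hK y h0 hB
  rw [Finset.sum_range_succ'] at h
  simp only [f, cavityTerms_zero, cavityLog_zero hN] at h
  have e : cavityLog N β y - N * alphaN N β - y ^ 2 / 2 + 1 / 2 * ∑ k ∈ Finset.range n,
      quenchedTerms N β (insertedLines k) * y ^ (2 * (k + 1)) / (k + 1).factorial =
      -(1 / 2) * (y ^ 2 - 2 * cavityLog N β y - (∑ k ∈ Finset.range n,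
      quenchedTerms N β (insertedLines k) * y ^ (2 * (k + 1)) / (k + 1).factorial +
      (0 ^ 2 - 2 * (N * alphaN N β)) * y ^ (2 * 0) / Nat.factorial 0)) := by
    simp
    ring
  rw [e, abs_mul]
  calc _ ≤ |-(1 / 2 : ℝ)| * (D * (E * U) * y ^ (2 * (n + 1))) := by gcongr
    _ = _ := by rw [abs_neg, abs_of_nonneg (by norm_num)]; ring

end Cavity
end SK
namespace SK

/-! ### The filled graphs and their coefficients -/

lemma quenchedTerms_cons (N : ℕ) (β : ℝ) (t) (L : List (ℤ × ℕ × List (ℕ × ℕ))) :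
    quenchedTerms N β (t :: L) = t.1 * quenchedLines N β t.2.1 t.2.2 + quenchedTerms N β L := by
  simp only [quenchedTerms, termsMean_cons]
  rw [integral_add ((integrable_linesMean _ _ _ _ _).const_mul _) (integrable_termsMean _ _ _ _),
    integral_const_mul]
  rfl

lemma quenchedTerms_nil (N : ℕ) (β : ℝ) : quenchedTerms N β [] = 0 := by
  simp [quenchedTerms, termsMean_nil]

lemma field_bondPattern_neg {N : ℕ} (β : ℝ) (J : Bond N → ℝ) (σ : Config N) :
    field (fun _ => β) (bondPattern N) J (-σ) = field (fun _ => β) (bondPattern N) J σ := by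
  simp [field, bondPattern, spin_neg]

lemma zipWith_eq_termsMean {Ω : Type*} [Fintype Ω] [Nonempty Ω] (q : Ω → Ω → ℝ) (W : Ω → ℝ)
    (cs : List ℤ) (gs : List (ℕ × List (ℕ × ℕ))) :
    (List.zipWith (fun (c : ℤ) g => (c : ℝ) * linesMean q W g.1 g.2) cs gs).sum =
      termsMean q W (cs.zip gs) := by
  rw [termsMean, List.zip, List.map_zipWith]

/-- Evaluation of a quenched combination by collecting the filled graphs. -/
lemma quenchedTerms_eq {gs : List (ℕ × List (ℕ × ℕ))} {L : List (ℤ × ℕ × List (ℕ × ℕ))}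
    {cs : List ℤ} (hL : TermsBelow L) (h : collectTerms gs (filledTerms L) = some cs) (N : ℕ)
    (β : ℝ) : quenchedTerms N β L = quenchedTerms N β (cs.zip gs) := by
  unfold quenchedTerms
  congr 1
  funext J
  rw [termsMean_filledTerms (flip := fun σ => -σ) neg_involutive overlap_neg_left
    overlap_neg_right (field_bondPattern_neg β J) hL,
    termsMean_eq_of_collectTerms overlap_comm _ gs
      (L := filledTerms L) (fun t ht => hL t (List.mem_of_mem_filter ht)) h, zipWith_eq_termsMean]

namespace OverlapGraph

/-- `q₁₂⁴` -/
def fourfoldLine : OverlapGraph := ⟨2, [(0, 1), (0, 1), (0, 1), (0, 1)]⟩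

/-- `q₁₂³ q₂₃ q₃₁` -/
def triangleDoubleLineEdge : OverlapGraph := ⟨3, [(0, 1), (0, 1), (0, 1), (1, 2), (2, 0)]⟩

/-- The number of replicas and the lines of a graph. -/
def toPair (G : OverlapGraph) : ℕ × List (ℕ × ℕ) := (G.replicas, G.natLines)

end OverlapGraph
open OverlapGraph

lemma quenchedTerms_toPair_cons (N : ℕ) (β : ℝ) (c : ℤ) (cs : List ℤ) (G : OverlapGraph)
    (gs : List (ℕ × List (ℕ × ℕ))) :
    quenchedTerms N β ((c :: cs).zip (G.toPair :: gs)) =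
      c * graphAvg N β G + quenchedTerms N β (cs.zip gs) := by
  rw [List.zip_cons_cons, quenchedTerms_cons, graphAvg_eq_quenchedLines]
  rfl

/-- A single line leaves both of its replicas odd, so no filled graph occurs. -/
lemma quenchedTerms_insertedLines_zero (N : ℕ) (β : ℝ) :
    quenchedTerms N β (insertedLines 0) = 0 := by
  rw [quenchedTerms_eq (gs := []) (cs := []) (termsBelow_insertedLines 0) (by decide +kernel)]
  simp [quenchedTerms_nil]

lemma quenchedTerms_insertedLines_one (N : ℕ) (β : ℝ) :
    quenchedTerms N β (insertedLines 1) = graphAvg N β doubleLine := by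
  rw [quenchedTerms_eq (gs := [doubleLine.toPair]) (cs := [1]) (termsBelow_insertedLines 1)
    (by decide +kernel)]
  simp only [quenchedTerms_toPair_cons, List.zip_nil_left, quenchedTerms_nil]
  push_cast
  ring

lemma quenchedTerms_insertedLines_two (N : ℕ) (β : ℝ) :
    quenchedTerms N β (insertedLines 2) = -4 * graphAvg N β triangle := by
  rw [quenchedTerms_eq (gs := [triangle.toPair]) (cs := [-4]) (termsBelow_insertedLines 2)
    (by decide +kernel)]
  simp only [quenchedTerms_toPair_cons, List.zip_nil_left, quenchedTerms_nil]
  push_cast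
  ring

lemma quenchedTerms_insertedLines_three (N : ℕ) (β : ℝ) :
    quenchedTerms N β (insertedLines 3) = graphAvg N β fourfoldLine
      - 12 * graphAvg N β twoDoubleLinesJoined + 9 * graphAvg N β twoDoubleLinesDisjoint
      + 36 * graphAvg N β square := by
  rw [quenchedTerms_eq (gs := [fourfoldLine.toPair, twoDoubleLinesJoined.toPair,
    twoDoubleLinesDisjoint.toPair, square.toPair]) (cs := [1, -12, 9, 36])
    (termsBelow_insertedLines 3) (by decide +kernel)]
  simp only [quenchedTerms_toPair_cons, List.zip_nil_left, quenchedTerms_nil]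
  push_cast
  ring

lemma quenchedTerms_insertedLines_four (N : ℕ) (β : ℝ) :
    quenchedTerms N β (insertedLines 4) = -40 * graphAvg N β triangleDoubleLineEdge
      + 360 * graphAvg N β triangleDoubleLineJoined - 240 * graphAvg N β triangleDoubleLineDisjoint
      - 576 * graphAvg N β pentagon := by
  rw [quenchedTerms_eq (gs := [triangleDoubleLineEdge.toPair, triangleDoubleLineJoined.toPair,
    triangleDoubleLineDisjoint.toPair, pentagon.toPair]) (cs := [-40, 360, -240, -576])
    (termsBelow_insertedLines 4) (by decide +kernel)]
  simp only [quenchedTerms_toPair_cons, List.zip_nil_left, quenchedTerms_nil]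
  push_cast
  ring

lemma linesBelow_doubleLine : LinesBelow doubleLine.replicas doubleLine.natLines := by decide

lemma linesBelow_triangle : LinesBelow triangle.replicas triangle.natLines := by decide

/-- Inserting double lines into `q₁₂²`. -/
lemma quenchedTerms_insertLines_doubleLine (N : ℕ) (β : ℝ) :
    quenchedTerms N β (insertLines 2 doubleLine.replicas doubleLine.natLines) =
      graphAvg N β fourfoldLine - 4 * graphAvg N β twoDoubleLinesJoined
        + 3 * graphAvg N β twoDoubleLinesDisjoint := by
  rw [quenchedTerms_eq (gs := [fourfoldLine.toPair, twoDoubleLinesJoined.toPair,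
    twoDoubleLinesDisjoint.toPair]) (cs := [1, -4, 3]) linesBelow_doubleLine.insertLines
    (by decide +kernel)]
  simp only [quenchedTerms_toPair_cons, List.zip_nil_left, quenchedTerms_nil]
  push_cast
  ring

/-- Inserting double lines into the triangle. -/
lemma quenchedTerms_insertLines_triangle (N : ℕ) (β : ℝ) :
    quenchedTerms N β (insertLines 2 triangle.replicas triangle.natLines) =
      3 * graphAvg N β triangleDoubleLineEdge - 9 * graphAvg N β triangleDoubleLineJoined
        + 6 * graphAvg N β triangleDoubleLineDisjoint := by
  rw [quenchedTerms_eq (gs := [triangleDoubleLineEdge.toPair, triangleDoubleLineJoined.toPair,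
    triangleDoubleLineDisjoint.toPair]) (cs := [3, -9, 6]) linesBelow_triangle.insertLines
    (by decide +kernel)]
  simp only [quenchedTerms_toPair_cons, List.zip_nil_left, quenchedTerms_nil]
  push_cast
  ring

end SK
namespace SK

/-! ### Thermal energy fluctuations -/

section Thermal
variable {Ω R : Type*} [Fintype Ω] [Nonempty Ω] [Fintype R] [DecidableEq R]

omit [Nonempty Ω] in
lemma gmean_pair_eq_iterate {Ω' : Type*} [Fintype Ω'] (W : Ω → ℝ) (W' : Ω' → ℝ)
    (g : Ω → Ω' → ℝ) : gmean (fun p : Ω × Ω' => W p.1 + W' p.2) (fun p => g p.1 p.2) =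
      gmean W fun σ => gmean W' (g σ) := by
  simp only [gmean, Real.exp_add, Fintype.sum_prod_type]
  rw [← Finset.sum_mul_sum, ← div_div, div_right_comm, Finset.sum_div]
  congr 1
  refine Finset.sum_congr rfl fun σ _ => ?_
  rw [mul_div_assoc', Finset.mul_sum]
  congr 1
  exact Finset.sum_congr rfl fun τ _ => by ring

/-- The Gibbs mean of the energy. -/
noncomputable def energyMean (X : Ω → ℝ) (x : ℝ) : ℝ := gmean (fun σ => x * X σ) X

/-- The Gibbs variance of the energy. -/
noncomputable def energyVar (X : Ω → ℝ) (x : ℝ) : ℝ :=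
  gmean (fun σ => x * X σ) (fun σ => X σ * X σ) - energyMean X x * energyMean X x

/-- The mean distance of the energies of two replicas. -/
noncomputable def energyDist (X : Ω → ℝ) (x : ℝ) : ℝ :=
  gmean (fun p : Ω × Ω => x * X p.1 + x * X p.2) fun p => |X p.1 - X p.2|

lemma hasDerivAt_energyMean (X : Ω → ℝ) (x : ℝ) :
    HasDerivAt (energyMean X) (energyVar X x) x :=
  hasDerivAt_gmean (W := fun x σ => x * X σ) X
    fun σ => ((hasDerivAt_id x).mul_const (X σ)).congr_deriv (one_mul _)

lemma gmean_sq_diff (X : Ω → ℝ) (x : ℝ) :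
    gmean (fun p : Ω × Ω => x * X p.1 + x * X p.2) (fun p => (X p.1 - X p.2) ^ 2) =
      2 * energyVar X x := by
  set W : Ω → ℝ := fun σ => x * X σ
  have h1 := gmean_prod W W (fun σ => X σ * X σ) (fun _ => 1)
  have h2 := gmean_prod W W (fun _ => 1) (fun σ => X σ * X σ)
  have h3 := gmean_prod W W X X
  rw [gmean_const] at h1 h2
  simp only [mul_one, one_mul] at h1 h2
  have e : (fun p : Ω × Ω => (X p.1 - X p.2) ^ 2) = fun p =>
      X p.1 * X p.1 + X p.2 * X p.2 - 2 * (X p.1 * X p.2) := by funext p; ring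
  show gmean (fun p : Ω × Ω => W p.1 + W p.2) _ = _
  rw [e, gmean_sub, gmean_add, gmean_const_mul, h1, h2, h3, energyVar, energyMean]
  ring

lemma energyVar_nonneg (X : Ω → ℝ) (x : ℝ) : 0 ≤ energyVar X x := by
  have := gmean_sq_diff X x
  have h := gmean_nonneg (fun p : Ω × Ω => x * X p.1 + x * X p.2)
    (F := fun p => (X p.1 - X p.2) ^ 2) fun p => sq_nonneg _
  linarith

lemma monotone_energyMean (X : Ω → ℝ) : Monotone (energyMean X) :=
  monotone_of_deriv_nonneg (fun x => (hasDerivAt_energyMean X x).differentiableAt)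
    fun x => by rw [(hasDerivAt_energyMean X x).deriv]; exact energyVar_nonneg X x

/-- The derivative of the mean energy distance is controlled by the variance. -/
lemma hasDerivAt_energyDist (X : Ω → ℝ) (x : ℝ) :
    ∃ d, HasDerivAt (energyDist X) d x ∧ -(2 * energyVar X x) ≤ d := by
  let P : Ω × Ω → ℝ := fun p => x * X p.1 + x * X p.2
  let S : Ω × Ω → ℝ := fun p => X p.1 + X p.2
  let m := gmean P S
  have hd := hasDerivAt_gmean (W := fun x (p : Ω × Ω) => x * X p.1 + x * X p.2) (x := x)
    (W' := S) (fun p => |X p.1 - X p.2|) fun p =>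
      (((hasDerivAt_id x).mul_const (X p.1)).add
        ((hasDerivAt_id x).mul_const (X p.2))).congr_deriv (by simp [S])
  refine ⟨_, hd, ?_⟩
  set W : Ω → ℝ := fun σ => x * X σ
  have h1 := gmean_prod W W X (fun _ => 1)
  have h2 := gmean_prod W W (fun _ => 1) X
  rw [gmean_const] at h1 h2
  simp only [mul_one, one_mul] at h1 h2
  have hm : m = 2 * energyMean X x := by
    show gmean (fun p : Ω × Ω => W p.1 + W p.2) (fun p => X p.1 + X p.2) = _
    rw [gmean_add, h1, h2, energyMean]; ring
  have h3 := gmean_prod W W (fun σ => X σ * X σ) (fun _ => 1)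
  have h4 := gmean_prod W W (fun _ => 1) (fun σ => X σ * X σ)
  have h5 := gmean_prod W W X X
  rw [gmean_const] at h3 h4
  simp only [mul_one, one_mul] at h3 h4
  have hS : gmean P (fun p => (S p - m) ^ 2) = 2 * energyVar X x := by
    have e : (fun p : Ω × Ω => (S p - m) ^ 2) = fun p =>
        X p.1 * X p.1 + X p.2 * X p.2 + 2 * (X p.1 * X p.2)
          - (2 * m) * (X p.1 + X p.2) + m ^ 2 := by funext p; simp only [S]; ring
    show gmean (fun p : Ω × Ω => W p.1 + W p.2) _ = _
    rw [e, gmean_add, gmean_sub, gmean_add, gmean_add, gmean_const_mul, gmean_const_mul, gmean_add,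
      gmean_const, h1, h2, h3, h4, h5, hm, energyVar, energyMean]
    ring
  have key : gmean P (fun p => |X p.1 - X p.2| * S p) - gmean P (fun p => |X p.1 - X p.2|) * m =
      gmean P (fun p => |X p.1 - X p.2| * (S p - m)) := by
    rw [← gmean_mul_const, ← gmean_sub]
    congr 1; funext p; ring
  show _ ≤ gmean P (fun p => |X p.1 - X p.2| * S p) - gmean P (fun p => |X p.1 - X p.2|) * m
  rw [key]
  -- From uv ≥ −(u² + v²)/2; the sum and the difference of two independent energies each have second
  -- central moment 2·`energyVar`.
  have hlow : gmean P (fun p => (-(1 / 2)) * ((X p.1 - X p.2) ^ 2 + (S p - m) ^ 2)) ≤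
      gmean P (fun p => |X p.1 - X p.2| * (S p - m)) := gmean_mono _ fun p => by
    nlinarith [sq_nonneg (|X p.1 - X p.2| + (S p - m)), sq_abs (X p.1 - X p.2)]
  refine le_trans (le_of_eq ?_) hlow
  rw [gmean_const_mul, gmean_add, hS]
  show _ = -(1 / 2) * (gmean (fun p : Ω × Ω => x * X p.1 + x * X p.2)
    (fun p => (X p.1 - X p.2) ^ 2) + _)
  rw [gmean_sq_diff]
  ring

/-- The mean energy distance is controlled by the increments of the mean energy. -/
lemma energyDist_le (X : Ω → ℝ) (x : ℝ) {δ : ℝ} (hδ : 0 < δ) :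
    energyDist X x ≤ 4 * (energyMean X (x + δ) - energyMean X x) + 1 / (4 * δ) := by
  -- Since the variance is the derivative of the mean energy, the lower bound on the derivative of
  -- `energyDist` makes this sum nondecreasing, and a bound at one later point controls x.
  have hmono : Monotone fun y => energyDist X y + 2 * energyMean X y := by
    have hd : ∀ y, ∃ d, HasDerivAt (fun y => energyDist X y + 2 * energyMean X y) d y ∧ 0 ≤ d := by
      intro y
      obtain ⟨d, h, hd⟩ := hasDerivAt_energyDist X y
      exact ⟨_, h.add ((hasDerivAt_energyMean X y).const_mul 2), by linarith⟩
    refine monotone_of_deriv_nonneg (fun y => ?_) fun y => ?_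
    · obtain ⟨d, h, -⟩ := hd y; exact h.differentiableAt
    · obtain ⟨d, h, h0⟩ := hd y; rw [h.deriv]; exact h0
  -- A point where δ times the variance equals the increment of the mean energy. There |u| ≤ δu² +
  -- 1/(4δ) gives twice the increment plus 1/(4δ); going back to x costs at most two more
  -- increments.
  obtain ⟨y, hy, hslope⟩ := exists_hasDerivAt_eq_slope (energyMean X) (energyVar X)
    (show x < x + δ by linarith)
    (fun z _ => (hasDerivAt_energyMean X z).continuousAt.continuousWithinAt)
    (fun z _ => hasDerivAt_energyMean X z)
  have h1 : energyDist X y ≤ 2 * δ * energyVar X y + 1 / (4 * δ) := by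
    have : energyDist X y ≤ gmean (fun p : Ω × Ω => y * X p.1 + y * X p.2)
        (fun p => δ * (X p.1 - X p.2) ^ 2 + 1 / (4 * δ)) := gmean_mono _ fun p => by
      have hp : 0 < 4 * δ := by positivity
      have h2 : δ * (X p.1 - X p.2) ^ 2 + 1 / (4 * δ) - |X p.1 - X p.2| =
          (2 * δ * |X p.1 - X p.2| - 1) ^ 2 / (4 * δ) := by
        rw [← sq_abs (X p.1 - X p.2)]
        field_simp
        ring
      have : 0 ≤ (2 * δ * |X p.1 - X p.2| - 1) ^ 2 / (4 * δ) := by positivity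
      linarith
    refine this.trans (le_of_eq ?_)
    rw [gmean_add, gmean_const_mul, gmean_sq_diff, gmean_const]
    ring
  have h2 : δ * energyVar X y = energyMean X (x + δ) - energyMean X x := by
    rw [hslope]
    have : x + δ - x = δ := by ring
    rw [this]
    field_simp
  have h3 := hmono hy.1.le
  have h4 := monotone_energyMean X hy.2.le
  dsimp only at h3
  linarith

/-- The correlation of a bounded replica observable with the energy. -/
lemma abs_gmean_cov_energy_le (X : Ω → ℝ) (x : ℝ) {F : (R → Ω) → ℝ} (hF : ∀ τ, |F τ| ≤ 1) :
    |gmean (repEnergy R fun σ => x * X σ) (fun τ => F τ * repEnergy R X τ) -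
      gmean (repEnergy R fun σ => x * X σ) F *
        gmean (repEnergy R fun σ => x * X σ) (repEnergy R X)| ≤
      Fintype.card R * energyDist X x := by
  set W : Ω → ℝ := fun σ => x * X σ
  have e1 : gmean (repEnergy R W) (repEnergy R X) = ∑ _a : R, gmean W X := by
    show gmean (repEnergy R W) (fun τ => ∑ a, X (τ a)) = _
    rw [gmean_sum]
    exact Finset.sum_congr rfl fun a _ => gmean_repEnergy_apply W X a
  have e2 : gmean (repEnergy R W) (fun τ => F τ * repEnergy R X τ) =
      ∑ a, gmean (repEnergy R W) (fun τ => F τ * X (τ a)) := by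
    rw [← gmean_sum]
    simp only [repEnergy, Finset.mul_sum]
  rw [e1, e2, Finset.mul_sum, ← Finset.sum_sub_distrib]
  refine (Finset.abs_sum_le_sum_abs _ _).trans ?_
  have : ∀ a ∈ (Finset.univ : Finset R), |gmean (repEnergy R W) (fun τ => F τ * X (τ a)) -
      gmean (repEnergy R W) F * gmean W X| ≤ energyDist X x := by
    intro a _
    rw [← gmean_mul_const, ← gmean_sub]
    refine (abs_gmean_le_gmean _ _).trans ?_
    have h1 : gmean (repEnergy R W) (fun τ => |F τ * X (τ a) - F τ * gmean W X|) ≤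
        gmean (repEnergy R W) (fun τ => |X (τ a) - gmean W X|) := gmean_mono _ fun τ => by
      rw [← mul_sub, abs_mul]
      exact mul_le_of_le_one_left (abs_nonneg _) (hF τ)
    refine h1.trans ?_
    rw [gmean_repEnergy_apply W (fun σ => |X σ - gmean W X|) a]
    have h2 := gmean_pair_eq_iterate W W fun σ τ => |X σ - X τ|
    rw [energyDist, h2]
    refine gmean_mono _ fun σ => ?_
    -- The thermal mean is an average over a second replica, so the deviation from it is at most the
    -- mean distance of two replicas.
    have h3 : X σ - gmean W X = gmean W (fun τ => X σ - X τ) := by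
      rw [gmean_sub, gmean_const]
    rw [h3]
    exact abs_gmean_le_gmean _ _
  refine (Finset.sum_le_sum this).trans (le_of_eq ?_)
  simp

end Thermal

/-! ### Quenched energy fluctuations bound temperature derivatives -/

section Quenched
variable {N : ℕ}

/-- The quenched mean distance of the energies of two replicas. -/
noncomputable def energyFluct (N : ℕ) (x : ℝ) : ℝ :=
  ∫ J, energyDist (field (fun _ => 1) (bondPattern N) J) x ∂(gaussianPi (Bond N))

/-- The derivative of `alphaN`. -/
noncomputable def alphaDeriv (N : ℕ) (x : ℝ) : ℝ := x / 2 * (1 - overlapSq N x)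

lemma field_bond_eq_mul (x : ℝ) (J : Bond N → ℝ) :
    field (fun _ => x) (bondPattern N) J =
      fun σ => x * field (fun _ => 1) (bondPattern N) J σ := by
  funext σ
  simp only [field, Finset.mul_sum]
  exact Finset.sum_congr rfl fun k _ => by ring

/-- The same derivative of Nα_N is computed once before and once after integration by parts. -/
lemma integral_energyMean (hN : N ≠ 0) (x : ℝ) :
    ∫ J, energyMean (field (fun _ => 1) (bondPattern N) J) x ∂(gaussianPi (Bond N)) =
      N * alphaDeriv N x := by
  have h1 := hasDerivAt_integral_log (ι := Bond N) (a := fun _ y => y) (a' := fun _ _ => 1)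
    (fun _ y => hasDerivAt_id y) (by simp) (bondPattern N) x
  have h2 := (hasDerivAt_alphaN hN x).const_mul (N : ℝ)
  simp only [← alphaN_mul hN] at h1
  have h3 := h1.unique h2
  rw [alphaDeriv, ← h3]
  simp only [energyMean, ← field_bond_eq_mul]

lemma integrable_energyMean (x : ℝ) :
    Integrable (fun J => energyMean (field (fun _ => 1) (bondPattern N) J) x)
      (gaussianPi (Bond N)) := by
  obtain ⟨M, hM0, hM⟩ := exists_abs_le (bondPattern N)
  have hc : Continuous fun J => energyMean (field (fun _ => 1) (bondPattern N) J) x :=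
    continuous_gmean (fun σ => (continuous_field _ _ σ).const_mul x) (continuous_field _ _)
  refine Integrable.mono' (integrable_sum_abs.const_mul (1 * M)) hc.aestronglyMeasurable
    (ae_of_all _ fun J => ?_)
  exact abs_gmean_le _ (abs_field_le (by simp) hM J)

lemma integrable_energyDist (x : ℝ) :
    Integrable (fun J => energyDist (field (fun _ => 1) (bondPattern N) J) x)
      (gaussianPi (Bond N)) := by
  obtain ⟨M, hM0, hM⟩ := exists_abs_le (bondPattern N)
  have hc : Continuous fun J => energyDist (field (fun _ => 1) (bondPattern N) J) x :=
    continuous_gmean (fun p => ((continuous_field _ _ _).const_mul x).add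
      ((continuous_field _ _ _).const_mul x))
      (fun p => ((continuous_field _ _ _).sub (continuous_field _ _ _)).abs)
  refine Integrable.mono' (integrable_sum_abs.const_mul (2 * (1 * M))) hc.aestronglyMeasurable
    (ae_of_all _ fun J => ?_)
  refine abs_gmean_le _ fun p => ?_
  rw [abs_abs]
  refine (abs_sub _ _).trans ?_
  have h := abs_field_le (a := fun _ : Bond N => (1 : ℝ)) (A := 1) (by simp) hM J
  linarith [h p.1, h p.2]

/-- Convexity of log Z in the inverse temperature survives averaging over the couplings. -/
lemma monotone_alphaDeriv (hN : N ≠ 0) : Monotone (alphaDeriv N) := by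
  intro x y hxy
  have hN' : (0 : ℝ) < N := by exact_mod_cast Nat.pos_of_ne_zero hN
  refine le_of_mul_le_mul_left ?_ hN'
  rw [← integral_energyMean hN, ← integral_energyMean hN]
  exact integral_mono (integrable_energyMean x) (integrable_energyMean y)
    fun J => monotone_energyMean _ hxy

lemma energyFluct_le (hN : N ≠ 0) (x : ℝ) {δ : ℝ} (hδ : 0 < δ) :
    energyFluct N x ≤ 4 * N * (alphaDeriv N (x + δ) - alphaDeriv N x) + 1 / (4 * δ) := by
  have h : energyFluct N x ≤ ∫ J, (4 * (energyMean (field (fun _ => 1) (bondPattern N) J) (x + δ) -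
      energyMean (field (fun _ => 1) (bondPattern N) J) x) + 1 / (4 * δ))
      ∂(gaussianPi (Bond N)) :=
    integral_mono (integrable_energyDist x)
      ((((integrable_energyMean _).sub (integrable_energyMean _)).const_mul 4).add
        (integrable_const _)) fun J => energyDist_le _ x hδ
  have hi : Integrable (fun J => 4 * (energyMean (field (fun _ => 1) (bondPattern N) J) (x + δ) -
      energyMean (field (fun _ => 1) (bondPattern N) J) x)) (gaussianPi (Bond N)) :=
    ((integrable_energyMean _).sub (integrable_energyMean _)).const_mul 4
  refine h.trans (le_of_eq ?_)
  rw [integral_add hi (integrable_const _), integral_const_mul, integral_sub (integrable_energyMean _)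
    (integrable_energyMean _), integral_energyMean hN, integral_energyMean hN]
  simp
  ring

/-- The derivative of a quenched mean with respect to the inverse temperature: the identity
from integration by parts, and the bound by energy fluctuations. -/
lemma hasDerivAt_quenchedLines (hN : N ≠ 0) (x : ℝ) {s : ℕ} {m : List (ℕ × ℕ)}
    (hm : LinesBelow s m) :
    HasDerivAt (fun y => quenchedLines N y s m)
      (x * N * quenchedTerms N x (insertLines 2 s m)) x ∧
    |x * N * quenchedTerms N x (insertLines 2 s m)| ≤ s * energyFluct N x := by
  have h1 := hasDerivAt_integral_linesMean (ι := Bond N) (a := fun _ y => y) (a' := fun _ _ => 1)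
    (fun _ y => hasDerivAt_id y) (by simp) (bondPattern N) overlap 2 x (x * N / 2) (-x / 2)
    (bond_covariance hN x) overlap_comm (overlap_self hN) hm
  have h2 := hasDerivAt_integral_gmean (ι := Bond N) (a := fun _ y => y) (a' := fun _ _ => 1)
    (fun _ y => hasDerivAt_id y) (by simp) (repPattern (Fin s) (bondPattern N))
    (fun τ => lineProd overlap m (extendReplicas τ)) x
  have h3 : HasDerivAt (fun y => quenchedLines N y s m)
      (x * N * quenchedTerms N x (insertLines 2 s m)) x :=
    h1.congr_deriv (by rw [quenchedTerms]; ring)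
  refine ⟨h3, ?_⟩
  simp only [field_repPattern] at h2
  -- The derivative is also the quenched covariance with the energy; in this form it has no
  -- prefactor N and is bounded by fluctuations.
  rw [h3.unique h2]
  refine abs_integral_le_integral_abs.trans ?_
  rw [energyFluct, ← integral_const_mul]
  refine integral_mono_of_nonneg (ae_of_all _ fun J => abs_nonneg _)
    ((integrable_energyDist x).const_mul _) (ae_of_all _ fun J => ?_)
  have := abs_gmean_cov_energy_le (R := Fin s) (field (fun _ => 1) (bondPattern N) J) x
    (F := fun τ => lineProd overlap m (extendReplicas τ))
    fun τ => abs_lineProd_le_one abs_overlap_le_one _ _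
  simp only [← field_bond_eq_mul, Fintype.card_fin] at this
  exact this

end Quenched
end SK
namespace SK

/-! ### Convexity and the countable exceptional set -/

section Derivatives

lemma slope_bounds_of_monotone_deriv {f f' : ℝ → ℝ} (hf : ∀ x, HasDerivAt f (f' x) x)
    (hm : Monotone f') {a b : ℝ} (hab : a < b) :
    f' a * (b - a) ≤ f b - f a ∧ f b - f a ≤ f' b * (b - a) := by
  obtain ⟨c, hc, h⟩ := exists_hasDerivAt_eq_slope f f' hab
    (fun x _ => (hf x).continuousAt.continuousWithinAt) fun x _ => hf x
  have hba : 0 < b - a := sub_pos.2 hab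
  rw [eq_div_iff hba.ne'] at h
  rw [← h]
  exact ⟨mul_le_mul_of_nonneg_right (hm hc.1.le) hba.le,
    mul_le_mul_of_nonneg_right (hm hc.2.le) hba.le⟩

/-- If convex functions converge pointwise, then outside a countable set their derivatives
oscillate little near each point. -/
lemma exists_countable_deriv_gap {f f' : ℕ → ℝ → ℝ} {F : ℝ → ℝ}
    (hf : ∀ N ≠ 0, ∀ x, HasDerivAt (f N) (f' N x) x) (hm : ∀ N ≠ 0, Monotone (f' N))
    (hb : ∀ x, ∃ K, ∀ N, |f' N x| ≤ K)
    (hF : ∀ x, 0 ≤ x → Tendsto (fun N => f N x) atTop (𝓝 (F x))) :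
    ∃ S : Set ℝ, S.Countable ∧ ∀ β, 0 < β → β ∉ S → ∀ ε, 0 < ε → ∃ δ, 0 < δ ∧ 3 * δ ≤ β ∧
      ∀ᶠ N in atTop, f' N (β + δ) - f' N (β - 2 * δ) ≤ ε := by
  -- A limsup of monotone functions is monotone, hence continuous off a countable set; no
  -- differentiability of the limit `F` is used.
  set m : ℝ → ℝ := fun x => limsup (fun N => f' N x) atTop
  have hbu : ∀ x, IsBoundedUnder (· ≤ ·) atTop fun N => f' N x := fun x => by
    obtain ⟨K, hK⟩ := hb x
    exact isBoundedUnder_of ⟨K, fun N => (abs_le.1 (hK N)).2⟩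
  have hbl : ∀ x, IsCoboundedUnder (· ≤ ·) atTop fun N => f' N x := fun x => by
    obtain ⟨K, hK⟩ := hb x
    exact (isBoundedUnder_of ⟨-K, fun N => (abs_le.1 (hK N)).1⟩).isCoboundedUnder_le
  have hmm : Monotone m := fun x y hxy => limsup_le_limsup
    ((eventually_ne_atTop 0).mono fun N hN => hm N hN hxy) (hbl x) (hbu y)
  refine ⟨{x | ¬ContinuousAt m x}, hmm.countable_not_continuousAt, fun β hβ hS ε hε => ?_⟩
  have hc : ContinuousAt m β := not_not.1 hS
  obtain ⟨η, hη, hηm⟩ := Metric.continuousAt_iff.1 hc (ε / 8) (by positivity)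
  set δ := min η β / 4 with hδ
  have hmin : 0 < min η β := lt_min hη hβ
  have hδ0 : 0 < δ := by positivity
  have hδη : 4 * δ ≤ η := by rw [hδ]; linarith [min_le_left η β]
  have hδβ : 4 * δ ≤ β := by rw [hδ]; linarith [min_le_right η β]
  refine ⟨δ, hδ0, by linarith, ?_⟩
  have h1 : |m (β + δ) - m β| < ε / 8 := hηm (by
    rw [Real.dist_eq, add_sub_cancel_left, abs_of_pos hδ0]; linarith)
  have h2 : |m (β - 3 * δ) - m β| < ε / 8 := hηm (by
    rw [Real.dist_eq, sub_sub_cancel_left, abs_neg, abs_of_pos (by positivity)]; linarith)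
  rw [abs_lt] at h1 h2
  have hup : ∀ᶠ N in atTop, f' N (β + δ) < m (β + δ) + ε / 8 :=
    eventually_lt_of_limsup_lt (by linarith : m (β + δ) < m (β + δ) + ε / 8) (hbu _)
  have hfr : ∃ᶠ N in atTop, m (β - 3 * δ) - ε / 8 < f' N (β - 3 * δ) :=
    frequently_lt_of_lt_limsup (hbl _) (by linarith : m (β - 3 * δ) - ε / 8 < m (β - 3 * δ))
  have hs : Tendsto (fun N => f N (β - 2 * δ) - f N (β - 3 * δ)) atTop
      (𝓝 (F (β - 2 * δ) - F (β - 3 * δ))) :=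
    (hF _ (by linarith)).sub (hF _ (by linarith))
  have hlow : (m (β - 3 * δ) - ε / 8) * δ ≤ F (β - 2 * δ) - F (β - 3 * δ) := by
    refine ge_of_tendsto_of_frequently hs ?_
    refine (hfr.and_eventually (eventually_ne_atTop 0)).mono fun N ⟨hN, hN0⟩ => ?_
    have := (slope_bounds_of_monotone_deriv (hf N hN0) (hm N hN0)
      (by linarith : β - 3 * δ < β - 2 * δ)).1
    rw [show β - 2 * δ - (β - 3 * δ) = δ by ring] at this
    exact (mul_le_mul_of_nonneg_right hN.le hδ0.le).trans this
  -- At β − 3δ the derivative is known to be large only for infinitely many N. Convergence of the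
  -- values `f N` turns this into a bound on slopes for all large N, and convexity carries the slope
  -- bound to the derivative at β − 2δ.
  have hlow' : ∀ᶠ N in atTop, (m (β - 3 * δ) - ε / 4) * δ < f N (β - 2 * δ) - f N (β - 3 * δ) :=
    hs.eventually_const_lt (lt_of_lt_of_le (by nlinarith) hlow)
  filter_upwards [hup, hlow', eventually_ne_atTop 0] with N h3 h4 hN0
  have h5 := (slope_bounds_of_monotone_deriv (hf N hN0) (hm N hN0)
      (by linarith : β - 3 * δ < β - 2 * δ)).2
  rw [show β - 2 * δ - (β - 3 * δ) = δ by ring] at h5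
  have h6 : m (β - 3 * δ) - ε / 4 < f' N (β - 2 * δ) :=
    lt_of_mul_lt_mul_right (h4.trans_le h5) hδ0.le
  linarith [h1.2, h2.1]

end Derivatives

lemma abs_alphaDeriv_le (N : ℕ) (x : ℝ) : |alphaDeriv N x| ≤ |x| / 2 := by
  rw [alphaDeriv, abs_mul, abs_div, abs_two]
  refine mul_le_of_le_one_right (by positivity) (abs_le.2 ⟨?_, ?_⟩) <;>
  linarith [overlapSq_nonneg N x, overlapSq_le_one N x]

/-- A point near which the energy fluctuations are negligible. -/
def FluctNegligible (β : ℝ) : Prop := ∀ ε, 0 < ε → ∃ δ, 0 < δ ∧ δ ≤ β ∧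
  ∀ᶠ N : ℕ in atTop, ∀ x, β - δ ≤ x → x ≤ β → energyFluct N x ≤ ε * N

/-- `energyFluct_le` with a fixed step δ bounds fluctuations per spin by the oscillation of α_N'
near β plus 1/(4δN). The oscillation is eventually small for generic β. -/
lemma exists_countable_fluctNegligible :
    ∃ S : Set ℝ, S.Countable ∧ ∀ β, 0 < β → β ∉ S → FluctNegligible β := by
  obtain ⟨S, hS, h⟩ := exists_countable_deriv_gap (f := alphaN) (f' := alphaDeriv) (F := alpha)
    (fun N hN x => hasDerivAt_alphaN hN x) (fun N hN => monotone_alphaDeriv hN)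
    (fun x => ⟨_, fun N => abs_alphaDeriv_le N x⟩) (fun x hx => tendsto_alphaN hx)
  refine ⟨S, hS, fun β hβ hβS ε hε => ?_⟩
  obtain ⟨δ, hδ, hδβ, hev⟩ := h β hβ hβS (ε / 8) (by positivity)
  refine ⟨δ, hδ, by linarith, ?_⟩
  have hlim : Tendsto (fun N : ℕ => ε / 2 * (N : ℝ)) atTop atTop :=
    tendsto_natCast_atTop_atTop.const_mul_atTop (by positivity)
  filter_upwards [hev, eventually_ne_atTop 0, hlim.eventually_ge_atTop (1 / (4 * δ))]
    with N h1 hN h2 x hx1 hx2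
  have hN' : (0 : ℝ) < N := by exact_mod_cast Nat.pos_of_ne_zero hN
  have h3 : alphaDeriv N (x + δ) ≤ alphaDeriv N (β + δ) := monotone_alphaDeriv hN (by linarith)
  have h4 : alphaDeriv N (β - 2 * δ) ≤ alphaDeriv N x := monotone_alphaDeriv hN (by linarith)
  have h5 : N * (alphaDeriv N (x + δ) - alphaDeriv N x) ≤ N * (ε / 8) :=
    mul_le_mul_of_nonneg_left (by linarith) hN'.le
  linarith [energyFluct_le hN x hδ]

/-- The insertion of double lines, multiplied by βN, is a temperature derivative of size o(N).
Dividing by βN gives identities of Ghirlanda–Guerra and Aizenman–Contucci type. -/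
lemma tendsto_quenchedTerms_insertLines {β : ℝ} (hβ : 0 < β) (h : FluctNegligible β) {s : ℕ}
    {m : List (ℕ × ℕ)} (hm : LinesBelow s m) :
    Tendsto (fun N => quenchedTerms N β (insertLines 2 s m)) atTop (𝓝 0) := by
  rw [Metric.tendsto_atTop']
  intro ε hε
  obtain ⟨δ, hδ, hδβ, hev⟩ := h (β * ε / (2 * (s + 1))) (by positivity)
  obtain ⟨N₀, hN₀⟩ := eventually_atTop.1 (hev.and (eventually_ne_atTop 0))
  refine ⟨N₀, fun N hN => ?_⟩
  obtain ⟨h1, hN0⟩ := hN₀ N hN.le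
  have hN' : (0 : ℝ) < N := by exact_mod_cast Nat.pos_of_ne_zero hN0
  have h2 := (hasDerivAt_quenchedLines hN0 β hm).2
  have h3 := h1 β (by linarith) le_rfl
  rw [abs_mul, abs_of_pos (by positivity : 0 < β * N)] at h2
  rw [Real.dist_eq, sub_zero]
  have h4 : (s : ℝ) * energyFluct N β ≤ s * (β * ε / (2 * (s + 1)) * N) :=
    mul_le_mul_of_nonneg_left h3 (Nat.cast_nonneg s)
  have h5 : (s : ℝ) * (β * ε / (2 * (s + 1)) * N) = (s / (s + 1)) * (ε / 2) * (β * N) := by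
    field_simp
  have h6 : (s : ℝ) / (s + 1) ≤ 1 := (div_le_one (by positivity)).2 (by linarith)
  have h7 := h2.trans (h4.trans_eq h5)
  rw [mul_comm] at h7
  have h8 := le_of_mul_le_mul_right h7 (by positivity : 0 < β * N)
  nlinarith

/-! ### The temperature shift between the full and the cavity system -/

section Cavity

lemma one_sub_sqrt_bounds {N : ℕ} (hN : N ≠ 0) :
    0 ≤ 1 - Real.sqrt (N / (N + 1)) ∧ N * (1 - Real.sqrt (N / (N + 1))) ≤ 1 := by
  have hN' : (0 : ℝ) < N := by exact_mod_cast Nat.pos_of_ne_zero hN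
  have hr0 : 0 ≤ Real.sqrt ((N : ℝ) / (N + 1)) := Real.sqrt_nonneg _
  have hr : Real.sqrt ((N : ℝ) / (N + 1)) ^ 2 = N / (N + 1) := Real.sq_sqrt (by positivity)
  have h1 : (N : ℝ) / (N + 1) ≤ 1 := (div_le_one (by positivity)).2 (by linarith)
  have hr1 : Real.sqrt ((N : ℝ) / (N + 1)) ≤ 1 := Real.sqrt_le_one.2 h1
  refine ⟨by linarith, ?_⟩
  have h2 : (N : ℝ) / (N + 1) ≤ Real.sqrt ((N : ℝ) / (N + 1)) := by nlinarith
  have h3 : (N : ℝ) * (1 - N / (N + 1)) ≤ 1 := by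
    rw [one_sub_div (by positivity), mul_div_assoc', div_le_one (by positivity)]; linarith
  nlinarith

lemma tendsto_sqrt_ratio :
    Tendsto (fun N : ℕ => Real.sqrt ((N : ℝ) / (N + 1))) atTop (𝓝 1) := by
  have := (tendsto_natCast_div_add_atTop (1 : ℝ)).sqrt
  rwa [Real.sqrt_one] at this

lemma tendsto_cavityBeta (β : ℝ) : Tendsto (fun N => cavityBeta N β) atTop (𝓝 β) := by
  simpa [cavityBeta] using tendsto_sqrt_ratio.const_mul β

lemma cavityBeta_nonneg (N : ℕ) {β : ℝ} (hβ : 0 ≤ β) : 0 ≤ cavityBeta N β :=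
  mul_nonneg hβ (Real.sqrt_nonneg _)

lemma cavityBeta_le {N : ℕ} (hN : N ≠ 0) {β : ℝ} (hβ : 0 ≤ β) : cavityBeta N β ≤ β := by
  have := (one_sub_sqrt_bounds hN).1
  exact mul_le_of_le_one_right hβ (by linarith)

lemma cavityBeta_lt {N : ℕ} {β : ℝ} (hβ : 0 < β) : cavityBeta N β < β := by
  refine mul_lt_of_lt_one_right hβ ((Real.sqrt_lt' one_pos).2 ?_)
  rw [one_pow, div_lt_one (by positivity)]; linarith

lemma natCast_mul_sub_cavityBeta_le {N : ℕ} (hN : N ≠ 0) {β : ℝ} (hβ : 0 ≤ β) :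
    N * (β - cavityBeta N β) ≤ β := by
  have := mul_le_mul_of_nonneg_left (one_sub_sqrt_bounds hN).2 hβ
  rw [cavityBeta]; linarith

/-- With r = √(N/(N+1)), rationalising gives N(1 − r) = (N/(N+1))/(1 + r), which tends to 1/2. -/
lemma tendsto_natCast_mul_sub_cavityBeta (β : ℝ) :
    Tendsto (fun N : ℕ => N * (β - cavityBeta N β)) atTop (𝓝 (β / 2)) := by
  have h1 := (tendsto_natCast_div_add_atTop (1 : ℝ)).mul
    ((tendsto_sqrt_ratio.const_add 1).inv₀ (by norm_num))
  have h2 := h1.const_mul β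
  rw [show β * (1 * (1 + 1)⁻¹) = β / 2 by ring] at h2
  refine h2.congr fun N => ?_
  have hN : (0 : ℝ) < N + 1 := by positivity
  have hr0 : 0 ≤ Real.sqrt ((N : ℝ) / (N + 1)) := Real.sqrt_nonneg _
  have hr : Real.sqrt ((N : ℝ) / (N + 1)) ^ 2 = N / (N + 1) := Real.sq_sqrt (by positivity)
  have h3 : (1 : ℝ) = (N + 1) * (1 - Real.sqrt (N / (N + 1))) * (1 + Real.sqrt (N / (N + 1))) := by
    rw [mul_assoc, show (1 - Real.sqrt ((N : ℝ) / (N + 1))) * (1 + Real.sqrt (N / (N + 1))) =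
      1 - Real.sqrt ((N : ℝ) / (N + 1)) ^ 2 by ring, hr]
    field_simp
    ring
  rw [cavityBeta]
  set r := Real.sqrt ((N : ℝ) / (N + 1))
  have h4 : 0 < 1 + r := by positivity
  field_simp
  linear_combination (β * N) * h3

/-- Quenched means at the temperature of the cavity system. -/
lemma tendsto_quenchedLines_sub_cavityBeta {β : ℝ} (hβ : 0 < β) (h : FluctNegligible β) {s : ℕ}
    {m : List (ℕ × ℕ)} (hm : LinesBelow s m) :
    Tendsto (fun N => quenchedLines N (cavityBeta N β) s m - quenchedLines N β s m)
      atTop (𝓝 0) := by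
  rw [Metric.tendsto_atTop']
  intro ε hε
  obtain ⟨δ, hδ, hδβ, hev⟩ := h (ε / ((s + 1) * (β + 1))) (by positivity)
  obtain ⟨N₀, hN₀⟩ := eventually_atTop.1 ((hev.and (eventually_ne_atTop 0)).and
    ((tendsto_cavityBeta β).eventually_const_le (by linarith : β - δ < β)))
  refine ⟨N₀, fun N hN => ?_⟩
  obtain ⟨⟨h1, hN0⟩, hc⟩ := hN₀ N hN.le
  -- The derivative is o(N) throughout [β − δ, β], and the interval from β' to β has length at most
  -- β/N.
  obtain ⟨x, hx, hd⟩ := exists_hasDerivAt_eq_slope (fun y => quenchedLines N y s m) _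
    (cavityBeta_lt hβ)
    (fun x _ => (hasDerivAt_quenchedLines hN0 x hm).1.continuousAt.continuousWithinAt)
    fun x _ => (hasDerivAt_quenchedLines hN0 x hm).1
  have hN' : (0 : ℝ) < N := by exact_mod_cast Nat.pos_of_ne_zero hN0
  have hp : 0 < β - cavityBeta N β := sub_pos.2 (cavityBeta_lt hβ)
  rw [eq_div_iff hp.ne'] at hd
  rw [Real.dist_eq, sub_zero, abs_sub_comm, ← hd, abs_mul, abs_of_pos hp]
  have h2 := (hasDerivAt_quenchedLines hN0 x hm).2.trans
    (mul_le_mul_of_nonneg_left (h1 x (hc.trans hx.1.le) hx.2.le) (Nat.cast_nonneg s))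
  have h3 := mul_le_mul_of_nonneg_right h2 hp.le
  refine h3.trans_lt ?_
  have h4 := mul_le_mul_of_nonneg_left (natCast_mul_sub_cavityBeta_le hN0 hβ.le)
    (by positivity : (0 : ℝ) ≤ s * (ε / ((s + 1) * (β + 1))))
  have h5 : s * (ε / ((s + 1) * (β + 1))) * β = (s / (s + 1)) * (β / (β + 1)) * ε := by
    field_simp
  have h6 : (s : ℝ) / (s + 1) ≤ 1 := (div_le_one (by positivity)).2 (by linarith)
  have h7 : β / (β + 1) < 1 := (div_lt_one (by positivity)).2 (by linarith)
  have h8 : (s / (s + 1)) * (β / (β + 1)) < 1 := mul_lt_one_of_nonneg_of_lt_one_right h6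
    (by positivity) h7
  have h9 := mul_lt_mul_of_pos_right h8 hε
  rw [one_mul, ← h5] at h9
  linarith

lemma linesBelow_replicate (n : ℕ) : LinesBelow 2 (List.replicate n (0, 1)) := by
  intro u hu
  rw [List.eq_of_mem_replicate hu]; simp

/-- The change of the free energy between the temperatures of the full and the cavity system. -/
lemma tendsto_alphaN_sub_cavityBeta {β : ℝ} (hβ : 0 < β) (h : FluctNegligible β) :
    Tendsto (fun N : ℕ => N * (alphaN N β - alphaN N (cavityBeta N β)) -
      β ^ 2 / 4 * (1 - overlapSq N β)) atTop (𝓝 0) := by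
  have h1 : Tendsto (fun N => alphaDeriv N (cavityBeta N β) - alphaDeriv N β) atTop (𝓝 0) := by
    have e1 := ((tendsto_cavityBeta β).sub_const β).mul_const (1 / 2)
    have e2 := (tendsto_quenchedLines_sub_cavityBeta hβ h (linesBelow_replicate 2)).const_mul
      (β / 2)
    rw [sub_self, zero_mul] at e1
    rw [mul_zero] at e2
    have e3 := squeeze_zero_norm (f := fun N => (cavityBeta N β - β) * (1 / 2) *
      (1 - overlapSq N (cavityBeta N β))) (fun N => ?_) (by simpa using e1.abs)
    · have e4 := e3.sub e2
      rw [sub_zero] at e4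
      refine e4.congr fun N => ?_
      rw [alphaDeriv, alphaDeriv, overlapSq, overlapSq]
      ring
    · rw [norm_mul, Real.norm_eq_abs, Real.norm_eq_abs]
      refine (mul_le_of_le_one_right (abs_nonneg _) (abs_le.2 ⟨?_, ?_⟩)).trans_eq (by simp) <;>
      linarith [overlapSq_nonneg N (cavityBeta N β), overlapSq_le_one N (cavityBeta N β)]
  -- Convexity places the increment between the slopes at the two endpoints, whose difference tends
  -- to 0 by `h1`.
  have h2 : Tendsto (fun N : ℕ => N * (alphaN N β - alphaN N (cavityBeta N β)) -
      N * (β - cavityBeta N β) * alphaDeriv N β) atTop (𝓝 0) := by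
    have e := (tendsto_natCast_mul_sub_cavityBeta β).mul h1
    rw [mul_zero] at e
    refine tendsto_of_tendsto_of_tendsto_of_le_of_le' e tendsto_const_nhds ?_ ?_
    all_goals
      filter_upwards [eventually_ne_atTop 0] with N hN
      have hs := slope_bounds_of_monotone_deriv (f' := alphaDeriv N) (hasDerivAt_alphaN hN)
        (monotone_alphaDeriv hN)
        (cavityBeta_lt (N := N) hβ)
      have hN' : (0 : ℝ) ≤ N := Nat.cast_nonneg N
    · linarith [mul_le_mul_of_nonneg_left hs.1 hN']
    · linarith [mul_le_mul_of_nonneg_left hs.2 hN']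
  have h3 : Tendsto (fun N : ℕ => (N * (β - cavityBeta N β) - β / 2) * alphaDeriv N β) atTop
      (𝓝 0) := by
    have e := (((tendsto_natCast_mul_sub_cavityBeta β).sub_const (β / 2)).mul_const (|β| / 2)).abs
    simp only [sub_self, zero_mul, abs_zero] at e
    refine squeeze_zero_norm (fun N => ?_) e
    rw [norm_mul, Real.norm_eq_abs, Real.norm_eq_abs, abs_mul, abs_of_nonneg
      (by positivity : 0 ≤ |β| / 2)]
    exact mul_le_mul_of_nonneg_left (abs_alphaDeriv_le N β) (abs_nonneg _)
  have h4 := h2.add h3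
  rw [add_zero] at h4
  refine h4.congr fun N => ?_
  rw [alphaDeriv]
  ring

end Cavity
end SK
namespace SK

/-! ### Expansion of one increment -/

open OverlapGraph

lemma abs_graphAvg_le_one (N : ℕ) (β : ℝ) (G : OverlapGraph) : |graphAvg N β G| ≤ 1 := by
  rw [graphAvg_eq_quenchedLines]
  exact abs_quenchedLines_le_one _ _ _ _

/-- The expansion of the logarithm of the cavity field in its amplitude. -/
noncomputable def cavityExpansion (y : ℝ) (g : OverlapGraph → ℝ) : ℝ :=
  y ^ 2 / 2 + -1 / 4 * (y ^ 4 * g doubleLine) + 1 / 3 * (y ^ 6 * g triangle)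
    + (-1 / 48 * (y ^ 8 * g fourfoldLine) + 1 / 4 * (y ^ 8 * g twoDoubleLinesJoined)
      + -3 / 16 * (y ^ 8 * g twoDoubleLinesDisjoint) + -3 / 4 * (y ^ 8 * g square))
    + (1 / 6 * (y ^ 10 * g triangleDoubleLineEdge) + -3 / 2 * (y ^ 10 * g triangleDoubleLineJoined)
      + 1 * (y ^ 10 * g triangleDoubleLineDisjoint) + 12 / 5 * (y ^ 10 * g pentagon))

/-- Five inserted-line coefficients are kept, so the remainder has six lines and order y¹²; the
coefficients are −1/(2(k+1)!) times the graph counts. -/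
lemma abs_cavityLog_sub_cavityExpansion_le (B : ℝ) : ∃ C, 0 ≤ C ∧ ∀ N : ℕ, N ≠ 0 →
    ∀ β y : ℝ, 0 ≤ y → y ≤ B →
    |cavityLog N β y - N * alphaN N β - cavityExpansion y (graphAvg N β)| ≤
      C * y ^ 12 * graphAvg N β sixfoldLine := by
  obtain ⟨C, hC, h⟩ := abs_cavityLog_sub_le B 5 (by decide)
  refine ⟨C, hC, fun N hN β y h0 hB => ?_⟩
  have h1 := h N hN β y h0 hB
  rw [graphAvg_eq_quenchedLines N β sixfoldLine]
  refine (le_of_eq ?_).trans h1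
  congr 1
  simp only [Finset.sum_range_succ, Finset.sum_range_zero, quenchedTerms_insertedLines_zero,
    quenchedTerms_insertedLines_one, quenchedTerms_insertedLines_two,
    quenchedTerms_insertedLines_three, quenchedTerms_insertedLines_four, cavityExpansion]
  norm_num [Nat.factorial]
  ring

lemma tendsto_graphAvg_sub_cavityBeta {β : ℝ} (hβ : 0 < β) (h : FluctNegligible β)
    {G : OverlapGraph} (hG : LinesBelow G.replicas G.natLines) :
    Tendsto (fun N => graphAvg N (cavityBeta N β) G - graphAvg N β G) atTop (𝓝 0) := by
  simp only [graphAvg_eq_quenchedLines]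
  exact tendsto_quenchedLines_sub_cavityBeta hβ h hG

lemma tendsto_pow_mul_graphAvg_sub {β : ℝ} (hβ : 0 < β) (h : FluctNegligible β)
    {G : OverlapGraph} (hG : LinesBelow G.replicas G.natLines) (k : ℕ) :
    Tendsto (fun N => cavityBeta N β ^ k * graphAvg N (cavityBeta N β) G - β ^ k * graphAvg N β G)
      atTop (𝓝 0) := by
  have h1 := (tendsto_graphAvg_sub_cavityBeta hβ h hG).const_mul (β ^ k)
  have h2 := ((tendsto_cavityBeta β).pow k).sub_const (β ^ k)
  rw [sub_self] at h2
  have h3 := squeeze_zero_norm (f := fun N => (cavityBeta N β ^ k - β ^ k) *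
    graphAvg N (cavityBeta N β) G) (fun N => ?_) (by simpa using h2.abs)
  · have h4 := h3.add h1
    rw [mul_zero, add_zero] at h4
    exact h4.congr fun N => by ring
  · rw [norm_mul]
    exact mul_le_of_le_one_right (norm_nonneg _) (abs_graphAvg_le_one _ _ _)

lemma tendsto_cavityExpansion_sub {β : ℝ} (hβ : 0 < β) (h : FluctNegligible β) :
    Tendsto (fun N => cavityExpansion (cavityBeta N β) (graphAvg N (cavityBeta N β)) -
      cavityExpansion β (graphAvg N β)) atTop (𝓝 0) := by
  have t := fun {G : OverlapGraph} (hG : LinesBelow G.replicas G.natLines) (k : ℕ) (c : ℝ) =>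
    (tendsto_pow_mul_graphAvg_sub hβ h hG k).const_mul c
  have h0 := (((tendsto_cavityBeta β).pow 2).sub_const (β ^ 2)).div_const 2
  have e := ((((((((((h0.add (t (G := doubleLine) (by decide) 4 (-1 / 4))).add
    (t (G := triangle) (by decide) 6 (1 / 3))).add
    (t (G := fourfoldLine) (by decide) 8 (-1 / 48))).add
    (t (G := twoDoubleLinesJoined) (by decide) 8 (1 / 4))).add
    (t (G := twoDoubleLinesDisjoint) (by decide) 8 (-3 / 16))).add
    (t (G := square) (by decide) 8 (-3 / 4))).add
    (t (G := triangleDoubleLineEdge) (by decide) 10 (1 / 6))).add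
    (t (G := triangleDoubleLineJoined) (by decide) 10 (-3 / 2))).add
    (t (G := triangleDoubleLineDisjoint) (by decide) 10 1)).add
    (t (G := pentagon) (by decide) 10 (12 / 5)))
  simp only [sub_self, zero_div, mul_zero, add_zero] at e
  refine e.congr fun N => ?_
  rw [cavityExpansion, cavityExpansion]
  ring

/-- The increment of the free energy when a spin is added. -/
noncomputable def increment (N : ℕ) (β : ℝ) : ℝ :=
  (N + 1 : ℕ) * alphaN (N + 1) β - N * alphaN N β

lemma increment_eq {N : ℕ} (hN : N ≠ 0) (β : ℝ) :
    increment N β = Real.log 2 + (cavityLog N (cavityBeta N β) (cavityBeta N β) -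
      N * alphaN N (cavityBeta N β)) - N * (alphaN N β - alphaN N (cavityBeta N β)) := by
  rw [increment, alphaN_succ hN]
  ring

/-- The two vanishing insertions are added with weights −β⁸/48 and β¹⁰/18, chosen to match the
coefficients −1/48 of q₁₂⁴ and 1/6 = 3/18 of q₁₂³q₂₃q₃₁. Both graphs then drop out, and the other
coefficients become those of `expansion`. -/
lemma tendsto_main_terms_sub_expansion {β : ℝ} (hβ : 0 < β) (h : FluctNegligible β) :
    Tendsto (fun N : ℕ => Real.log 2 + cavityExpansion (cavityBeta N β)
      (graphAvg N (cavityBeta N β)) - N * (alphaN N β - alphaN N (cavityBeta N β)) -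
      expansion β (graphAvg N β)) atTop (𝓝 0) := by
  have h1 := tendsto_cavityExpansion_sub hβ h
  have h2 := tendsto_alphaN_sub_cavityBeta hβ h
  have h3 := (tendsto_quenchedTerms_insertLines hβ h linesBelow_doubleLine).const_mul
    (-(β ^ 8 / 48))
  have h4 := (tendsto_quenchedTerms_insertLines hβ h linesBelow_triangle).const_mul (β ^ 10 / 18)
  have e := ((h1.sub h2).add h3).add h4
  simp only [sub_self, mul_zero, add_zero] at e
  refine e.congr fun N => ?_
  rw [quenchedTerms_insertLines_doubleLine, quenchedTerms_insertLines_triangle, overlapSq,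
    show quenchedLines N β 2 (List.replicate 2 (0, 1)) = graphAvg N β doubleLine from
      (graphAvg_eq_quenchedLines N β doubleLine).symm, cavityExpansion, cavityExpansion, expansion]
  ring

/-- The increment of the free energy is given by the expansion up to a multiple of the mean
sixth power of the overlap. -/
lemma exists_abs_increment_sub_expansion_le (B : ℝ) : ∃ C, 0 ≤ C ∧ ∀ β, 0 < β → β ≤ B →
    FluctNegligible β → ∃ r : ℕ → ℝ, Tendsto r atTop (𝓝 0) ∧ ∀ᶠ N in atTop,
      |increment N β - expansion β (graphAvg N β)| ≤
        C * β ^ 12 * graphAvg N β sixfoldLine + r N := by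
  obtain ⟨C, hC, hc⟩ := abs_cavityLog_sub_cavityExpansion_le B
  refine ⟨C, hC, fun β hβ hB h => ?_⟩
  have h1 := tendsto_main_terms_sub_expansion hβ h
  have h2 := (tendsto_graphAvg_sub_cavityBeta hβ h (G := sixfoldLine) (by decide)).const_mul
    (C * β ^ 12)
  have e := h1.abs.add h2.abs
  simp only [mul_zero, abs_zero, add_zero] at e
  refine ⟨_, e, ?_⟩
  filter_upwards [eventually_ne_atTop 0] with N hN
  have hb := cavityBeta_nonneg N hβ.le
  have hb' := cavityBeta_le hN hβ.le
  have h3 := hc N hN (cavityBeta N β) (cavityBeta N β) hb (hb'.trans hB)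
  have h4 : 0 ≤ graphAvg N (cavityBeta N β) sixfoldLine := by
    rw [graphAvg_eq_quenchedLines]
    exact quenchedLines_nonneg_of_even N _ (by decide : Even 6)
  have h5 : C * cavityBeta N β ^ 12 * graphAvg N (cavityBeta N β) sixfoldLine ≤
      C * β ^ 12 * graphAvg N (cavityBeta N β) sixfoldLine := by gcongr
  rw [increment_eq hN]
  set a := Real.log 2 + cavityExpansion (cavityBeta N β) (graphAvg N (cavityBeta N β)) -
      N * (alphaN N β - alphaN N (cavityBeta N β)) - expansion β (graphAvg N β)
  have h6 := le_abs_self (C * β ^ 12 * (graphAvg N (cavityBeta N β) sixfoldLine -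
    graphAvg N β sixfoldLine))
  calc _ = |(cavityLog N (cavityBeta N β) (cavityBeta N β) - N * alphaN N (cavityBeta N β) -
        cavityExpansion (cavityBeta N β) (graphAvg N (cavityBeta N β))) + a| := by
        congr 1; ring
    _ ≤ _ := (abs_add_le _ _).trans (by linarith)

end SK
namespace SK

open OverlapGraph

/-! ### Cesàro means and passage to the limit -/

section Limsup

lemma limsup_le_const_mul_limsup {u v e : ℕ → ℝ} {K : ℝ} (hK : 0 ≤ K) (hu : ∀ n, 0 ≤ u n)
    (hv : ∀ n, v n ≤ 1) (he : Tendsto e atTop (𝓝 0)) (h : ∀ᶠ n in atTop, u n ≤ K * v n + e n) :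
    limsup u atTop ≤ K * limsup v atTop := by
  refine le_of_forall_pos_le_add fun ε hε => ?_
  have hlt : limsup v atTop < limsup v atTop + ε / (2 * (K + 1)) := by
    have : 0 < ε / (2 * (K + 1)) := by positivity
    linarith
  have h1 : ∀ᶠ n in atTop, v n < limsup v atTop + ε / (2 * (K + 1)) :=
    eventually_lt_of_limsup_lt hlt (isBoundedUnder_of ⟨1, hv⟩)
  have h2 : ∀ᶠ n in atTop, e n < ε / 2 := he.eventually_lt_const (by positivity)
  refine limsup_le_of_le (isBoundedUnder_of ⟨0, hu⟩).isCoboundedUnder_le ?_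
  filter_upwards [h, h1, h2] with n h h1 h2
  have h3 := mul_le_mul_of_nonneg_left h1.le hK
  have h4 : K * (ε / (2 * (K + 1))) ≤ ε / 2 := by
    rw [mul_div_assoc', div_le_div_iff₀ (by positivity) (by positivity)]
    nlinarith
  linarith

lemma tendsto_max_sub_limsup {v : ℕ → ℝ} (hv : ∀ n, v n ≤ 1) :
    Tendsto (fun n => max (v n - limsup v atTop) 0) atTop (𝓝 0) := by
  refine tendsto_order.2 ⟨fun a ha => Eventually.of_forall fun n => ha.trans_le (le_max_right _ _),
    fun a ha => ?_⟩
  filter_upwards [eventually_lt_of_limsup_lt (by linarith : limsup v atTop < limsup v atTop + a)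
    (isBoundedUnder_of ⟨1, hv⟩)] with n hn
  exact max_lt (by linarith) ha

lemma tendsto_cesaro {u : ℕ → ℝ} {l : ℝ} (h : Tendsto u atTop (𝓝 l)) :
    Tendsto (fun n : ℕ => (∑ i ∈ Finset.range n, u i) / n) atTop (𝓝 l) :=
  h.cesaro.congr fun n => by rw [div_eq_inv_mul]

lemma cesaro_le {u v : ℕ → ℝ} (h : ∀ n, u n ≤ v n) (n : ℕ) :
    (∑ i ∈ Finset.range n, u i) / n ≤ (∑ i ∈ Finset.range n, v i) / n :=
  div_le_div_of_nonneg_right (Finset.sum_le_sum fun i _ => h i) (Nat.cast_nonneg n)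

lemma cesaro_le_of_le {u : ℕ → ℝ} {c : ℝ} (hc : 0 ≤ c) (h : ∀ n, u n ≤ c) (n : ℕ) :
    (∑ i ∈ Finset.range n, u i) / n ≤ c := by
  refine div_le_of_le_mul₀ (Nat.cast_nonneg n) hc ?_
  refine (Finset.sum_le_card_nsmul _ _ c fun i _ => h i).trans_eq ?_
  rw [Finset.card_range, nsmul_eq_mul, mul_comm]

lemma limsup_cesaro_le {v : ℕ → ℝ} (h0 : ∀ n, 0 ≤ v n) (hv : ∀ n, v n ≤ 1) :
    limsup (fun n : ℕ => (∑ i ∈ Finset.range n, v i) / n) atTop ≤ limsup v atTop := by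
  set L := limsup v atTop
  have h1 := tendsto_cesaro ((tendsto_max_sub_limsup hv).const_add L)
  rw [add_zero] at h1
  refine (limsup_le_limsup (Eventually.of_forall (cesaro_le fun n => ?_)) ?_ ?_).trans_eq
    h1.limsup_eq
  · linarith [le_max_left (v n - L) 0]
  · exact (isBoundedUnder_of ⟨0, fun n => div_nonneg (Finset.sum_nonneg fun i _ => h0 i)
      (Nat.cast_nonneg n)⟩).isCoboundedUnder_le
  · exact h1.isBoundedUnder_le

end Limsup

lemma graphAvg_sixfoldLine_nonneg (N : ℕ) (β : ℝ) : 0 ≤ graphAvg N β sixfoldLine := by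
  rw [graphAvg_eq_quenchedLines]
  exact quenchedLines_nonneg_of_even N _ (by decide : Even 6)

lemma graphAvg_le_one (N : ℕ) (β : ℝ) (G : OverlapGraph) : graphAvg N β G ≤ 1 :=
  (le_abs_self _).trans (abs_graphAvg_le_one N β G)

/-- The increments telescope, and the boundary term at N = 0 vanishes because of its factor N. -/
lemma sum_increment_div {n : ℕ} (hn : n ≠ 0) (β : ℝ) :
    (∑ N ∈ Finset.range n, increment N β) / n = alphaN n β := by
  have hn' : (n : ℝ) ≠ 0 := by exact_mod_cast hn
  simp only [increment]
  rw [Finset.sum_range_sub (fun N : ℕ => (N : ℝ) * alphaN N β)]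
  field_simp
  simp

/-- The expansion is affine in the graph values and therefore commutes with averaging. -/
lemma expansion_cesaroAvg {n : ℕ} (hn : n ≠ 0) (β : ℝ) :
    expansion β (cesaroAvg n β) = (∑ N ∈ Finset.range n, expansion β (graphAvg N β)) / n := by
  have hn' : (n : ℝ) ≠ 0 := by exact_mod_cast hn
  simp only [expansion, cesaroAvg, mul_add, mul_one, Finset.sum_add_distrib,
    Finset.sum_sub_distrib, ← Finset.mul_sum, Finset.sum_const, Finset.card_range, nsmul_eq_mul]
  field_simp

lemma tendsto_expansion {g : ℕ → OverlapGraph → ℝ} {g' : OverlapGraph → ℝ}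
    (h : ∀ G ∈ expansionGraphs, Tendsto (fun N => g N G) atTop (𝓝 (g' G))) (β : ℝ) :
    Tendsto (fun N => expansion β (g N)) atTop (𝓝 (expansion β g')) := by
  simp only [expansionGraphs, List.forall_mem_cons, List.not_mem_nil, false_imp_iff] at h
  obtain ⟨h1, h2, h3, h4, h5, h6, h7, h8, -⟩ := h
  exact ((((((((((h1.const_mul _).const_add 1).const_mul _).const_add _).add (h2.const_mul _)).add
    (h3.const_mul _)).sub (h4.const_mul _)).sub (h5.const_mul _)).sub (h6.const_mul _)).add
    (h7.const_mul _)).add (h8.const_mul _)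

/-- The graded form of the expansion, for Cesàro means. -/
lemma limsup_cesaro_expansion_le {β K : ℝ} (hβ : 0 ≤ β) (hK : 0 ≤ K) {r : ℕ → ℝ}
    (hr : Tendsto r atTop (𝓝 0)) (h : ∀ᶠ N in atTop, |increment N β - expansion β (graphAvg N β)| ≤
      K * graphAvg N β sixfoldLine + r N) :
    limsup (fun n : ℕ => |alpha β - expansion β (cesaroAvg n β)|) atTop ≤
      K * limsup (fun n : ℕ => cesaroAvg n β sixfoldLine) atTop := by
  set d : ℕ → ℝ := fun N => |increment N β - expansion β (graphAvg N β)|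
  -- Taking the positive part makes the inequality hold for every N, not only eventually, so that it
  -- can be averaged from N = 0.
  set e : ℕ → ℝ := fun N => max (d N - K * graphAvg N β sixfoldLine) 0
  have he : Tendsto e atTop (𝓝 0) := by
    have ha := hr.abs
    rw [abs_zero] at ha
    refine squeeze_zero' (Eventually.of_forall fun N => le_max_right _ _) ?_ ha
    filter_upwards [h] with N hN
    exact max_le (by linarith [le_abs_self (r N)]) (abs_nonneg _)
  have h1 := ((tendsto_alphaN hβ).const_sub (alpha β)).abs.add (tendsto_cesaro he)
  simp only [sub_self, abs_zero, add_zero] at h1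
  refine limsup_le_const_mul_limsup hK (fun n => abs_nonneg _)
    (cesaro_le_of_le zero_le_one fun N => graphAvg_le_one N β _) h1 ?_
  filter_upwards [eventually_ne_atTop 0] with n hn
  have h2 : |alphaN n β - expansion β (cesaroAvg n β)| ≤
      (∑ N ∈ Finset.range n, d N) / n := by
    rw [← sum_increment_div hn, expansion_cesaroAvg hn, ← sub_div, ← Finset.sum_sub_distrib,
      abs_div, Nat.abs_cast]
    exact div_le_div_of_nonneg_right (Finset.abs_sum_le_sum_abs _ _) (Nat.cast_nonneg n)
  have h3 := cesaro_le (u := d) (v := fun N => K * graphAvg N β sixfoldLine + e N)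
    (fun N => by linarith [le_max_left (d N - K * graphAvg N β sixfoldLine) 0]) n
  rw [Finset.sum_add_distrib, ← Finset.mul_sum, add_div, mul_div_assoc] at h3
  have h4 := abs_sub_le (alpha β) (alphaN n β) (expansion β (cesaroAvg n β))
  rw [cesaroAvg]
  linarith

lemma cesaroAvg_sixfoldLine_limsup_le (β : ℝ) :
    limsup (fun n : ℕ => cesaroAvg n β sixfoldLine) atTop ≤
      limsup (fun N : ℕ => graphAvg N β sixfoldLine) atTop :=
  limsup_cesaro_le (fun N => graphAvg_sixfoldLine_nonneg N β) fun N => graphAvg_le_one N β _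

/-- The graded form of the expansion, when the limits exist. -/
lemma abs_alpha_sub_expansion_le {β K : ℝ} (hK : 0 ≤ K)
    (h : limsup (fun n : ℕ => |alpha β - expansion β (cesaroAvg n β)|) atTop ≤
      K * limsup (fun n : ℕ => cesaroAvg n β sixfoldLine) atTop) {g : OverlapGraph → ℝ}
    (hg : ∀ G ∈ expansionGraphs, Tendsto (fun N : ℕ => graphAvg N β G) atTop (𝓝 (g G))) :
    |alpha β - expansion β g| ≤
      K * limsup (fun N : ℕ => graphAvg N β sixfoldLine) atTop := by
  have h1 := ((tendsto_expansion (g := fun n => cesaroAvg n β)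
    (fun G hG => tendsto_cesaro (hg G hG)) β).const_sub (alpha β)).abs
  rw [h1.limsup_eq] at h
  exact h.trans (mul_le_mul_of_nonneg_left (cesaroAvg_sixfoldLine_limsup_le β) hK)

end SK
namespace SK

/-! ### High temperature and the uniform bound -/

open OverlapGraph

lemma fluctNegligible_dense {a b : ℝ} (ha : 0 ≤ a) (hab : a < b) :
    ∃ β, a < β ∧ β < b ∧ FluctNegligible β := by
  obtain ⟨S, hS, h⟩ := exists_countable_fluctNegligible
  obtain ⟨x, hx, hxS⟩ := (hS.dense_compl ℝ).exists_between hab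
  exact ⟨x, hxS.1, hxS.2, h x (ha.trans_lt hxS.1) hx⟩

/-- At high temperature, the free energy is the annealed one: generic temperatures. -/
lemma exists_annealed_le_alpha : ∃ β₀, 0 < β₀ ∧ ∀ β, 0 < β → β ≤ β₀ → FluctNegligible β →
    Real.log 2 + β ^ 2 / 4 ≤ alpha β := by
  obtain ⟨C, hC, hc⟩ := abs_cavityLog_sub_le 1 1 (by decide)
  have hβ₀ : min 1 (1 / (4 * (C + 1))) ≤ 1 / (4 * (C + 1)) := min_le_right _ _
  -- This β₀ ensures Cβ² ≤ 1/4, so the cavity error Cβ⁴⟨q₁₂²⟩ is absorbed by the gain β²/4 · ⟨q₁₂²⟩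
  -- from the temperature shift.
  refine ⟨min 1 (1 / (4 * (C + 1))), lt_min one_pos (by positivity), fun β hβ hle h => ?_⟩
  have h1 : β ≤ 1 := hle.trans (min_le_left _ _)
  have h2 : C * β ^ 2 ≤ 1 / 4 := by
    have := hle.trans hβ₀
    rw [le_div_iff₀ (by positivity)] at this
    nlinarith
  have t1 := ((tendsto_cavityBeta β).pow 2).div_const 2
  have t2 := tendsto_alphaN_sub_cavityBeta hβ h
  have t3 := tendsto_quenchedLines_sub_cavityBeta hβ h (linesBelow_replicate 2)
  have t4 := ((t1.sub t2).sub (t3.abs.const_mul (β ^ 2 / 4))).const_add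
    (Real.log 2 - β ^ 2 / 4)
  rw [abs_zero, mul_zero, sub_zero, sub_zero,
    show Real.log 2 - β ^ 2 / 4 + β ^ 2 / 2 = Real.log 2 + β ^ 2 / 4 by ring] at t4
  set w : ℕ → ℝ := fun N => Real.log 2 - β ^ 2 / 4 + (cavityBeta N β ^ 2 / 2 -
    (N * (alphaN N β - alphaN N (cavityBeta N β)) - β ^ 2 / 4 * (1 - overlapSq N β)) -
    β ^ 2 / 4 * |overlapSq N (cavityBeta N β) - overlapSq N β|)
  -- `increment_eq` needs N ≠ 0 while the telescoping sum starts at N = 0; replacing one term does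
  -- not affect the limit.
  have t5 : Tendsto (fun N => if N = 0 then increment N β else w N) atTop
      (𝓝 (Real.log 2 + β ^ 2 / 4)) :=
    t4.congr' ((eventually_ne_atTop 0).mono fun N hN => (if_neg hN).symm)
  refine le_of_tendsto_of_tendsto (tendsto_cesaro t5) (tendsto_alphaN hβ.le) ?_
  filter_upwards [eventually_ne_atTop 0] with n hn
  rw [← sum_increment_div hn]
  refine cesaro_le (fun N => ?_) n
  split_ifs with hN
  · exact le_rfl
  have hb := cavityBeta_nonneg N hβ.le
  have hb' := cavityBeta_le hN hβ.le
  have h3 := hc N hN (cavityBeta N β) (cavityBeta N β) hb (hb'.trans h1)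
  simp only [Finset.sum_range_one, quenchedTerms_insertedLines_zero, zero_mul, zero_div, mul_zero,
    add_zero] at h3
  have h4 : C * cavityBeta N β ^ 4 ≤ β ^ 2 / 4 := by
    have : cavityBeta N β ^ 4 ≤ β ^ 4 := pow_le_pow_left₀ hb hb' 4
    nlinarith [mul_le_mul_of_nonneg_left this hC, mul_le_mul_of_nonneg_right h2 (sq_nonneg β)]
  have h5 := mul_le_mul_of_nonneg_right h4 (overlapSq_nonneg N (cavityBeta N β))
  have h6 := mul_le_mul_of_nonneg_left
    (le_abs_self (overlapSq N (cavityBeta N β) - overlapSq N β)) (by positivity : 0 ≤ β ^ 2 / 4)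
  have h7 := (abs_le.1 h3).1
  rw [increment_eq hN]
  change _ ≤ C * cavityBeta N β ^ 4 * overlapSq N (cavityBeta N β) at h3
  change -(C * cavityBeta N β ^ 4 * overlapSq N (cavityBeta N β)) ≤ _ at h7
  simp only [w]
  linarith

lemma alpha_le_annealed {β : ℝ} (hβ : 0 ≤ β) : alpha β ≤ Real.log 2 + β ^ 2 / 4 :=
  le_of_tendsto (tendsto_alphaN hβ) ((eventually_ne_atTop 0).mono fun _ hN => alphaN_le hN hβ)

/-- At high temperature, the free energy is the annealed one. -/
lemma exists_alpha_eq_annealed : ∃ β₀, 0 < β₀ ∧ ∀ β, 0 ≤ β → β < β₀ →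
    alpha β = Real.log 2 + β ^ 2 / 4 := by
  obtain ⟨β₀, h₀, h⟩ := exists_annealed_le_alpha
  refine ⟨β₀, h₀, fun β hβ hlt => (alpha_le_annealed hβ).antisymm ?_⟩
  -- The gap to the annealed value is nondecreasing in β, so its vanishing at a generic x > β forces
  -- it to vanish at β.
  obtain ⟨x, hx, hx₀, hxF⟩ := fluctNegligible_dense hβ hlt
  have h1 := h x (hβ.trans_lt hx) hx₀.le hxF
  have h2 : Real.log 2 + β ^ 2 / 4 - alpha β ≤ Real.log 2 + x ^ 2 / 4 - alpha x :=
    le_of_tendsto_of_tendsto ((tendsto_alphaN hβ).const_sub _)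
      ((tendsto_alphaN (hβ.trans hx.le)).const_sub _) ((eventually_ne_atTop 0).mono fun N hN =>
        monotoneOn_annealed_sub_alphaN hN (Set.mem_Ici.2 hβ) (Set.mem_Ici.2 (hβ.trans hx.le)) hx.le)
  linarith

/-- At high temperature, the overlap vanishes. -/
lemma exists_tendsto_overlapSq : ∃ β₀, 0 < β₀ ∧ ∀ β, 0 < β → β < β₀ →
    alpha β = Real.log 2 + β ^ 2 / 4 ∧ Tendsto (fun N => overlapSq N β) atTop (𝓝 0) := by
  obtain ⟨β₀, h₀, h⟩ := exists_alpha_eq_annealed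
  refine ⟨β₀, h₀, fun β hβ hlt => ⟨h β hβ.le hlt, ?_⟩⟩
  refine tendsto_order.2 ⟨fun a ha => Eventually.of_forall fun N => ha.trans_le
    (overlapSq_nonneg N β), fun a ha => ?_⟩
  -- The slope of the annealed curve over [β − d, β] is β/2 − d/4. By convexity α_N'(β) eventually
  -- exceeds β/2 − d/2, that is β·`overlapSq` < d ≤ βa.
  set d := min β (β * a) with hd
  have hd0 : 0 < d := lt_min hβ (by positivity)
  have hdβ : d ≤ β := min_le_left _ _
  have hda : d ≤ β * a := min_le_right _ _
  have t := (tendsto_alphaN hβ.le).sub (tendsto_alphaN (by linarith : 0 ≤ β - d))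
  rw [h β hβ.le hlt, h (β - d) (by linarith) (by linarith)] at t
  have hlim : Real.log 2 + β ^ 2 / 4 - (Real.log 2 + (β - d) ^ 2 / 4) = (β / 2 - d / 4) * d := by
    ring
  rw [hlim] at t
  have hlt' : (β / 2 - d / 2) * d < (β / 2 - d / 4) * d :=
    mul_lt_mul_of_pos_right (by linarith) hd0
  filter_upwards [t.eventually_const_lt hlt', eventually_ne_atTop 0] with N hN hN0
  have h1 := (slope_bounds_of_monotone_deriv (f' := alphaDeriv N) (hasDerivAt_alphaN hN0)
    (monotone_alphaDeriv hN0) (by linarith : β - d < β)).2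
  rw [sub_sub_cancel] at h1
  have h2 := lt_of_mul_lt_mul_right (hN.trans_le h1) hd0.le
  rw [alphaDeriv] at h2
  have h3 : β * overlapSq N β < β * a := by linarith
  exact lt_of_mul_lt_mul_left h3 hβ.le

lemma abs_graphAvg_le_overlapSq (N : ℕ) (β : ℝ) {G : OverlapGraph} (hG : G ∈ expansionGraphs) :
    |graphAvg N β G| ≤ 2 * overlapSq N β := by
  have key : ∀ {G : OverlapGraph} {e e' : ℕ × ℕ} {m : List (ℕ × ℕ)},
      LinesBelow G.replicas G.natLines → G.natLines = e :: e' :: m →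
      |graphAvg N β G| ≤ 2 * overlapSq N β := by
    intro G e e' m hb hm
    rw [graphAvg_eq_quenchedLines, overlapSq, quenchedLines, quenchedLines, ← integral_const_mul]
    refine abs_integral_le_integral_abs.trans (integral_mono (integrable_linesMean _ _ _ _ _).abs
      ((integrable_linesMean _ _ _ _ _).const_mul _) fun J => ?_)
    dsimp only
    rw [hm] at hb ⊢
    exact abs_linesMean_cons_cons_le abs_overlap_le_one _ hb
  simp only [expansionGraphs, List.mem_cons, List.not_mem_nil, or_false] at hG
  rcases hG with rfl | rfl | rfl | rfl | rfl | rfl | rfl | rfl <;>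
  exact key (by decide) rfl

lemma abs_expansion_le {β M : ℝ} (h0 : 0 ≤ β) (hM : β ≤ M) (h1 : 1 ≤ M) {g : OverlapGraph → ℝ}
    (hg : ∀ G, |g G| ≤ 1) : |expansion β g| ≤ Real.log 2 + 20 * M ^ 10 := by
  have hp : ∀ k ≤ 10, β ^ k ≤ M ^ 10 := fun k hk =>
    (pow_le_pow_left₀ h0 hM k).trans (pow_le_pow_right₀ h1 hk)
  have h : ∀ k ≤ 10, ∀ G, |β ^ k * g G| ≤ M ^ 10 := fun k hk G => by
    rw [abs_mul, abs_of_nonneg (pow_nonneg h0 k)]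
    exact (mul_le_of_le_one_right (pow_nonneg h0 k) (hg G)).trans (hp k hk)
  have e : expansion β g = Real.log 2 + β ^ 2 / 4 + β ^ 2 * g doubleLine / 4
      - β ^ 4 * g doubleLine / 4 + β ^ 6 * g triangle / 3 + β ^ 8 * g twoDoubleLinesJoined / 6
      - β ^ 8 * g twoDoubleLinesDisjoint / 8 - β ^ 8 * g square * (3 / 4)
      - β ^ 10 * g triangleDoubleLineJoined + β ^ 10 * g pentagon * (12 / 5)
      + β ^ 10 * g triangleDoubleLineDisjoint * (2 / 3) := by
    rw [expansion]; ring
  have hl := Real.log_nonneg one_le_two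
  have a0 := hp 2 (by norm_num)
  have a0' := pow_nonneg h0 2
  have a1 := abs_le.1 (h 2 (by norm_num) doubleLine)
  have a2 := abs_le.1 (h 4 (by norm_num) doubleLine)
  have a3 := abs_le.1 (h 6 (by norm_num) triangle)
  have a4 := abs_le.1 (h 8 (by norm_num) twoDoubleLinesJoined)
  have a5 := abs_le.1 (h 8 (by norm_num) twoDoubleLinesDisjoint)
  have a6 := abs_le.1 (h 8 (by norm_num) square)
  have a7 := abs_le.1 (h 10 (by norm_num) triangleDoubleLineJoined)
  have a8 := abs_le.1 (h 10 (by norm_num) pentagon)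
  have a9 := abs_le.1 (h 10 (by norm_num) triangleDoubleLineDisjoint)
  rw [e, abs_le]
  constructor <;> linarith

/-- Each α_N is convex with derivative 0 at β = 0, so it stays above its value there. -/
lemma log_two_le_alpha {β : ℝ} (hβ : 0 < β) : Real.log 2 ≤ alpha β := by
  refine ge_of_tendsto (tendsto_alphaN hβ.le) ?_
  filter_upwards [eventually_ne_atTop 0] with N hN
  have h := (slope_bounds_of_monotone_deriv (f' := alphaDeriv N) (hasDerivAt_alphaN hN)
    (monotone_alphaDeriv hN) hβ).1
  rw [alphaN_zero_right hN, alphaDeriv] at h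
  linarith

lemma expansion_zero_left (g : OverlapGraph → ℝ) : expansion 0 g = Real.log 2 := by
  simp [expansion]

lemma alpha_zero : alpha 0 = Real.log 2 :=
  tendsto_nhds_unique (tendsto_alphaN le_rfl) (tendsto_const_nhds.congr'
    ((eventually_ne_atTop 0).mono fun _ hN => (alphaN_zero_right hN).symm))

/-- The remainder of the expansion is of order twelve, uniformly on bounded intervals. -/
lemma exists_limsup_abs_sub_expansion_le (B : ℝ) : ∃ C : ℝ, ∀ β : ℝ, 0 ≤ β → β ≤ B →
    limsup (fun N : ℕ => |alpha β - expansion β (graphAvg N β)|) atTop ≤ C * β ^ 12 := by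
  obtain ⟨β₀, h₀, h⟩ := exists_tendsto_overlapSq
  set M := max B 1
  have hM : 1 ≤ M := le_max_right _ _
  set K := 2 * Real.log 2 + 21 * M ^ 10
  have hl := Real.log_nonneg one_le_two
  have hK : 0 ≤ K := by positivity
  refine ⟨K / β₀ ^ 12, fun β h0 hB => ?_⟩
  have hC : 0 ≤ K / β₀ ^ 12 * β ^ 12 := by positivity
  rcases h0.eq_or_lt with rfl | hβ
  · simp [alpha_zero, expansion_zero_left]
  -- Below β₀ every graph average tends to 0 and α is annealed, so the limsup is 0. Above it, the
  -- crude bound K is turned into a multiple of β¹² by dividing by β₀¹².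
  rcases lt_or_ge β β₀ with hlt | hge
  · obtain ⟨ha, hq⟩ := h β hβ hlt
    have hg : ∀ G ∈ expansionGraphs, Tendsto (fun N => graphAvg N β G) atTop (𝓝 0) :=
      fun G hG => squeeze_zero_norm (fun N => abs_graphAvg_le_overlapSq N β hG)
        (by simpa using hq.const_mul 2)
    have t := ((tendsto_expansion (g' := fun _ => 0) hg β).const_sub (alpha β)).abs
    refine t.limsup_eq.trans_le (le_trans (le_of_eq ?_) hC)
    rw [ha, expansion]
    simp
  · have hKβ : K ≤ K / β₀ ^ 12 * β ^ 12 := by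
      rw [div_mul_eq_mul_div, le_div_iff₀ (by positivity)]
      exact mul_le_mul_of_nonneg_left (pow_le_pow_left₀ h₀.le hge 12) hK
    refine le_trans (limsup_le_of_le (isBoundedUnder_of ⟨0, fun N =>
      abs_nonneg _⟩).isCoboundedUnder_le (Eventually.of_forall fun N => ?_)) hKβ
    have hβM : β ≤ M := hB.trans (le_max_left _ _)
    have h1 := abs_le.1 (abs_expansion_le h0 hβM hM fun G => abs_graphAvg_le_one N β G)
    have h2 := log_two_le_alpha hβ
    have h3 := alpha_le_annealed h0
    have h4 : β ^ 2 ≤ M ^ 10 := (pow_le_pow_left₀ h0 hβM 2).trans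
      (pow_le_pow_right₀ hM (by norm_num))
    have h5 : 0 ≤ β ^ 2 := sq_nonneg β
    rw [abs_le]
    constructor <;> linarith

lemma filled_of_mem_expansionGraphs {G : OverlapGraph} (hG : G ∈ expansionGraphs) : G.Filled := by
  simp only [expansionGraphs, List.mem_cons, List.not_mem_nil, or_false] at hG
  rcases hG with rfl | rfl | rfl | rfl | rfl | rfl | rfl | rfl <;>
  exact fun a => by revert a; decide

end SK

theorem mainTheorem4 :
    -- all graphs of the expansion are filled
    (∀ G ∈ SK.expansionGraphs, G.Filled) ∧
    -- the infinite-volume limit defining `α` exists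
    (∀ β : ℝ, 0 ≤ β → Tendsto (fun N : ℕ => SK.alphaN N β) atTop (𝓝 (SK.alpha β))) ∧
    -- the remainder is `O(β ^ 12)`, uniformly on bounded intervals
    (∀ B : ℝ, 0 < B → ∃ C : ℝ, ∀ β : ℝ, 0 ≤ β → β ≤ B →
      limsup (fun N : ℕ => |SK.alpha β - SK.expansion β (SK.graphAvg N β)|) atTop
        ≤ C * β ^ 12) ∧
    -- graded form: the remainder is `O(β ^ 12)` times a filled average with six lines
    ∃ S : Set ℝ, S.Countable ∧ ∀ B : ℝ, 0 < B → ∃ C : ℝ, ∀ β : ℝ, 0 ≤ β → β ≤ B → β ∉ S →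
      (∀ g : SK.OverlapGraph → ℝ,
        (∀ G ∈ SK.expansionGraphs,
          Tendsto (fun N : ℕ => SK.graphAvg N β G) atTop (𝓝 (g G))) →
        |SK.alpha β - SK.expansion β g|
          ≤ C * β ^ 12 *
            limsup (fun N : ℕ => SK.graphAvg N β SK.OverlapGraph.sixfoldLine) atTop) ∧
      limsup (fun n : ℕ => |SK.alpha β - SK.expansion β (SK.cesaroAvg n β)|) atTop
        ≤ C * β ^ 12 *
          limsup (fun n : ℕ => SK.cesaroAvg n β SK.OverlapGraph.sixfoldLine) atTop := by
  refine ⟨fun G hG => SK.filled_of_mem_expansionGraphs hG, fun β hβ => SK.tendsto_alphaN hβ,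
    fun B _ => SK.exists_limsup_abs_sub_expansion_le B, ?_⟩
  obtain ⟨S, hS, hF⟩ := SK.exists_countable_fluctNegligible
  refine ⟨S, hS, fun B _ => ?_⟩
  obtain ⟨C, hC, h⟩ := SK.exists_abs_increment_sub_expansion_le B
  refine ⟨C, fun β h0 hB hβS => ?_⟩
  rcases h0.eq_or_lt with rfl | hβ
  -- `FluctNegligible` is available only for β > 0; at β = 0 both α and the expansion equal log 2.
  · simp [SK.alpha_zero, SK.expansion_zero_left]
  obtain ⟨r, hr, hb⟩ := h β hβ hB (hF β hβ hβS)
  have hK : 0 ≤ C * β ^ 12 := by positivity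
  have hc := SK.limsup_cesaro_expansion_le h0 hK hr hb
  exact ⟨fun g hg => SK.abs_alpha_sub_expansion_le hK hc hg, hc⟩
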